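/- There are $m$ identical processors of variable speed and $n\ge 1$ rigid parallel jobs. Job $j$ has a size $size_j\in\{1,\dots,m\}$, a work $W_j>0$, a release time $r_j$ and a deadline $d_j>r_j$. In a preemptive schedule without migration, job $j$ is given one fixed set of exactly $size_j$ processors, all of which process it simultaneously and at the same speed $s_j(t)\ge 0$ at time $t$; the job may be interrupted and resumed on the same processors. The schedule is feasible if $s_j(t)=0$ outside $[r_j,d_j)$, $\int s_j(t)\,dt=W_j$ for every $j$, and at every time each processor executes at most one job. Its energy is $E=\sum_j size_j\int s_j(t)^{\alpha}\,dt$, where $\alpha>1$. A schedule is $\rho$-approximate if it is feasible and its energy is at most $\rho$ times the energy of every feasible schedule. **Theorem.** (a) There is an algorithm that, for every $m$, every $n\ge1$ and every instance in which all jobs have a common release time ($r_j=r$ for all $j$, individual deadlines $d_j$), finds in $O(n^2)$ time a schedule that is $\left(3-\frac{4}{m+1}\right)^{\alpha-1}$-approximate for the preemptive problem without migration. (b) The same holds for the instances in which all jobs have a common deadline ($d_j=d$ for all $j$, individual release times $r_j$). Time is the number of steps on a real RAM: arithmetic operations $+,-,\times,/$ and comparisons on real numbers, addition, subtraction and comparison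 of natural numbers, their conversion to reals, and array accesses have unit cost. The output lists, for each job, ranges of consecutive processors and the time intervals, with speeds, in which it is executed. The algorithm and the constant in $O(n^2)$ depend neither on $m$ nor on $\alpha$, and the schedule found does not depend on $\alpha$. -/

import Mathlib

open MeasureTheory

namespace SpeedScaling

/-! ### Instances, schedules, energy -/

/-- An instance with `n` rigid parallel jobs: `m` identical processors; job `j` needs `size j`
processors simultaneously, has release time `release j`, deadline `deadline j` and
processing volume `work j`. -/
structure RigidInstance (n : ℕ) where
  m : ℕ
  size : Fin n → ℕ
  release : Fin n → ℝ
  deadline : Fin n → ℝ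
  work : Fin n → ℝ
  one_le_size : ∀ j, 1 ≤ size j
  size_le : ∀ j, size j ≤ m
  release_lt_deadline : ∀ j, release j < deadline j
  work_pos : ∀ j, 0 < work j

/-- A preemptive schedule without migration: every job `j` gets one set of processors, fixed for
the whole schedule, and at time `t` all of these process `j` at the same speed `speed j t`
(speed `0`: the job is not being executed at time `t`). -/
structure PmtnSchedule {n : ℕ} (I : RigidInstance n) where
  procs : Fin n → Finset (Fin I.m)
  speed : Fin n → ℝ → ℝ

namespace PmtnSchedule

variable {n : ℕ} {I : RigidInstance n}

/-- Feasibility of a schedule. -/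
structure Feasible (S : PmtnSchedule I) : Prop where
  /-- every job uses exactly the required number of processors -/
  card_procs : ∀ j, (S.procs j).card = I.size j
  measurable_speed : ∀ j, Measurable (S.speed j)
  speed_nonneg : ∀ j t, 0 ≤ S.speed j t
  /-- a job is executed only between its release time and its deadline -/
  window : ∀ j t, t ∉ Set.Ico (I.release j) (I.deadline j) → S.speed j t = 0
  /-- the whole volume of every job is processed -/
  work_done : ∀ j, ∫⁻ t, ENNReal.ofReal (S.speed j t) = ENNReal.ofReal (I.work j)
  /-- at any time each processor executes at most one job -/
  exclusive : ∀ t i j, i ≠ j → 0 < S.speed i t → 0 < S.speed j t →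
    Disjoint (S.procs i) (S.procs j)

/-- Total energy: power `speed ^ α` on each of the `size j` processors that execute job `j`,
integrated over time. -/
noncomputable def energy (α : ℝ) (S : PmtnSchedule I) : ENNReal :=
  ∑ j, (I.size j : ENNReal) * ∫⁻ t, ENNReal.ofReal (S.speed j t ^ α)

/-- `S` is a `ρ`-approximate schedule: feasible, and its energy is at most `ρ` times the energy of
every feasible schedule. -/
def IsApproximate (α ρ : ℝ) (S : PmtnSchedule I) : Prop :=
  S.Feasible ∧
    ∀ S' : PmtnSchedule I, S'.Feasible → S.energy α ≤ ENNReal.ofReal ρ * S'.energy α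

end PmtnSchedule

/-! ### A real RAM

Programs work on finitely many arrays (a program names them by literals) of natural numbers and of
real numbers. Natural numbers are used for indices and counters and can be added, subtracted
(truncated at `0`) and compared; real numbers can be added, subtracted, multiplied, divided
(with `x / 0 = 0`) and compared. There is no rounding of reals and no real constant other than the
natural numbers. Every operation and every memory access costs one step. -/

/-- Contents of the memory: `nat a i` / `real a i` is cell `i` of the natural / real array `a`. -/
structure Memory where
  nat : ℕ → ℕ → ℕ
  real : ℕ → ℕ → ℝ

namespace Memory

def setNat (s : Memory) (a i v : ℕ) : Memory :=
  { s with nat := Function.update s.nat a (Function.update (s.nat a) i v) }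

noncomputable def setReal (s : Memory) (a i : ℕ) (v : ℝ) : Memory :=
  { s with real := Function.update s.real a (Function.update (s.real a) i v) }

end Memory

/-- Natural number expressions. -/
inductive NExp
  | lit (k : ℕ)
  | get (a : ℕ) (i : NExp)
  | add (e f : NExp)
  | sub (e f : NExp)

namespace NExp

def eval (s : Memory) : NExp → ℕ
  | lit k => k
  | get a i => s.nat a (i.eval s)
  | add e f => e.eval s + f.eval s
  | sub e f => e.eval s - f.eval s

def cost : NExp → ℕ
  | lit _ => 1
  | get _ i => i.cost + 1
  | add e f => e.cost + f.cost + 1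
  | sub e f => e.cost + f.cost + 1

end NExp

/-- Real number expressions. -/
inductive RExp
  | ofNat (e : NExp)
  | get (a : ℕ) (i : NExp)
  | add (e f : RExp)
  | sub (e f : RExp)
  | mul (e f : RExp)
  | div (e f : RExp)

namespace RExp

noncomputable def eval (s : Memory) : RExp → ℝ
  | ofNat e => (e.eval s : ℝ)
  | get a i => s.real a (i.eval s)
  | add e f => e.eval s + f.eval s
  | sub e f => e.eval s - f.eval s
  | mul e f => e.eval s * f.eval s
  | div e f => e.eval s / f.eval s

def cost : RExp → ℕ
  | ofNat e => e.cost + 1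
  | get _ i => i.cost + 1
  | add e f => e.cost + f.cost + 1
  | sub e f => e.cost + f.cost + 1
  | mul e f => e.cost + f.cost + 1
  | div e f => e.cost + f.cost + 1

end RExp

/-- Tests. -/
inductive BExp
  | natLe (e f : NExp)
  | realLe (e f : RExp)
  | not (b : BExp)
  | and (b c : BExp)

namespace BExp

def Holds (s : Memory) : BExp → Prop
  | natLe e f => e.eval s ≤ f.eval s
  | realLe e f => e.eval s ≤ f.eval s
  | not b => ¬ b.Holds s
  | and b c => b.Holds s ∧ c.Holds s

def cost : BExp → ℕ
  | natLe e f => e.cost + f.cost + 1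
  | realLe e f => e.cost + f.cost + 1
  | not b => b.cost + 1
  | and b c => b.cost + c.cost + 1

end BExp

/-- Programs. `storeNat a i e` and `storeReal a i e` write the value of `e` into cell `i` of
array `a`; `loop b c` is "while `b` do `c`". -/
inductive Program
  | skip
  | storeNat (a : ℕ) (i e : NExp)
  | storeReal (a : ℕ) (i : NExp) (e : RExp)
  | seq (c d : Program)
  | cond (b : BExp) (c d : Program)
  | loop (b : BExp) (c : Program)

/-- `Exec c s t s'`: program `c`, started with memory `s`, halts after exactly `t` steps with
memory `s'`. -/
inductive Exec : Program → Memory → ℕ → Memory → Prop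
  | skip (s : Memory) : Exec .skip s 1 s
  | storeNat (a : ℕ) (i e : NExp) (s : Memory) :
      Exec (.storeNat a i e) s (i.cost + e.cost + 1) (s.setNat a (i.eval s) (e.eval s))
  | storeReal (a : ℕ) (i : NExp) (e : RExp) (s : Memory) :
      Exec (.storeReal a i e) s (i.cost + e.cost + 1) (s.setReal a (i.eval s) (e.eval s))
  | seq {c d : Program} {s s₁ s₂ : Memory} {t₁ t₂ : ℕ} (hc : Exec c s t₁ s₁)
      (hd : Exec d s₁ t₂ s₂) : Exec (.seq c d) s (t₁ + t₂) s₂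
  | cond_true {b : BExp} {c d : Program} {s s₁ : Memory} {t : ℕ} (hb : b.Holds s)
      (hc : Exec c s t s₁) : Exec (.cond b c d) s (b.cost + t) s₁
  | cond_false {b : BExp} {c d : Program} {s s₁ : Memory} {t : ℕ} (hb : ¬ b.Holds s)
      (hd : Exec d s t s₁) : Exec (.cond b c d) s (b.cost + t) s₁
  | loop_false {b : BExp} {c : Program} {s : Memory} (hb : ¬ b.Holds s) :
      Exec (.loop b c) s b.cost s
  | loop_true {b : BExp} {c : Program} {s s₁ s₂ : Memory} {t₁ t₂ : ℕ} (hb : b.Holds s)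
      (hc : Exec c s t₁ s₁) (hl : Exec (.loop b c) s₁ t₂ s₂) :
      Exec (.loop b c) s (b.cost + t₁ + t₂) s₂

/-! ### Input and output conventions -/

/-- The natural numbers `v 0, …, v (n - 1)` as the contents of an array, followed by zeros. -/
def natArray {n : ℕ} (v : Fin n → ℕ) : ℕ → ℕ :=
  fun i => if h : i < n then v ⟨i, h⟩ else 0

/-- The real numbers `v 0, …, v (n - 1)` as the contents of an array, followed by zeros. -/
noncomputable def realArray {n : ℕ} (v : Fin n → ℝ) : ℕ → ℝ :=
  fun i => if h : i < n then v ⟨i, h⟩ else 0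

/-- The initial memory. Natural array `0` holds `n` and `m`, natural array `1` the job sizes;
real arrays `0`, `1`, `2` hold the release times, deadlines and volumes. All else is `0`. -/
noncomputable def inputMemory {n : ℕ} (I : RigidInstance n) : Memory where
  nat a := match a with
    | 0 => natArray ![n, I.m]
    | 1 => natArray I.size
    | _ => fun _ => 0
  real a := match a with
    | 0 => realArray I.release
    | 1 => realArray I.deadline
    | 2 => realArray I.work
    | _ => fun _ => 0

/-- The schedule written in the memory, as two lists.
* Cell `0` of natural array `2` is the length of a list of processor ranges; its `k`-th entry says
  that job `nat 3 k` uses the processors `q` with `nat 4 k ≤ q < nat 5 k`.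
* Cell `1` of natural array `2` is the length of a list of execution intervals; its `k`-th entry
  says that job `nat 6 k` is executed during `[real 3 k, real 4 k)` at speed `real 5 k`. -/
noncomputable def outputSchedule {n : ℕ} (I : RigidInstance n) (s : Memory) :
    PmtnSchedule I where
  procs j := Finset.univ.filter fun q : Fin I.m =>
    ∃ k < s.nat 2 0, s.nat 3 k = (j : ℕ) ∧ s.nat 4 k ≤ (q : ℕ) ∧ (q : ℕ) < s.nat 5 k
  speed j t := ∑ k ∈ (Finset.range (s.nat 2 1)).filter (fun k => s.nat 6 k = (j : ℕ)),
    Set.indicator (Set.Ico (s.real 3 k) (s.real 4 k)) (fun _ => s.real 5 k) t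

end SpeedScaling

open SpeedScaling

/-! Lower bound. Windows with a common end point are nested, so the jobs can be ordered by window
length `L 0 ≤ L 1 ≤ …`. Let `z k` be the sizes. In a feasible schedule the time `x i` during which
job `i` runs is at most `L i`, and since the jobs up to `i` run inside the window of job `i`, `∑ k ≤
i, z k * x k ≤ m * L i`. Minimising the energy over durations under these linear constraints alone
is a convex problem. `OptimalDurations` describes durations `p` together with a dual certificate
that is phrased in speeds instead of powers: a nonincreasing threshold `θ` that drops only behind a
tight constraint, with `W i / p i = θ i` unless `p i = L i`. As `f ↦ f ^ α` is monotone, the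
thresholds `θ ^ α` certify optimality for every exponent at once; this is why the schedule does not
depend on `α`. Tangents of `f ^ α` at the speeds `W i / p i` and an Abel summation turn the
certificate into `OptimalDurations.le_energy`.

Computing `p`. A block of consecutive jobs shares one speed threshold, except that no job may last
longer than its window. The threshold of a block comes from one scan of its jobs by decreasing
density `W / L` (`Filling.level`). Adjacent blocks whose thresholds fail to decrease are pooled
(`Block.merge`), until the blocks form a chain that yields the certificate
(`BlockChain.optimalDurations`).

Rounding. Put `ρ = 3 - 4 / (m + 1)`, so that `(m + 1) * ρ = 3 * m - 1`, and run each job `ρ` times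
faster than in the relaxation; this multiplies the energy by exactly `ρ ^ (α - 1)`. Jobs with `2 * z
≤ m + 1` are list scheduled by window length in a virtual time. While such a job waits, at least `(m
+ 1) / 2` processors are busy (`Listing.advance`). A big job also occupies at least that many; it is
inserted when all earlier small jobs are finished, and it stops every small job still running. A
small job is thus delayed only by big jobs that precede it in the list. Comparing volumes shows that
each job ends within its window (`ListSchedule.end_add_B_le`, `ListSchedule.piece_window`).

Time. Sorting by rank is quadratic; pooling computes linearly many thresholds at linear cost each;
the list schedule makes linearly many steps of linear cost; every job is written as at most `n`
intervals. For a common deadline the intervals are reflected in time when they are written, and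
nothing else changes. -/

namespace SpeedScaling

/-! ### The lower bound -/

/-- The tangent of `f ↦ f ^ α` at `s`. -/
theorem tangent_le_rpow {α s f : ℝ} (hα : 1 < α) (hs : 0 < s) (hf : 0 ≤ f) :
    α * s ^ (α - 1) * f ≤ f ^ α + (α - 1) * s ^ α := by
  have h := one_add_mul_self_le_rpow_one_add (s := f / s - 1) (by have := div_nonneg hf hs.le; linarith)
    hα.le
  have h1 : (1 + (f / s - 1)) ^ α = f ^ α / s ^ α := by
    rw [add_sub_cancel, Real.div_rpow hf hs.le]
  rw [h1, le_div_iff₀ (Real.rpow_pos_of_pos hs α)] at h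
  have h2 : s ^ α = s ^ (α - 1) * s := by
    rw [← Real.rpow_add_one hs.ne', sub_add_cancel]
  have h3 : (1 + α * (f / s - 1)) * s ^ α = α * s ^ (α - 1) * f - (α - 1) * s ^ α := by
    have : f / s * s ^ α = s ^ (α - 1) * f := by
      rw [h2]; field_simp
    linear_combination α * this
  linarith

/-! ### Execution times in a feasible schedule -/

namespace PmtnSchedule

variable {n : ℕ} {I : RigidInstance n} {S : PmtnSchedule I}

/-- The times at which job `j` is executed. -/
def busy (S : PmtnSchedule I) (j : Fin n) : Set ℝ := {t | 0 < S.speed j t}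

theorem Feasible.measurableSet_busy (h : S.Feasible) (j : Fin n) : MeasurableSet (S.busy j) :=
  measurableSet_lt measurable_const (h.measurable_speed j)

theorem Feasible.busy_subset (h : S.Feasible) (j : Fin n) :
    S.busy j ⊆ Set.Ico (I.release j) (I.deadline j) := by
  intro t ht
  by_contra hn
  exact absurd (h.window j t hn) (ne_of_gt ht)

theorem Feasible.volume_busy_le (h : S.Feasible) (j : Fin n) :
    volume (S.busy j) ≤ ENNReal.ofReal (I.deadline j - I.release j) := by
  simpa using measure_mono (μ := volume) (h.busy_subset j)

theorem Feasible.volume_busy_ne_top (h : S.Feasible) (j : Fin n) : volume (S.busy j) ≠ ⊤ :=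
  ne_top_of_le_ne_top ENNReal.ofReal_ne_top (h.volume_busy_le j)

theorem Feasible.sum_size_le (h : S.Feasible) (t : ℝ) (A : Finset (Fin n))
    (hA : ∀ j ∈ A, t ∈ S.busy j) : ∑ j ∈ A, I.size j ≤ I.m := by
  have : (A.biUnion S.procs).card = ∑ j ∈ A, (S.procs j).card := by
    refine Finset.card_biUnion fun i hi j hj hij => ?_
    exact h.exclusive t i j hij (hA i hi) (hA j hj)
  calc ∑ j ∈ A, I.size j = ∑ j ∈ A, (S.procs j).card := by simp [h.card_procs]
    _ = (A.biUnion S.procs).card := this.symm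
    _ ≤ I.m := by simpa using Finset.card_le_univ (A.biUnion S.procs)

/-- Jobs with windows inside `[a, b)` occupy at most the volume `m * (b - a)`. -/
theorem Feasible.sum_size_mul_volume_busy_le (h : S.Feasible) (A : Finset (Fin n)) {a b : ℝ}
    (hA : ∀ j ∈ A, Set.Ico (I.release j) (I.deadline j) ⊆ Set.Ico a b) :
    ∑ j ∈ A, (I.size j : ENNReal) * volume (S.busy j) ≤ (I.m : ENNReal) * ENNReal.ofReal (b - a) := by
  classical
  have h1 : ∀ j ∈ A, (I.size j : ENNReal) * volume (S.busy j)
      = ∫⁻ t in Set.Ico a b, (S.busy j).indicator (fun _ => (I.size j : ENNReal)) t := by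
    intro j hj
    rw [lintegral_indicator (h.measurableSet_busy j), lintegral_const,
      Measure.restrict_apply_univ, Measure.restrict_apply (h.measurableSet_busy j),
      Set.inter_eq_left.2 ((h.busy_subset j).trans (hA j hj))]
  rw [Finset.sum_congr rfl h1, ← lintegral_finsetSum]
  · calc _ ≤ ∫⁻ _ in Set.Ico a b, (I.m : ENNReal) := by
          refine lintegral_mono fun t => ?_
          have : ∑ j ∈ A, (S.busy j).indicator (fun _ => (I.size j : ENNReal)) t
              = ((∑ j ∈ A.filter (fun j => t ∈ S.busy j), I.size j : ℕ) : ENNReal) := by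
            rw [Finset.sum_filter]
            push_cast
            refine Finset.sum_congr rfl fun j _ => ?_
            simp [Set.indicator_apply]
          simp only [this]
          exact_mod_cast h.sum_size_le t _ (by simp)
      _ = _ := by simp
  · intro j hj
    exact measurable_const.indicator (h.measurableSet_busy j)

/-- Integrate the tangent inequality over time. Its constant term is needed only where the job runs,
so it is charged to the busy time; `s` is free here and will be the speed of the job in the
relaxation. -/
theorem Feasible.tangent_le_lintegral (h : S.Feasible) (j : Fin n) {α s : ℝ} (hα : 1 < α)
    (hs : 0 < s) :
    ENNReal.ofReal (α * s ^ (α - 1) * I.work j) ≤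
      (∫⁻ t, ENNReal.ofReal (S.speed j t ^ α))
        + ENNReal.ofReal ((α - 1) * s ^ α) * volume (S.busy j) := by
  have hc : 0 ≤ α * s ^ (α - 1) := by positivity
  have hc' : 0 ≤ (α - 1) * s ^ α := mul_nonneg (by linarith) (by positivity)
  have hm : Measurable fun t => ENNReal.ofReal (S.speed j t ^ α) :=
    ((h.measurable_speed j).pow_const α).ennreal_ofReal
  rw [ENNReal.ofReal_mul hc, ← h.work_done j,
    ← lintegral_const_mul _ (h.measurable_speed j).ennreal_ofReal,
    ← setLIntegral_const, ← lintegral_indicator (h.measurableSet_busy j),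
    ← lintegral_add_left hm]
  refine lintegral_mono fun t => ?_
  by_cases ht : t ∈ S.busy j
  · simp only [Set.indicator_of_mem ht]
    rw [← ENNReal.ofReal_mul hc, ← ENNReal.ofReal_add (Real.rpow_nonneg (h.speed_nonneg j t) _) hc']
    exact ENNReal.ofReal_le_ofReal (tangent_le_rpow hα hs (h.speed_nonneg j t))
  · have : S.speed j t = 0 := le_antisymm (not_lt.1 ht) (h.speed_nonneg j t)
    simp [this]

end PmtnSchedule

/-! ### The relaxed problem and its certificate -/

/-- Abel summation: a nonincreasing price, dropping only where the constraint is tight. -/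
theorem sum_price_mul_nonneg {n : ℕ} {c u : ℕ → ℝ} (hc : ∀ i < n, c (i + 1) ≤ c i)
    (hn : c n = 0)
    (hu : ∀ i < n, c (i + 1) = c i ∨ 0 ≤ ∑ k ∈ Finset.range (i + 1), u k) :
    0 ≤ ∑ i ∈ Finset.range n, c i * u i := by
  have key : ∀ j ≤ n, c j * ∑ k ∈ Finset.range j, u k ≤ ∑ i ∈ Finset.range j, c i * u i := by
    intro j
    induction j with
    | zero => simp
    | succ j ih =>
      intro hj
      have h1 := ih (by omega)
      rw [Finset.sum_range_succ (fun i => c i * u i)]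
      have h2 : c (j + 1) * ∑ k ∈ Finset.range (j + 1), u k
          ≤ c j * ∑ k ∈ Finset.range (j + 1), u k := by
        rcases hu j (by omega) with h | h
        · rw [h]
        · exact mul_le_mul_of_nonneg_right (hc j (by omega)) h
      rw [Finset.sum_range_succ, mul_add] at h2
      rw [Finset.sum_range_succ, mul_add]
      linarith
  simpa [hn] using key n le_rfl

/-- Durations `p` of the jobs that solve the relaxed problem "the first `i + 1` jobs have volume
at most `m * L i`, and job `i` has duration at most `L i`", with a certificate `θ` of optimality
that is common to all exponents. -/
structure OptimalDurations (n m : ℕ) (z : ℕ → ℕ) (L W p : ℕ → ℝ) : Prop where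
  pos : ∀ i < n, 0 < p i
  le : ∀ i < n, p i ≤ L i
  sum_le : ∀ i < n, ∑ k ∈ Finset.range (i + 1), (z k : ℝ) * p k ≤ m * L i
  exists_price : ∃ θ : ℕ → ℝ, θ n = 0 ∧ ∀ i < n, θ i ≤ W i / p i ∧ (p i = L i ∨ W i / p i = θ i) ∧
    0 ≤ θ i ∧ θ (i + 1) ≤ θ i ∧
    (θ (i + 1) = θ i ∨ ∑ k ∈ Finset.range (i + 1), (z k : ℝ) * p k = m * L i)

/-- First-order optimality of `p` against any other point `x` of the relaxation. Replacing the
speeds by the thresholds only lowers the sum, because they differ only where `p i = L i ≥ x i`; for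
the thresholds the claim is Abel summation, since at each drop the constraint is tight for `p`. -/
theorem OptimalDurations.sum_speed_mul_nonneg {n m : ℕ} {z : ℕ → ℕ} {L W p x : ℕ → ℝ}
    (h : OptimalDurations n m z L W p) {α : ℝ} (hα : 1 < α)
    (hxL : ∀ i < n, x i ≤ L i)
    (hx : ∀ i < n, ∑ k ∈ Finset.range (i + 1), (z k : ℝ) * x k ≤ m * L i) :
    0 ≤ ∑ i ∈ Finset.range n, (z i : ℝ) * ((W i / p i) ^ α * (p i - x i)) := by
  obtain ⟨θ, hn, hθ⟩ := h.exists_price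
  have hα0 : α ≠ 0 := by linarith
  have h1 : 0 ≤ ∑ i ∈ Finset.range n, θ i ^ α * (z i * (p i - x i)) := by
    refine sum_price_mul_nonneg (c := fun i => θ i ^ α) (fun i hi => ?_)
      (by simp [hn, Real.zero_rpow hα0]) fun i hi => ?_
    · obtain ⟨-, -, h0, h1, -⟩ := hθ i hi
      have : 0 ≤ θ (i + 1) := by
        rcases Nat.lt_or_ge (i + 1) n with h | h
        · exact (hθ _ h).2.2.1
        · have : i + 1 = n := by omega
          rw [this, hn]
      exact Real.rpow_le_rpow this h1 (by linarith)
    · obtain ⟨-, -, h0, h1, h2⟩ := hθ i hi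
      rcases h2 with h2 | h2
      · left; simp [h2]
      · right
        have := hx i hi
        simp only [mul_sub, Finset.sum_sub_distrib]
        linarith
  refine h1.trans (Finset.sum_le_sum fun i hi => ?_)
  have hi := Finset.mem_range.1 hi
  obtain ⟨h0, h2, h3, -, -⟩ := hθ i hi
  rcases h2 with h2 | h2
  · have : θ i ^ α ≤ (W i / p i) ^ α := Real.rpow_le_rpow h3 h0 (by linarith)
    have hx' : 0 ≤ p i - x i := by have := hxL i hi; linarith
    have hz : (0 : ℝ) ≤ z i := by positivity
    nlinarith [mul_nonneg hz (mul_nonneg (sub_nonneg.2 this) hx')]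
  · rw [h2]; linarith

/-- The optimum of the relaxed problem bounds the energy of every feasible schedule. -/
theorem OptimalDurations.le_energy {n : ℕ} {I : RigidInstance n} (e : Equiv.Perm (Fin n))
    {z : ℕ → ℕ} {L W p : ℕ → ℝ} (h : OptimalDurations n I.m z L W p)
    (hz : ∀ a : Fin n, z a = I.size (e a))
    (hL : ∀ a : Fin n, L a = I.deadline (e a) - I.release (e a))
    (hW : ∀ a : Fin n, W a = I.work (e a))
    (hwin : ∀ a b : Fin n, a ≤ b → Set.Ico (I.release (e a)) (I.deadline (e a)) ⊆
      Set.Ico (I.release (e b)) (I.deadline (e b)))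
    {α : ℝ} (hα : 1 < α) {S : PmtnSchedule I} (hS : S.Feasible) :
    ENNReal.ofReal (∑ i ∈ Finset.range n, z i * p i * (W i / p i) ^ α) ≤ S.energy α := by
  by_cases htop : S.energy α = ⊤
  · simp [htop]
  set x : ℕ → ℝ := fun i => if hi : i < n then (volume (S.busy (e ⟨i, hi⟩))).toReal else 0 with hx
  have hxa : ∀ a : Fin n, x a = (volume (S.busy (e a))).toReal := fun a => by simp [hx]
  have hfin : ∀ j, (I.size j : ENNReal) * ∫⁻ t, ENNReal.ofReal (S.speed j t ^ α) ≠ ⊤ := by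
    intro j hj
    exact htop (ENNReal.sum_eq_top.2 ⟨j, Finset.mem_univ _, hj⟩)
  have hfin' : ∀ j, ∫⁻ t, ENNReal.ofReal (S.speed j t ^ α) ≠ ⊤ := by
    intro j hj
    apply hfin j
    rw [hj, ENNReal.mul_top]
    have := I.one_le_size j
    exact_mod_cast (by omega : I.size j ≠ 0)
  have hWpos : ∀ i < n, 0 < W i := fun i hi => by
    have := hW ⟨i, hi⟩; simp only at this; rw [this]; exact I.work_pos _
  have hspeed : ∀ i < n, 0 < W i / p i := fun i hi => div_pos (hWpos i hi) (h.pos i hi)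
  have hxL : ∀ i < n, x i ≤ L i := by
    intro i hi
    have h1 := hS.volume_busy_le (e ⟨i, hi⟩)
    have h2 := hL ⟨i, hi⟩
    have h3 := hxa ⟨i, hi⟩
    simp only at h2 h3
    rw [h2, h3]
    refine ENNReal.toReal_le_of_le_ofReal ?_ h1
    linarith [I.release_lt_deadline (e ⟨i, hi⟩)]
  have hxsum : ∀ i < n, ∑ k ∈ Finset.range (i + 1), (z k : ℝ) * x k ≤ I.m * L i := by
    intro i hi
    -- The jobs up to position `i` have windows inside that of job `i`, which offers the volume `m *
    -- L i`.
    have hle : ∀ j ∈ (Finset.univ.filter fun a : Fin n => a ≤ ⟨i, hi⟩).map e.toEmbedding,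
        Set.Ico (I.release j) (I.deadline j) ⊆
          Set.Ico (I.release (e ⟨i, hi⟩)) (I.deadline (e ⟨i, hi⟩)) := by
      intro j hj
      simp only [Finset.mem_map, Finset.mem_filter, Finset.mem_univ, true_and] at hj
      obtain ⟨a, ha, rfl⟩ := hj
      exact hwin a _ ha
    have h1 := hS.sum_size_mul_volume_busy_le _ hle
    rw [Finset.sum_map] at h1
    have h2 : (0 : ℝ) ≤ I.deadline (e ⟨i, hi⟩) - I.release (e ⟨i, hi⟩) := by
      linarith [I.release_lt_deadline (e ⟨i, hi⟩)]
    have h3 := ENNReal.toReal_mono (by finiteness) h1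
    rw [ENNReal.toReal_mul, ENNReal.toReal_ofReal h2, ENNReal.toReal_sum (by
      intro a _; exact ENNReal.mul_ne_top (by simp) (hS.volume_busy_ne_top _))] at h3
    have h4 := hL ⟨i, hi⟩
    simp only at h4
    rw [h4]
    refine le_trans (le_of_eq ?_) h3
    symm
    rw [Finset.sum_filter]
    have h5 : ∀ a : Fin n, (if a ≤ ⟨i, hi⟩ then
        ((I.size (e.toEmbedding a) : ENNReal) * volume (S.busy (e.toEmbedding a))).toReal else 0)
        = (fun k : ℕ => if k ≤ i then (z k : ℝ) * x k else 0) a := by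
      intro a
      simp [ENNReal.toReal_mul, hxa, hz, Fin.le_def]
    rw [Finset.sum_congr rfl fun a _ => h5 a, Fin.sum_univ_eq_sum_range (fun k : ℕ => if k ≤ i then (z k : ℝ) * x k else 0),
      ← Finset.sum_filter]
    refine Finset.sum_congr ?_ fun _ _ => rfl
    ext k
    simp
    omega
  have hcert := h.sum_speed_mul_nonneg hα hxL hxsum
  have hjob : ∀ a : Fin n, (z a : ℝ) * (α * (W a / p a) ^ (α - 1) * W a)
      ≤ ((I.size (e a) : ENNReal) * ∫⁻ t, ENNReal.ofReal (S.speed (e a) t ^ α)).toReal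
        + z a * ((α - 1) * (W a / p a) ^ α * x a) := by
    intro a
    have hs := hspeed a a.2
    have h1 := hS.tangent_le_lintegral (e a) hα hs
    have h2 := ENNReal.toReal_mono (by
      exact ENNReal.add_ne_top.2 ⟨hfin' _, ENNReal.mul_ne_top ENNReal.ofReal_ne_top
        (hS.volume_busy_ne_top _)⟩) h1
    rw [ENNReal.toReal_add (hfin' _) (ENNReal.mul_ne_top ENNReal.ofReal_ne_top
        (hS.volume_busy_ne_top _)), ENNReal.toReal_mul, ENNReal.toReal_ofReal, ENNReal.toReal_ofReal,
        ← hxa, ← hW] at h2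
    · rw [ENNReal.toReal_mul, ENNReal.toReal_natCast, ← hz, ← mul_add]
      exact mul_le_mul_of_nonneg_left h2 (by positivity)
    · exact mul_nonneg (by linarith) (by positivity)
    · exact mul_nonneg (mul_nonneg (by linarith) (by positivity)) (I.work_pos _).le
  have hsum := Finset.sum_le_sum fun a (_ : a ∈ Finset.univ) => hjob a
  rw [Finset.sum_add_distrib, ← ENNReal.toReal_sum (fun a _ => hfin _),
    Equiv.sum_comp e (fun j => (I.size j : ENNReal) * ∫⁻ t, ENNReal.ofReal (S.speed j t ^ α)),
    Fin.sum_univ_eq_sum_range (fun i => (z i : ℝ) * (α * (W i / p i) ^ (α - 1) * W i)),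
    Fin.sum_univ_eq_sum_range (fun i => (z i : ℝ) * ((α - 1) * (W i / p i) ^ α * x i))] at hsum
  rw [← ENNReal.ofReal_toReal htop]
  refine ENNReal.ofReal_le_ofReal ?_
  change _ ≤ _ + _ at hsum
  -- With `s = W / p` one has `s ^ (α - 1) * W = s ^ α * p`. The sum of the tangent bounds is
  -- therefore the relaxed optimum, plus the terms in the busy times `x` that cancel, plus `α - 1`
  -- times the sum that the certificate makes nonnegative.
  have hid : ∑ i ∈ Finset.range n, (z i : ℝ) * (α * (W i / p i) ^ (α - 1) * W i)
      = ∑ i ∈ Finset.range n, z i * p i * (W i / p i) ^ α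
        + ∑ i ∈ Finset.range n, (z i : ℝ) * ((α - 1) * (W i / p i) ^ α * x i)
        + (α - 1) * ∑ i ∈ Finset.range n, (z i : ℝ) * ((W i / p i) ^ α * (p i - x i)) := by
    rw [Finset.mul_sum, ← Finset.sum_add_distrib, ← Finset.sum_add_distrib]
    refine Finset.sum_congr rfl fun i hi => ?_
    have hi := Finset.mem_range.1 hi
    have h1 : (W i / p i) ^ α = (W i / p i) ^ (α - 1) * (W i / p i) := by
      rw [← Real.rpow_add_one (hspeed i hi).ne', sub_add_cancel]
    have h2 : (W i / p i) ^ (α - 1) * W i = (W i / p i) ^ α * p i := by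
      rw [h1]; field_simp [(h.pos i hi).ne']
    linear_combination (z i : ℝ) * α * h2
  have : S.energy α = ∑ j, (I.size j : ENNReal) * ∫⁻ t, ENNReal.ofReal (S.speed j t ^ α) := rfl
  rw [this]
  nlinarith [mul_nonneg (by linarith : (0 : ℝ) ≤ α - 1) hcert]

/-! ### Schedules made of finitely many intervals -/

/-- The half-open intervals `[a, b)` and `[c, d)` are disjoint. -/
def Separate (a b c d : ℝ) : Prop := b ≤ a ∨ d ≤ c ∨ b ≤ c ∨ d ≤ a

theorem Separate.disjoint {a b c d : ℝ} (h : Separate a b c d) :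
    Disjoint (Set.Ico a b) (Set.Ico c d) := by
  rw [Set.disjoint_left]
  rintro t ⟨h1, h2⟩ ⟨h3, h4⟩
  rcases h with h | h | h | h <;> linarith

/-- The speed of a job that runs at the constant speed `v` in the intervals `[lo g, hi g)`. -/
noncomputable def pieceSpeed (N : ℕ) (lo hi : ℕ → ℝ) (v t : ℝ) : ℝ :=
  ∑ g ∈ Finset.range N, Set.indicator (Set.Ico (lo g) (hi g)) (fun _ => v) t

/-- At most one interval contains `t`. Quantifying over `v` inside each alternative allows the same
interval to be used for the speed and for its power. -/
theorem pieceSpeed_cases {N : ℕ} {lo hi : ℕ → ℝ}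
    (hsep : ∀ g < N, ∀ g' < N, g ≠ g' → Separate (lo g) (hi g) (lo g') (hi g')) (t : ℝ) :
    (∃ g < N, t ∈ Set.Ico (lo g) (hi g) ∧ ∀ v, pieceSpeed N lo hi v t = v) ∨
      (∀ g < N, t ∉ Set.Ico (lo g) (hi g)) ∧ ∀ v, pieceSpeed N lo hi v t = 0 := by
  by_cases h : ∃ g < N, t ∈ Set.Ico (lo g) (hi g)
  · obtain ⟨g, hg, ht⟩ := h
    refine Or.inl ⟨g, hg, ht, fun v => ?_⟩
    rw [pieceSpeed, Finset.sum_eq_single g]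
    · simp [ht]
    · intro g' hg' hne
      refine Set.indicator_of_notMem (fun ht' => ?_) _
      exact Set.disjoint_left.1 (hsep g hg g' (Finset.mem_range.1 hg') hne.symm).disjoint ht ht'
    · intro h; exact absurd (Finset.mem_range.2 hg) h
  · push Not at h
    refine Or.inr ⟨h, fun v => Finset.sum_eq_zero fun g hg => ?_⟩
    exact Set.indicator_of_notMem (h g (Finset.mem_range.1 hg)) _

theorem measurable_pieceSpeed (N : ℕ) (lo hi : ℕ → ℝ) (v : ℝ) :
    Measurable (pieceSpeed N lo hi v) :=
  Finset.measurable_sum _ fun _ _ => measurable_const.indicator measurableSet_Ico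

theorem lintegral_pieceSpeed {N : ℕ} {lo hi : ℕ → ℝ} {v : ℝ} (hv : 0 ≤ v)
    (hle : ∀ g < N, lo g ≤ hi g) :
    ∫⁻ t, ENNReal.ofReal (pieceSpeed N lo hi v t)
      = ENNReal.ofReal (v * ∑ g ∈ Finset.range N, (hi g - lo g)) := by
  have h1 : ∀ t, ENNReal.ofReal (pieceSpeed N lo hi v t)
      = ∑ g ∈ Finset.range N, (Set.Ico (lo g) (hi g)).indicator (fun _ => ENNReal.ofReal v) t := by
    intro t
    rw [pieceSpeed, ENNReal.ofReal_sum_of_nonneg fun g _ => Set.indicator_nonneg (fun _ _ => hv) t]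
    refine Finset.sum_congr rfl fun g _ => ?_
    by_cases h : t ∈ Set.Ico (lo g) (hi g) <;> simp [h]
  simp_rw [h1]
  rw [lintegral_finsetSum _ fun g _ => measurable_const.indicator measurableSet_Ico,
    Finset.mul_sum, ENNReal.ofReal_sum_of_nonneg fun g hg =>
      mul_nonneg hv (sub_nonneg.2 (hle g (Finset.mem_range.1 hg)))]
  refine Finset.sum_congr rfl fun g _ => ?_
  rw [lintegral_indicator measurableSet_Ico, setLIntegral_const, Real.volume_Ico,
    ENNReal.ofReal_mul hv]

/-- A schedule in which the `a`-th job of a list `e` runs at constant speed in intervals `[lo a g,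
hi a g)`, `g < N a`, of total length `q a`. -/
structure Pieces {n : ℕ} {I : RigidInstance n} (S : PmtnSchedule I) (e : Equiv.Perm (Fin n))
    (W q : ℕ → ℝ) (N : ℕ → ℕ) (lo hi : ℕ → ℕ → ℝ) : Prop where
  card_procs : ∀ j, (S.procs j).card = I.size j
  work : ∀ a : Fin n, W a = I.work (e a)
  pos : ∀ a < n, 0 < q a
  speed : ∀ (a : Fin n) t, S.speed (e a) t = pieceSpeed (N a) (lo a) (hi a) (W a / q a) t
  le : ∀ a < n, ∀ g < N a, lo a g ≤ hi a g
  sum_length : ∀ a < n, ∑ g ∈ Finset.range (N a), (hi a g - lo a g) = q a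
  separate : ∀ a < n, ∀ g < N a, ∀ g' < N a, g ≠ g' →
    Separate (lo a g) (hi a g) (lo a g') (hi a g')
  window : ∀ (a : Fin n), ∀ g < N a, lo a g < hi a g →
    I.release (e a) ≤ lo a g ∧ hi a g ≤ I.deadline (e a)
  exclusive : ∀ a b : Fin n, a ≠ b → ¬ Disjoint (S.procs (e a)) (S.procs (e b)) →
    ∀ g < N a, ∀ g' < N b, Separate (lo a g) (hi a g) (lo b g') (hi b g')

namespace Pieces

variable {n : ℕ} {I : RigidInstance n} {S : PmtnSchedule I} {e : Equiv.Perm (Fin n)}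
  {W q : ℕ → ℝ} {N : ℕ → ℕ} {lo hi : ℕ → ℕ → ℝ}

theorem speed_pos (h : Pieces S e W q N lo hi) (a : Fin n) : 0 < W a / q a :=
  div_pos (by rw [h.work]; exact I.work_pos _) (h.pos a a.2)

theorem exists_of_speed_ne_zero (h : Pieces S e W q N lo hi) (a : Fin n) {t : ℝ}
    (ht : S.speed (e a) t ≠ 0) : ∃ g < N a, t ∈ Set.Ico (lo a g) (hi a g) := by
  rw [h.speed] at ht
  rcases pieceSpeed_cases (h.separate a a.2) t with ⟨g, hg, h1, -⟩ | ⟨-, h2⟩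
  · exact ⟨g, hg, h1⟩
  · exact absurd (h2 _) ht

theorem feasible (h : Pieces S e W q N lo hi) : S.Feasible where
  card_procs := h.card_procs
  measurable_speed j := by
    obtain ⟨a, rfl⟩ := e.surjective j
    rw [funext (h.speed a)]
    exact measurable_pieceSpeed _ _ _ _
  speed_nonneg j t := by
    obtain ⟨a, rfl⟩ := e.surjective j
    rw [h.speed]
    exact Finset.sum_nonneg fun g _ => Set.indicator_nonneg (fun _ _ => (h.speed_pos a).le) t
  window j t ht := by
    obtain ⟨a, rfl⟩ := e.surjective j
    by_contra hne
    obtain ⟨g, hg, h1, h2⟩ := h.exists_of_speed_ne_zero a hne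
    obtain ⟨h3, h4⟩ := h.window a g hg (h1.trans_lt h2)
    exact ht ⟨h3.trans h1, h2.trans_le h4⟩
  work_done j := by
    obtain ⟨a, rfl⟩ := e.surjective j
    simp_rw [h.speed]
    rw [lintegral_pieceSpeed (h.speed_pos a).le (h.le a a.2), h.sum_length a a.2,
      div_mul_cancel₀ _ (h.pos a a.2).ne', h.work]
  exclusive t i j hij hi hj := by
    obtain ⟨a, rfl⟩ := e.surjective i
    obtain ⟨b, rfl⟩ := e.surjective j
    by_contra hd
    obtain ⟨g, hg, h1⟩ := h.exists_of_speed_ne_zero a hi.ne'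
    obtain ⟨g', hg', h2⟩ := h.exists_of_speed_ne_zero b hj.ne'
    exact Set.disjoint_left.1
      (h.exclusive a b (fun hab => hij (by rw [hab])) hd g hg g' hg').disjoint h1 h2

theorem energy (h : Pieces S e W q N lo hi) {z : ℕ → ℕ} (hz : ∀ a : Fin n, z a = I.size (e a))
    {α : ℝ} (hα : 1 < α) :
    S.energy α = ENNReal.ofReal (∑ i ∈ Finset.range n, z i * q i * (W i / q i) ^ α) := by
  have hα0 : α ≠ 0 := by linarith
  have hv : ∀ a : Fin n, 0 ≤ (W a / q a) ^ α := fun a => Real.rpow_nonneg (h.speed_pos a).le _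
  have h1 : ∀ a : Fin n, (I.size (e a) : ENNReal) * ∫⁻ t, ENNReal.ofReal (S.speed (e a) t ^ α)
      = ENNReal.ofReal (z a * q a * (W a / q a) ^ α) := by
    intro a
    -- The power is again piecewise constant on the same intervals, because `0 ^ α = 0` outside
    -- them.
    have h2 : ∀ t, S.speed (e a) t ^ α = pieceSpeed (N a) (lo a) (hi a) ((W a / q a) ^ α) t := by
      intro t
      rw [h.speed]
      rcases pieceSpeed_cases (h.separate a a.2) t with ⟨g, -, -, h2⟩ | ⟨-, h2⟩
      · rw [h2, h2]
      · rw [h2, h2, Real.zero_rpow hα0]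
    simp_rw [h2]
    rw [lintegral_pieceSpeed (hv a) (h.le a a.2), h.sum_length a a.2, ← hz,
      ← ENNReal.ofReal_natCast, ← ENNReal.ofReal_mul (by positivity)]
    congr 1
    ring
  rw [PmtnSchedule.energy, ← Equiv.sum_comp e]
  simp_rw [h1]
  rw [← Fin.sum_univ_eq_sum_range (fun i => (z i : ℝ) * q i * (W i / q i) ^ α),
    ENNReal.ofReal_sum_of_nonneg]
  exact fun a _ => mul_nonneg (mul_nonneg (by positivity) (h.pos a a.2).le) (hv a)

/-- Running every job for `1 / ρ` of its duration in the relaxation costs a factor `ρ ^ (α - 1)`. -/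
theorem isApproximate {p : ℕ → ℝ} {ρ : ℝ} (hρ : 0 < ρ)
    (h : Pieces S e W (fun i => p i / ρ) N lo hi) {z : ℕ → ℕ} {L : ℕ → ℝ}
    (hp : OptimalDurations n I.m z L W p)
    (hz : ∀ a : Fin n, z a = I.size (e a))
    (hL : ∀ a : Fin n, L a = I.deadline (e a) - I.release (e a))
    (hwin : ∀ a b : Fin n, a ≤ b → Set.Ico (I.release (e a)) (I.deadline (e a)) ⊆
      Set.Ico (I.release (e b)) (I.deadline (e b)))
    {α : ℝ} (hα : 1 < α) : S.IsApproximate α (ρ ^ (α - 1)) := by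
  refine ⟨h.feasible, fun S' hS' => ?_⟩
  refine le_trans (le_of_eq ?_) (mul_le_mul_right (hp.le_energy e hz hL h.work hwin hα hS') _)
  rw [h.energy hz hα, ← ENNReal.ofReal_mul (by positivity), Finset.mul_sum]
  congr 1
  refine Finset.sum_congr rfl fun i hi => ?_
  have hi := Finset.mem_range.1 hi
  have hW : 0 < W i := by have := h.work ⟨i, hi⟩; simp only at this; rw [this]; exact I.work_pos _
  -- The speed grows by `ρ`, hence the power by `ρ ^ α`, while the duration shrinks by `ρ`.
  have h1 : W i / (p i / ρ) = ρ * (W i / p i) := by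
    field_simp
  rw [h1, Real.mul_rpow hρ.le (div_pos hW (hp.pos i hi)).le]
  have h2 : ρ ^ α = ρ ^ (α - 1) * ρ := by rw [← Real.rpow_add_one hρ.ne', sub_add_cancel]
  rw [h2]
  field_simp

end Pieces

/-! ### Optimal durations from a chain of blocks -/

/-- The duration of a job of work `W` at the level `l ∈ [0, 1]`, i.e. at speed `l / (1 - l)`,
but at most `L`. -/
noncomputable def levelDuration (L W l : ℝ) : ℝ :=
  if l * L ≤ W * (1 - l) then L else W * (1 - l) / l

section levelDuration

variable {L W l l' : ℝ}

theorem levelDuration_le (hW : 0 < W) (hl : 0 ≤ l) : levelDuration L W l ≤ L := by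
  unfold levelDuration
  split_ifs with h
  · exact le_rfl
  · rcases hl.eq_or_lt with rfl | hl
    · simp at h ⊢; linarith
    · rw [div_le_iff₀ hl]; linarith

/-- Level `1` stands for infinite speed. Admitting it gives a level to blocks without any available
volume. -/
theorem levelDuration_one (hL : 0 < L) : levelDuration L W 1 = 0 := by
  simp [levelDuration, hL]

theorem levelDuration_anti (hL : 0 < L) (hW : 0 < W) (hl : 0 ≤ l) (hll : l ≤ l') :
    levelDuration L W l' ≤ levelDuration L W l := by
  by_cases h : l * L ≤ W * (1 - l)
  · rw [levelDuration.eq_1 L W l, if_pos h]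
    exact levelDuration_le hW (hl.trans hll)
  · have h' : ¬ l' * L ≤ W * (1 - l') := by
      intro h'
      apply h
      nlinarith
    have hl0 : 0 < l := by
      rcases hl.eq_or_lt with rfl | hl
      · simp at h; linarith
      · exact hl
    rw [levelDuration, levelDuration, if_neg h, if_neg h', div_le_div_iff₀ (hl0.trans_le hll) hl0]
    nlinarith

theorem levelDuration_pos (hL : 0 < L) (hW : 0 < W) (hl : 0 ≤ l) (hl1 : l < 1) :
    0 < levelDuration L W l := by
  unfold levelDuration
  split_ifs with h
  · exact hL
  · have hl0 : 0 < l := by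
      rcases hl.eq_or_lt with rfl | hl
      · simp at h; linarith
      · exact hl
    exact div_pos (mul_pos hW (by linarith)) hl0

/-- The two conditions that tie a speed to its threshold in `OptimalDurations`, with the threshold
`l / (1 - l)`. -/
theorem div_levelDuration (hL : 0 < L) (hW : 0 < W) (hl1 : l < 1) :
    l / (1 - l) ≤ W / levelDuration L W l ∧
      (levelDuration L W l = L ∨ W / levelDuration L W l = l / (1 - l)) := by
  have h1 : 0 < 1 - l := by linarith
  unfold levelDuration
  split_ifs with h
  · refine ⟨?_, Or.inl rfl⟩
    rw [div_le_div_iff₀ h1 hL]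
    exact h
  · have : W / (W * (1 - l) / l) = l / (1 - l) := by
      rw [div_div_eq_mul_div, mul_div_mul_left _ _ hW.ne']
    exact ⟨this.ge, Or.inr this⟩

end levelDuration

/-! ### Pooling blocks into a chain -/

/-- The jobs `a ≤ i < b` at the common level `l` obey all volume constraints that start at `a`,
and fill the whole volume unless `l = 0`. -/
structure Block (f : ℕ → ℝ → ℝ) (D : ℕ → ℝ) (a b : ℕ) (l : ℝ) : Prop where
  lt : a < b
  nonneg : 0 ≤ l
  le_one : l ≤ 1
  sum_le : ∀ j, a ≤ j → j ≤ b → ∑ i ∈ Finset.Ico a j, f i l ≤ D j - D a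
  tight : 0 < l → ∑ i ∈ Finset.Ico a b, f i l = D b - D a

section Block

variable {f : ℕ → ℝ → ℝ} {D : ℕ → ℝ} {a b c : ℕ} {l l' r : ℝ}

/-- The whole block is tight and each initial part stays below its bound, so each final part uses at
least the volume that belongs to it. -/
theorem Block.le_sum_Ico (h : Block f D a b l) (hl : 0 < l) {j : ℕ} (haj : a ≤ j) (hjb : j ≤ b) :
    D b - D j ≤ ∑ i ∈ Finset.Ico j b, f i l := by
  have h1 := h.tight hl
  rw [← Finset.sum_Ico_consecutive _ haj hjb] at h1
  linarith [h.sum_le j haj hjb]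

/-- Pooling two adjacent blocks whose levels do not decrease. -/
theorem Block.merge (h : Block f D a b l) (h' : Block f D b c l') (hll : l ≤ l')
    (hf : ∀ i, a ≤ i → i < c → ∀ x y, 0 ≤ x → x ≤ y → y ≤ 1 → f i y ≤ f i x)
    (hr0 : 0 ≤ r) (hr1 : r ≤ 1)
    (hle : ∑ i ∈ Finset.Ico a c, f i r ≤ D c - D a)
    (heq : 0 < r → ∑ i ∈ Finset.Ico a c, f i r = D c - D a) : Block f D a c r := by
  have hab := h.lt
  have hbc := h'.lt
  refine ⟨hab.trans hbc, hr0, hr1, fun j haj hjc => ?_, heq⟩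
  have anti : ∀ u v x y, a ≤ u → v ≤ c → 0 ≤ x → x ≤ y → y ≤ 1 →
      ∑ i ∈ Finset.Ico u v, f i y ≤ ∑ i ∈ Finset.Ico u v, f i x := by
    intro u v x y hu hv hx hxy hy
    refine Finset.sum_le_sum fun i hi => ?_
    have := Finset.mem_Ico.1 hi
    exact hf i (by omega) (by omega) x y hx hxy hy
  have hsplit : ∑ i ∈ Finset.Ico a j, f i r + ∑ i ∈ Finset.Ico j c, f i r
      = ∑ i ∈ Finset.Ico a c, f i r := Finset.sum_Ico_consecutive _ haj hjc
  rcases le_total j b with hjb | hbj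
  · rcases le_or_gt l r with hlr | hrl
    · exact (anti a j l r le_rfl (by omega) h.nonneg hlr hr1).trans (h.sum_le j haj hjb)
    -- Lowering the level from `l` to `r` lengthens all jobs. From `j` on they fill at least `D c -
    -- D j`, and subtracting this from the bound for the merged block leaves the bound for the part
    -- before `j`.
    · have hl : 0 < l := hr0.trans_lt hrl
      have h1 := h.le_sum_Ico hl haj hjb
      have h2 := h'.tight (hl.trans_le hll)
      have h3 := anti j b r l haj (by omega) hr0 hrl.le h.le_one
      have h4 := anti b c r l' hab.le le_rfl hr0 (hrl.le.trans hll) h'.le_one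
      have h5 : ∑ i ∈ Finset.Ico j b, f i r + ∑ i ∈ Finset.Ico b c, f i r
        = ∑ i ∈ Finset.Ico j c, f i r := Finset.sum_Ico_consecutive _ hjb hbc.le
      linarith
  · rcases le_or_gt l' r with hlr | hrl
    · have h1 := anti a b l r le_rfl (by omega) h.nonneg (hll.trans hlr) hr1
      have h2 := anti b j l' r hab.le hjc h'.nonneg hlr hr1
      have h3 := h.sum_le b hab.le le_rfl
      have h4 := h'.sum_le j hbj hjc
      have h5 : ∑ i ∈ Finset.Ico a b, f i r + ∑ i ∈ Finset.Ico b j, f i r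
        = ∑ i ∈ Finset.Ico a j, f i r := Finset.sum_Ico_consecutive _ hab.le hbj
      linarith
    -- The same argument inside the right block: a level below `l'` makes the part behind `j` large
    -- enough.
    · have h1 := h'.le_sum_Ico (hr0.trans_lt hrl) hbj hjc
      have h3 := anti j c r l' haj le_rfl hr0 hrl.le h'.le_one
      linarith

/-- The jobs below `b` are cut into `d` blocks with decreasing levels; `lam i` is the level of the
block of job `i`, and `start (b - 1)` is where the block that ends at `b` starts. -/
inductive BlockChain (f : ℕ → ℝ → ℝ) (D : ℕ → ℝ) (start : ℕ → ℕ) (lam : ℕ → ℝ) : ℕ → ℕ → Prop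
  | nil : BlockChain f D start lam 0 0
  | snoc {b d : ℕ} (prev : BlockChain f D start lam (start (b - 1)) d)
      (const : ∀ i, start (b - 1) ≤ i → i < b → lam i = lam (b - 1))
      (block : Block f D (start (b - 1)) b (lam (b - 1)))
      (lt : 0 < start (b - 1) → lam (b - 1) < lam (start (b - 1) - 1)) :
      BlockChain f D start lam b (d + 1)

/-- A chain that ends at `b` reads only cells below `b`; the arrays may be overwritten from there
on. -/
theorem BlockChain.congr {start start' : ℕ → ℕ} {lam lam' : ℕ → ℝ} {d : ℕ}
    (h : BlockChain f D start lam b d) (hs : ∀ i < b, start' i = start i)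
    (hl : ∀ i < b, lam' i = lam i) : BlockChain f D start' lam' b d := by
  induction h with
  | nil => exact .nil
  | @snoc b d prev const block lt ih =>
    have hb := block.lt
    have h1 : start' (b - 1) = start (b - 1) := hs _ (by omega)
    have h2 : lam' (b - 1) = lam (b - 1) := hl _ (by omega)
    refine .snoc ?_ ?_ ?_ ?_
    · rw [h1]
      exact ih (fun i hi => hs i (by omega)) (fun i hi => hl i (by omega))
    · intro i hi hib
      rw [h2, hl i hib]
      exact const i (by omega) hib
    · rw [h1, h2]; exact block
    · rw [h1, h2]
      intro h0
      rw [hl _ (by omega)]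
      exact lt h0

/-- What a chain of blocks means for the single jobs. -/
structure LevelsOf (f : ℕ → ℝ → ℝ) (D : ℕ → ℝ) (lam : ℕ → ℝ) (b : ℕ) : Prop where
  nonneg : ∀ i < b, 0 ≤ lam i
  lt_one : ∀ i < b, lam i < 1
  sum_le : ∀ j ≤ b, ∑ i ∈ Finset.range j, f i (lam i) ≤ D j
  anti : ∀ i, i + 1 < b → lam (i + 1) ≤ lam i ∧
    (lam (i + 1) = lam i ∨ ∑ k ∈ Finset.range (i + 1), f k (lam k) = D (i + 1))
  tight : 0 < b → 0 < lam (b - 1) → ∑ k ∈ Finset.range b, f k (lam k) = D b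

theorem BlockChain.levelsOf {start : ℕ → ℕ} {lam : ℕ → ℝ} {d : ℕ}
    (h : BlockChain f D start lam b d) (hD0 : D 0 = 0) (hD : ∀ i, 0 < i → i ≤ b → 0 < D i)
    (hf1 : ∀ i < b, f i 1 = 0) : LevelsOf f D lam b := by
  induction h with
  | nil => exact ⟨by simp, by simp, by simp [hD0], by simp, by simp⟩
  | @snoc b d prev const block lt ih =>
    set a := start (b - 1) with ha
    have hab := block.lt
    have ih := ih (fun i h1 h2 => hD i h1 (by omega)) (fun i hi => hf1 i (by omega))
    have hsum : ∀ j, a ≤ j → j ≤ b → ∑ i ∈ Finset.range j, f i (lam i)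
        = ∑ i ∈ Finset.range a, f i (lam i) + ∑ i ∈ Finset.Ico a j, f i (lam (b - 1)) := by
      intro j haj hjb
      rw [← Finset.sum_range_add_sum_Ico _ haj]
      congr 1
      refine Finset.sum_congr rfl fun i hi => ?_
      have := Finset.mem_Ico.1 hi
      rw [const i (by omega) (by omega)]
    -- At level `1` the block would have volume zero. For the first block this contradicts
    -- tightness, as `D b > 0 = D 0`; every later level is smaller than its predecessor.
    have hlt1 : lam (b - 1) < 1 := by
      rcases Nat.eq_zero_or_pos a with h0 | h0
      · by_contra hge
        have h1 : lam (b - 1) = 1 := le_antisymm block.le_one (not_lt.1 hge)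
        have h2 := block.tight (by rw [h1]; exact one_pos)
        rw [h1, h0, hD0, Finset.sum_eq_zero fun i hi => hf1 i (Finset.mem_Ico.1 hi).2] at h2
        have := hD b (by omega) le_rfl
        linarith
      · exact (lt h0).trans (ih.lt_one _ (by omega))
    -- If the last level is positive, so is the larger one before it, and the chain up to `a` is
    -- tight by induction.
    have hta : 0 < lam (b - 1) → ∑ i ∈ Finset.range a, f i (lam i) = D a := by
      intro hpos
      rcases Nat.eq_zero_or_pos a with h0 | h0
      · simp [h0, hD0]
      · exact ih.tight h0 (hpos.trans (lt h0))
    refine ⟨fun i hi => ?_, fun i hi => ?_, fun j hj => ?_, fun i hi => ?_, fun hb hpos => ?_⟩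
    · rcases Nat.lt_or_ge i a with h | h
      · exact ih.nonneg i h
      · rw [const i h hi]; exact block.nonneg
    · rcases Nat.lt_or_ge i a with h | h
      · exact ih.lt_one i h
      · rw [const i h hi]; exact hlt1
    · rcases Nat.lt_or_ge j a with h | h
      · exact ih.sum_le j h.le
      · rw [hsum j h hj]
        linarith [ih.sum_le a le_rfl, block.sum_le j h hj]
    · rcases Nat.lt_trichotomy (i + 1) a with h | h | h
      · exact ih.anti i h
      · have h1 : lam (i + 1) = lam (b - 1) := const _ (by omega) hi
        have h2 := lt (by omega)
        have h3 : a - 1 = i := by omega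
        rw [h3] at h2
        refine ⟨by rw [h1]; exact h2.le, Or.inr ?_⟩
        rw [h]
        exact ih.tight (by omega) (by rw [h3]; exact block.nonneg.trans_lt h2)
      · have h1 : lam (i + 1) = lam (b - 1) := const _ (by omega) hi
        have h2 : lam i = lam (b - 1) := const _ (by omega) (by omega)
        rw [h1, h2]
        exact ⟨le_rfl, Or.inl rfl⟩
    · rw [hsum b hab.le le_rfl, hta hpos, block.tight hpos]
      ring

end Block

theorem BlockChain.optimalDurations {n m : ℕ} {z : ℕ → ℕ} {L W D : ℕ → ℝ} {start : ℕ → ℕ}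
    {lam : ℕ → ℝ} {d : ℕ} (hm : 0 < m)
    (h : BlockChain (fun i l => z i * levelDuration (L i) (W i) l) D start lam n d)
    (hD0 : D 0 = 0) (hD : ∀ i < n, D (i + 1) = m * L i) (hL : ∀ i < n, 0 < L i)
    (hW : ∀ i < n, 0 < W i) :
    OptimalDurations n m z L W (fun i => levelDuration (L i) (W i) (lam i)) := by
  have hm' : (0 : ℝ) < m := by exact_mod_cast hm
  have key := h.levelsOf hD0 (fun i h0 hi => by
    obtain ⟨j, rfl⟩ : ∃ j, i = j + 1 := ⟨i - 1, by omega⟩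
    rw [hD j (by omega)]
    exact mul_pos hm' (hL j (by omega))) (fun i hi => by simp [levelDuration_one (hL i hi)])
  refine ⟨fun i hi => levelDuration_pos (hL i hi) (hW i hi) (key.nonneg i hi) (key.lt_one i hi),
    fun i hi => levelDuration_le (hW i hi) (key.nonneg i hi), fun i hi => ?_,
    -- The threshold is the speed of the level. Its final drop to `0` at `n` is allowed because the
    -- last constraint is tight unless the last level is already `0`.
    fun i => if i < n then lam i / (1 - lam i) else 0, by simp, fun i hi => ?_⟩
  · rw [← hD i hi]
    exact key.sum_le (i + 1) hi
  · have h0 := key.nonneg i hi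
    have h1 := key.lt_one i hi
    have h2 : 0 < 1 - lam i := by linarith
    obtain ⟨h3, h4⟩ := div_levelDuration (hL i hi) (hW i hi) h1
    simp only [if_pos hi]
    refine ⟨h3, h4, div_nonneg h0 h2.le, ?_⟩
    split_ifs with hi'
    · obtain ⟨h5, h6⟩ := key.anti i hi'
      refine ⟨?_, ?_⟩
      · rw [div_le_div_iff₀ (by have := key.lt_one _ hi'; linarith) h2]
        nlinarith
      · rcases h6 with h6 | h6
        · left; rw [h6]
        · right; rw [← hD i hi]; exact h6
    · have hn : n = i + 1 := by omega
      refine ⟨div_nonneg h0 h2.le, ?_⟩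
      rcases h0.eq_or_lt with h0 | h0
      · left; rw [← h0]; simp
      · right
        rw [← hD i hi]
        subst hn
        exact key.tight (by omega) (by simpa using h0)

/-! ### The level of a block -/

/-- After a scan of the set `T` of jobs in the order of decreasing density, the jobs `K` of the
block `B` run at their full length, and `V` and `c` are the work of the others and the volume that
is left for them. -/
structure Filling (z : ℕ → ℕ) (L W : ℕ → ℝ) (C : ℝ) (B T K : Finset ℕ) (V c : ℝ) : Prop where
  subset : K ⊆ B
  subset_scanned : K ⊆ T
  work : V = ∑ i ∈ B \ K, z i * W i
  volume : c = C - ∑ i ∈ K, z i * L i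
  nonneg : 0 ≤ c
  pos : K.Nonempty → 0 < c
  full : ∀ i ∈ K, V * L i ≤ W i * c
  rest : (∀ i ∈ B, i ∈ T → i ∈ K) ∨ ∀ i ∈ B \ K, W i * c ≤ V * L i

namespace Filling

variable {z : ℕ → ℕ} {L W : ℕ → ℝ} {C V c : ℝ} {B T K : Finset ℕ}

theorem init (hC : 0 ≤ C) : Filling z L W C B ∅ ∅ (∑ i ∈ B, z i * W i) C :=
  ⟨by simp, by simp, by simp, by simp, hC, by simp, by simp, by simp⟩

theorem skip (h : Filling z L W C B T K V c) {i : ℕ} (hiB : i ∉ B) :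
    Filling z L W C B (insert i T) K V c := by
  refine ⟨h.subset, h.subset_scanned.trans (Finset.subset_insert _ _), h.work, h.volume, h.nonneg,
    h.pos, h.full, h.rest.imp_left fun h1 j hj hjT => ?_⟩
  rcases Finset.mem_insert.1 hjT with rfl | hjT
  · exact absurd hj hiB
  · exact h1 j hj hjT

/-- The first rejected job is the densest one still unscanned, so all jobs outside `K` have density
at most `V / c`. Everything is cross-multiplied, which covers `c = 0`. -/
theorem reject (h : Filling z L W C B T K V c) {i : ℕ} (hL : ∀ i ∈ B, 0 < L i) (hiB : i ∈ B)
    (hord : ∀ j ∈ B, j ∉ T → W j * L i ≤ W i * L j) (hi : W i * c ≤ V * L i) :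
    Filling z L W C B (insert i T) K V c := by
  refine ⟨h.subset, h.subset_scanned.trans (Finset.subset_insert _ _), h.work, h.volume, h.nonneg,
    h.pos, h.full, Or.inr ?_⟩
  rcases h.rest with h1 | h1
  · intro j hj
    obtain ⟨hjB, hjK⟩ := Finset.mem_sdiff.1 hj
    have h2 := hord j hjB fun hjT => hjK (h1 j hjB hjT)
    have hLi := hL i hiB
    have h3 := mul_le_mul_of_nonneg_right h2 h.nonneg
    have h4 := mul_le_mul_of_nonneg_right hi (hL j hjB).le
    by_contra hlt
    have := mul_lt_mul_of_pos_right (not_le.1 hlt) hLi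
    nlinarith
  · exact h1

/-- Removing a job whose density exceeds the mean `V / c` of those left lowers this mean, so all
jobs accepted so far stay above it. -/
theorem accept (h : Filling z L W C B T K V c) {i : ℕ} (hz : ∀ i ∈ B, 0 < z i)
    (hL : ∀ i ∈ B, 0 < L i) (hW : ∀ i ∈ B, 0 < W i) (hiB : i ∈ B) (hiT : i ∉ T)
    (hi : V * L i < W i * c) :
    Filling z L W C B (insert i T) (insert i K) (V - z i * W i) (c - z i * L i) := by
  have hiK : i ∉ K := fun hK => hiT (h.subset_scanned hK)
  have hLi := hL i hiB
  have hWi := hW i hiB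
  have hzi : (0 : ℝ) < z i := by exact_mod_cast hz i hiB
  have hV : z i * W i ≤ V := by
    rw [h.work]
    exact Finset.single_le_sum (f := fun i => (z i : ℝ) * W i) (fun j hj => mul_nonneg
      (by positivity) (hW j (Finset.mem_sdiff.1 hj).1).le) (Finset.mem_sdiff.2 ⟨hiB, hiK⟩)
  -- The job is itself part of the remaining work, so `z i * W i * L i ≤ V * L i < W i * c`; cancel
  -- `W i`.
  have hc : 0 < c - z i * L i := by
    have h1 : z i * W i * L i < W i * c :=
      (mul_le_mul_of_nonneg_right hV hLi.le).trans_lt hi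
    have h2 : W i * (z i * L i) < W i * c := by linarith
    linarith [lt_of_mul_lt_mul_left h2 hWi.le]
  have hc0 : 0 < c := by nlinarith [mul_pos hzi hLi]
  refine ⟨Finset.insert_subset hiB h.subset, Finset.insert_subset_insert _ h.subset_scanned, ?_, ?_,
    hc.le, fun _ => hc, ?_, Or.inl ?_⟩
  · have : B \ K = insert i (B \ insert i K) := by
      ext j
      simp only [Finset.mem_sdiff, Finset.mem_insert]
      by_cases hj : j = i
      · subst hj; simp [hiB, hiK]
      · simp [hj]
    rw [h.work, this, Finset.sum_insert (by simp)]
    ring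
  · rw [h.volume, Finset.sum_insert hiK]
    ring
  -- The new quotient of `V` and `c` is at most the old one, without division.
  · have hr : (V - z i * W i) * c ≤ V * (c - z i * L i) := by nlinarith
    have hold : ∀ j ∈ B, V * L j ≤ W j * c → (V - z i * W i) * L j ≤ W j * (c - z i * L i) := by
      intro j hj hfull
      have h1 := mul_le_mul_of_nonneg_right hr (hL j hj).le
      have h2 := mul_le_mul_of_nonneg_right hfull hc.le
      by_contra hlt
      have := mul_lt_mul_of_pos_right (not_le.1 hlt) hc0
      nlinarith
    intro j hj
    rcases Finset.mem_insert.1 hj with rfl | hj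
    · exact hold j hiB hi.le
    · exact hold j (h.subset hj) (h.full j hj)
  · intro j hj hjT
    rcases Finset.mem_insert.1 hjT with rfl | hjT
    · exact Finset.mem_insert_self _ _
    -- An earlier rejection would have put the density of job `i` at or below `V / c`, against its
    -- acceptance.
    · rcases h.rest with h1 | h1
      · exact Finset.mem_insert_of_mem (h1 j hj hjT)
      · exact absurd (h1 i (Finset.mem_sdiff.2 ⟨hiB, hiK⟩)) (not_le.2 hi)

/-- The level found by the scan of all jobs. -/
theorem level (h : Filling z L W C B T K V c) (hz : ∀ i ∈ B, 0 < z i)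
    (hW : ∀ i ∈ B, 0 < W i) (hB : B.Nonempty) (hBT : B ⊆ T) :
    0 ≤ V / (V + c) ∧ V / (V + c) ≤ 1 ∧
      ∑ i ∈ B, z i * levelDuration (L i) (W i) (V / (V + c)) ≤ C ∧
      (0 < V / (V + c) → ∑ i ∈ B, z i * levelDuration (L i) (W i) (V / (V + c)) = C) := by
  have hterm : ∀ i ∈ B, 0 < (z i : ℝ) * W i := fun i hi =>
    mul_pos (by exact_mod_cast hz i hi) (hW i hi)
  have hV : 0 ≤ V := by
    rw [h.work]
    exact Finset.sum_nonneg fun i hi => (hterm i (Finset.mem_sdiff.1 hi).1).le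
  have hVc : 0 < V + c := by
    by_cases hK : K.Nonempty
    · linarith [h.pos hK]
    · rw [Finset.not_nonempty_iff_eq_empty] at hK
      have : 0 < V := by
        rw [h.work, hK, Finset.sdiff_empty]
        exact Finset.sum_pos hterm hB
      linarith [h.nonneg]
  have hc := h.nonneg
  have h1 : 1 - V / (V + c) = c / (V + c) := by field_simp; ring
  have hcond : ∀ i, (V / (V + c) * L i ≤ W i * (1 - V / (V + c)) ↔ V * L i ≤ W i * c) := by
    intro i
    rw [h1, div_mul_eq_mul_div, ← mul_div_assoc, div_le_div_iff_of_pos_right hVc]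
  have hK : ∀ i ∈ K, levelDuration (L i) (W i) (V / (V + c)) = L i := fun i hi => by
    rw [levelDuration, if_pos ((hcond i).2 (h.full i hi))]
  have hKsum : ∑ i ∈ K, (z i : ℝ) * levelDuration (L i) (W i) (V / (V + c)) = C - c := by
    rw [Finset.sum_congr rfl fun i hi => by rw [hK i hi], h.volume]
    ring
  have hsplit := Finset.sum_sdiff h.subset
    (f := fun i => (z i : ℝ) * levelDuration (L i) (W i) (V / (V + c)))
  have hpos : 0 < V →
      ∑ i ∈ B, (z i : ℝ) * levelDuration (L i) (W i) (V / (V + c)) = C := by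
    intro hV
    have hne : ¬ B ⊆ K := by
      intro hBK
      have := h.work
      rw [Finset.sdiff_eq_empty_iff_subset.2 hBK] at this
      simp at this
      exact hV.ne' this
    have hrest : ∀ i ∈ B \ K, W i * c ≤ V * L i := by
      rcases h.rest with h2 | h2
      · exact absurd (fun i hi => h2 i hi (hBT hi)) hne
      · exact h2
    -- The remaining jobs run at speed `V / c`. In the case of a tie the cap `L i` equals this
    -- duration, so both branches of `levelDuration` agree.
    have h3 : ∀ i ∈ B \ K, (z i : ℝ) * levelDuration (L i) (W i) (V / (V + c))
        = z i * W i * (c / V) := by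
      intro i hi
      have h4 := hrest i hi
      rw [levelDuration]
      split_ifs with h5
      · have h6 := (hcond i).1 h5
        have h7 : V * L i = W i * c := le_antisymm h6 h4
        have h8 : L i = W i * c / V := by rw [← h7]; field_simp
        rw [h8]; ring
      · rw [h1]; field_simp
    rw [Finset.sum_congr rfl h3, ← Finset.sum_mul, ← h.work, hKsum] at hsplit
    rw [← hsplit]
    field_simp
    ring
  refine ⟨div_nonneg hV hVc.le, (div_le_one hVc).2 (by linarith), ?_, fun h2 => ?_⟩
  · rcases hV.eq_or_lt with hV | hV
    -- With `V = 0` every job runs for its full window length, and some volume may stay unused.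
    · have : B \ K = ∅ := by
        by_contra hne
        have := Finset.sum_pos (s := B \ K) (fun i hi => hterm i (Finset.mem_sdiff.1 hi).1)
          (Finset.nonempty_iff_ne_empty.2 hne)
        rw [← h.work] at this
        exact this.ne hV
      rw [this, hKsum] at hsplit
      simp at hsplit
      linarith
    · exact (hpos hV).le
  · refine hpos (hV.lt_of_ne fun h0 => ?_)
    rw [← h0] at h2
    simp at h2

end Filling

/-! ### Interleaving the list schedule of the small jobs with the big jobs -/

/-- Time and volume bounds of a list schedule. Jobs `i` with `2 * z i ≤ m + 1` are small; small job
`i` is started at the virtual time `S i`, at which no big job has been counted. `M i` is the latest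
virtual completion time of the small jobs below `i` and `B i` the total duration of the big ones. -/
structure ListSchedule (n m : ℕ) (z : ℕ → ℕ) (q S M B : ℕ → ℝ) (conflict : ℕ → ℕ → Prop) :
    Prop where
  dur_pos : ∀ i < n, 0 < q i
  M_zero : M 0 = 0
  B_zero : B 0 = 0
  start_nonneg : ∀ i < n, z i + z i ≤ m + 1 → 0 ≤ S i
  start_le : ∀ i < n, z i + z i ≤ m + 1 →
    ((m : ℝ) + 1) / 2 * S i ≤
      ∑ k ∈ Finset.range i, if z k + z k ≤ m + 1 then z k * q k else 0
  M_small : ∀ i < n, z i + z i ≤ m + 1 → M (i + 1) = max (M i) (S i + q i)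
  B_small : ∀ i < n, z i + z i ≤ m + 1 → B (i + 1) = B i
  M_big : ∀ i < n, ¬ z i + z i ≤ m + 1 → M (i + 1) = M i
  B_big : ∀ i < n, ¬ z i + z i ≤ m + 1 → B (i + 1) = B i + q i
  of_conflict : ∀ i j, i < j → j < n → z i + z i ≤ m + 1 → z j + z j ≤ m + 1 → conflict i j →
    S i + q i ≤ S j

/-- `x` moved into the interval `[a, a + d]`. -/
noncomputable def clampTo (a d x : ℝ) : ℝ := max a (min (a + d) x)

theorem clampTo_mono {a d x y : ℝ} (h : x ≤ y) : clampTo a d x ≤ clampTo a d y :=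
  max_le_max le_rfl (min_le_min le_rfl h)

theorem le_clampTo {a d x : ℝ} : a ≤ clampTo a d x := le_max_left _ _

theorem clampTo_le {a d x : ℝ} (hd : 0 ≤ d) : clampTo a d x ≤ a + d :=
  max_le (by linarith) (min_le_left _ _)

theorem clampTo_of_le {a d x : ℝ} (h : x ≤ a) : clampTo a d x = a :=
  max_eq_left ((min_le_right _ _).trans h)

theorem clampTo_of_ge {a d x : ℝ} (hd : 0 ≤ d) (h : a + d ≤ x) : clampTo a d x = a + d := by
  rw [clampTo, min_eq_left h, max_eq_right (by linarith)]

/-- A nonempty clamped interval lies inside `[x, y]`, and it begins before the end of the range to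
which it is clamped. -/
theorem clampTo_lt_clampTo {a d x y : ℝ} (hd : 0 ≤ d) (hxy : x ≤ y)
    (h : clampTo a d x < clampTo a d y) :
    x < a + d ∧ x ≤ clampTo a d x ∧ clampTo a d y ≤ y := by
  have h1 : x < a + d := by
    by_contra hx
    rw [clampTo_of_ge hd (not_lt.1 hx), clampTo_of_ge hd ((not_lt.1 hx).trans hxy)] at h
    exact lt_irrefl _ h
  have h2 : a < y := by
    by_contra hy
    rw [clampTo_of_le (not_lt.1 hy), clampTo_of_le (hxy.trans (not_lt.1 hy))] at h
    exact lt_irrefl _ h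
  refine ⟨h1, ?_, max_le h2.le (min_le_right _ _)⟩
  rw [clampTo, min_eq_right h1.le]
  exact le_max_right _ _

section

variable (n m : ℕ) (z : ℕ → ℕ) (q S M B : ℕ → ℝ)

/-- The number of intervals of a job. -/
def pieceCount (i : ℕ) : ℕ := if z i + z i ≤ m + 1 then n else 1

/-- The left end of the `g`-th interval of job `i`. -/
noncomputable def pieceLo (i g : ℕ) : ℝ :=
  if z i + z i ≤ m + 1 then clampTo (S i) (q i) (M g) + B (g + 1) else M i + B i

/-- The right end of the `g`-th interval of job `i`. -/
noncomputable def pieceHi (i g : ℕ) : ℝ :=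
  if z i + z i ≤ m + 1 then clampTo (S i) (q i) (M (g + 1)) + B (g + 1) else M i + B (i + 1)

end

namespace ListSchedule

variable {n m : ℕ} {z : ℕ → ℕ} {q S M B : ℕ → ℝ} {conflict : ℕ → ℕ → Prop}

theorem M_le_succ (h : ListSchedule n m z q S M B conflict) {i : ℕ} (hi : i < n) :
    M i ≤ M (i + 1) := by
  by_cases hs : z i + z i ≤ m + 1
  · rw [h.M_small i hi hs]; exact le_max_left _ _
  · rw [h.M_big i hi hs]

theorem B_le_succ (h : ListSchedule n m z q S M B conflict) {i : ℕ} (hi : i < n) :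
    B i ≤ B (i + 1) := by
  by_cases hs : z i + z i ≤ m + 1
  · rw [h.B_small i hi hs]
  · rw [h.B_big i hi hs]; linarith [h.dur_pos i hi]

theorem _root_.SpeedScaling.le_of_le_succ_below {n : ℕ} {f : ℕ → ℝ}
    (hf : ∀ i < n, f i ≤ f (i + 1)) {i j : ℕ} (hij : i ≤ j) (hj : j ≤ n) : f i ≤ f j := by
  induction j, hij using Nat.le_induction with
  | base => exact le_rfl
  | succ j _ ih => exact (ih (by omega)).trans (hf j (by omega))

theorem M_mono (h : ListSchedule n m z q S M B conflict) {i j : ℕ} (hij : i ≤ j) (hj : j ≤ n) :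
    M i ≤ M j := le_of_le_succ_below (fun _ => h.M_le_succ) hij hj

theorem B_mono (h : ListSchedule n m z q S M B conflict) {i j : ℕ} (hij : i ≤ j) (hj : j ≤ n) :
    B i ≤ B j := le_of_le_succ_below (fun _ => h.B_le_succ) hij hj

theorem M_nonneg (h : ListSchedule n m z q S M B conflict) {i : ℕ} (hi : i ≤ n) : 0 ≤ M i := by
  rw [← h.M_zero]; exact h.M_mono (Nat.zero_le _) hi

theorem B_nonneg (h : ListSchedule n m z q S M B conflict) {i : ℕ} (hi : i ≤ n) : 0 ≤ B i := by
  rw [← h.B_zero]; exact h.B_mono (Nat.zero_le _) hi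

theorem end_le_M (h : ListSchedule n m z q S M B conflict) {i j : ℕ} (hij : i < j) (hj : j ≤ n)
    (hs : z i + z i ≤ m + 1) : S i + q i ≤ M j := by
  refine le_trans ?_ (h.M_mono (i := i + 1) hij hj)
  rw [h.M_small i (by omega) hs]
  exact le_max_right _ _

/-- The maximum is attained. This reduces the bound on the start of a big job to the bound on the
end of one earlier small job. -/
theorem M_eq (h : ListSchedule n m z q S M B conflict) {i : ℕ} (hi : i ≤ n) :
    M i = 0 ∨ ∃ k < i, z k + z k ≤ m + 1 ∧ M i = S k + q k := by
  induction i with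
  | zero => exact Or.inl h.M_zero
  | succ i ih =>
    have hold : M (i + 1) = M i →
        M (i + 1) = 0 ∨ ∃ k < i + 1, z k + z k ≤ m + 1 ∧ M (i + 1) = S k + q k := by
      intro h1
      rw [h1]
      rcases ih (by omega) with h2 | ⟨k, h2, h3⟩
      · exact Or.inl h2
      · exact Or.inr ⟨k, by omega, h3⟩
    by_cases hs : z i + z i ≤ m + 1
    · have h1 := h.M_small i (by omega) hs
      rcases max_choice (M i) (S i + q i) with h2 | h2
      · exact hold (h1.trans h2)
      · exact Or.inr ⟨i, by omega, hs, h1.trans h2⟩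
    · exact hold (h.M_big i (by omega) hs)

/-- Big jobs keep more than half of the processors busy. -/
theorem volume_bound (h : ListSchedule n m z q S M B conflict) {i : ℕ} (hi : i ≤ n) :
    ((m : ℝ) + 1) / 2 * B i + (∑ k ∈ Finset.range i, if z k + z k ≤ m + 1 then z k * q k else 0)
      ≤ ∑ k ∈ Finset.range i, (z k : ℝ) * q k := by
  induction i with
  | zero => simp [h.B_zero]
  | succ i ih =>
    have ih := ih (by omega)
    rw [Finset.sum_range_succ, Finset.sum_range_succ (fun k => (z k : ℝ) * q k)]
    by_cases hs : z i + z i ≤ m + 1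
    · rw [h.B_small i (by omega) hs, if_pos hs]; linarith
    · rw [h.B_big i (by omega) hs, if_neg hs]
      have h1 : ((m : ℝ) + 1) / 2 ≤ z i := by
        have : ((m + 1 : ℕ) : ℝ) ≤ ((z i + z i : ℕ) : ℝ) := by exact_mod_cast (by omega)
        push_cast at this
        linarith
      nlinarith [h.dur_pos i (by omega)]

theorem sum_small_mono (h : ListSchedule n m z q S M B conflict) {i j : ℕ} (hij : i ≤ j)
    (hj : j ≤ n) :
    ∑ k ∈ Finset.range i, (if z k + z k ≤ m + 1 then z k * q k else 0)
      ≤ ∑ k ∈ Finset.range j, if z k + z k ≤ m + 1 then (z k : ℝ) * q k else 0 := by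
  refine Finset.sum_le_sum_of_subset_of_nonneg (Finset.range_subset_range.2 hij) fun k hk _ => ?_
  have := h.dur_pos k (by have := Finset.mem_range.1 hk; omega)
  split_ifs
  · positivity
  · exact le_rfl

/-- The virtual completion time of a small job, delayed by the big jobs up to some later job. -/
theorem end_add_B_le (h : ListSchedule n m z q S M B conflict) {L p : ℕ → ℝ} {W : ℕ → ℝ}
    (hp : OptimalDurations n m z L W p) (hz : ∀ i < n, 1 ≤ z i) (hm : 1 ≤ m)
    (hL : ∀ i j, i ≤ j → j < n → L i ≤ L j)
    (hq : ∀ i < n, q i = p i / (3 - 4 / ((m : ℝ) + 1))) {k j : ℕ} (hkj : k ≤ j) (hj : j < n)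
    (hs : z k + z k ≤ m + 1) : S k + q k + B (j + 1) ≤ L j := by
  have hm' : (1 : ℝ) ≤ m := by exact_mod_cast hm
  have hρ : (3 - 4 / ((m : ℝ) + 1)) * (m + 1) = 3 * m - 1 := by field_simp; ring
  have hρ0 : 0 < 3 - 4 / ((m : ℝ) + 1) := by
    by_contra hneg
    nlinarith
  set ρ := 3 - 4 / ((m : ℝ) + 1)
  have h1 := h.start_le k (by omega) hs
  have h2 := h.volume_bound (i := j + 1) (by omega)
  have h3 := h.sum_small_mono (i := k + 1) (j := j + 1) (by omega) (by omega)
  rw [Finset.sum_range_succ, if_pos hs] at h3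
  have h4 : ∑ i ∈ Finset.range (j + 1), (z i : ℝ) * q i ≤ m * (L j / ρ) := by
    rw [← mul_div_assoc, le_div_iff₀ hρ0, Finset.sum_mul]
    refine le_trans (le_of_eq (Finset.sum_congr rfl fun i hi => ?_)) (hp.sum_le j hj)
    rw [hq i (by have := Finset.mem_range.1 hi; omega)]
    field_simp
  have h5 : q k ≤ L j / ρ := by
    rw [hq k (by omega)]
    exact div_le_div_of_nonneg_right ((hp.le k (by omega)).trans (hL k j hkj hj)) hρ0.le
  have h6 : L j = ρ * (L j / ρ) := by field_simp
  have h7 := h.dur_pos k (by omega)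
  have h8 : q k ≤ z k * q k := by
    have : (1 : ℝ) ≤ z k := by exact_mod_cast hz k (by omega)
    nlinarith
  set K := L j / ρ
  rw [h6]
  -- With `K = L j / ρ` the volumes give `(m + 1) / 2 * (S k + B (j + 1)) + z k * q k ≤ m * K`. As
  -- `z k ≥ 1` and `q k ≤ K`, the left side here is at most `2 * m * K + (m - 1) * q k ≤ (3 * m - 1)
  -- * K`, which is `(m + 1) * ρ * K`: the origin of `ρ`.
  have h9 : (m + 1) * (S k + q k + B (j + 1)) ≤ (m + 1) * (ρ * K) := by nlinarith
  exact le_of_mul_le_mul_left h9 (by linarith)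

/-- For a big job that starts at virtual time `0` the volume bound alone suffices: `(m + 1) * B (j +
1) ≤ 2 * m * K ≤ (3 * m - 1) * K`. -/
theorem B_le (h : ListSchedule n m z q S M B conflict) {L p : ℕ → ℝ} {W : ℕ → ℝ}
    (hp : OptimalDurations n m z L W p) (hm : 1 ≤ m)
    (hq : ∀ i < n, q i = p i / (3 - 4 / ((m : ℝ) + 1))) {j : ℕ} (hj : j < n) :
    B (j + 1) ≤ L j := by
  have hm' : (1 : ℝ) ≤ m := by exact_mod_cast hm
  have hρ : (3 - 4 / ((m : ℝ) + 1)) * (m + 1) = 3 * m - 1 := by field_simp; ring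
  have hρ0 : 0 < 3 - 4 / ((m : ℝ) + 1) := by
    by_contra hneg
    nlinarith
  set ρ := 3 - 4 / ((m : ℝ) + 1)
  have h2 := h.volume_bound (i := j + 1) (by omega)
  have h3 := h.sum_small_mono (Nat.zero_le (j + 1)) (by omega)
  have h4 : ∑ i ∈ Finset.range (j + 1), (z i : ℝ) * q i ≤ m * (L j / ρ) := by
    rw [← mul_div_assoc, le_div_iff₀ hρ0, Finset.sum_mul]
    refine le_trans (le_of_eq (Finset.sum_congr rfl fun i hi => ?_)) (hp.sum_le j hj)
    rw [hq i (by have := Finset.mem_range.1 hi; omega)]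
    field_simp
  have h6 : L j = ρ * (L j / ρ) := by field_simp
  have h7 : 0 ≤ L j / ρ := div_nonneg ((hp.pos j hj).le.trans (hp.le j hj)) hρ0.le
  set K := L j / ρ
  rw [h6]
  simp at h3
  have h9 : (m + 1) * B (j + 1) ≤ (m + 1) * (ρ * K) := by nlinarith
  exact le_of_mul_le_mul_left h9 (by linarith)

theorem pieceLo_le (h : ListSchedule n m z q S M B conflict) {i g : ℕ} (hi : i < n)
    (hg : g < pieceCount n m z i) : pieceLo m z q S M B i g ≤ pieceHi m z q S M B i g := by
  unfold pieceCount at hg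
  unfold pieceLo pieceHi
  split_ifs with hs
  · rw [if_pos hs] at hg
    have := clampTo_mono (a := S i) (d := q i) (h.M_le_succ hg)
    linarith
  · linarith [h.B_le_succ hi]

/-- The lengths of the pieces of a small job telescope: `M` runs from `M 0 = 0 ≤ S i` to `M n ≥ S i
+ q i`, so its clamped value traverses the whole execution. -/
theorem sum_pieces (h : ListSchedule n m z q S M B conflict) {i : ℕ} (hi : i < n) :
    ∑ g ∈ Finset.range (pieceCount n m z i), (pieceHi m z q S M B i g - pieceLo m z q S M B i g)
      = q i := by
  unfold pieceCount pieceLo pieceHi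
  split_ifs with hs
  · simp only [add_sub_add_right_eq_sub]
    rw [Finset.sum_range_sub (fun g => clampTo (S i) (q i) (M g)),
      clampTo_of_ge (h.dur_pos i hi).le (h.end_le_M hi le_rfl hs),
      clampTo_of_le (by rw [h.M_zero]; exact h.start_nonneg i hi hs)]
    ring
  · simp [h.B_big i hi hs]

/-- The slot of the time axis that contains the `g`-th interval of job `i`. -/
def slot (m : ℕ) (z : ℕ → ℕ) (i g : ℕ) : ℕ := if z i + z i ≤ m + 1 then g else i

theorem slot_lt {i g : ℕ} (hi : i < n) (hg : g < pieceCount n m z i) : slot m z i g < n := by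
  unfold pieceCount at hg
  unfold slot
  split_ifs with hs
  · simpa [hs] using hg
  · exact hi

/-- The slots `[M g + B g, M (g + 1) + B (g + 1)]` follow each other on the real time axis. Only `M`
grows in the slot of a small job, only `B` in that of a big one. -/
theorem slot_bounds (h : ListSchedule n m z q S M B conflict) {i g : ℕ} (hi : i < n)
    (hg : g < pieceCount n m z i)
    (hlt : pieceLo m z q S M B i g < pieceHi m z q S M B i g) :
    M (slot m z i g) + B (slot m z i g) ≤ pieceLo m z q S M B i g ∧
      pieceHi m z q S M B i g ≤ M (slot m z i g + 1) + B (slot m z i g + 1) := by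
  unfold pieceCount at hg
  unfold pieceLo pieceHi at *
  unfold slot
  split_ifs at * with hs
  · obtain ⟨-, h1, h2⟩ := clampTo_lt_clampTo (h.dur_pos i hi).le (h.M_le_succ hg)
      (by linarith : clampTo (S i) (q i) (M g) < _)
    have := h.B_le_succ hg
    exact ⟨by linarith, by linarith⟩
  · rw [h.M_big i hi hs]
    exact ⟨le_rfl, le_rfl⟩

theorem separate_of_slot_lt (h : ListSchedule n m z q S M B conflict) {i j g g' : ℕ} (hi : i < n)
    (hj : j < n) (hg : g < pieceCount n m z i) (hg' : g' < pieceCount n m z j)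
    (hlt : slot m z i g < slot m z j g') :
    Separate (pieceLo m z q S M B i g) (pieceHi m z q S M B i g)
      (pieceLo m z q S M B j g') (pieceHi m z q S M B j g') := by
  by_cases h1 : pieceHi m z q S M B i g ≤ pieceLo m z q S M B i g
  · exact Or.inl h1
  by_cases h2 : pieceHi m z q S M B j g' ≤ pieceLo m z q S M B j g'
  · exact Or.inr (Or.inl h2)
  have h3 := (h.slot_bounds hi hg (not_le.1 h1)).2
  have h4 := (h.slot_bounds hj hg' (not_le.1 h2)).1
  have h5 := slot_lt hj hg'
  have h6 := h.M_mono (i := slot m z i g + 1) hlt h5.le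
  have h7 := h.B_mono (i := slot m z i g + 1) hlt h5.le
  exact Or.inr (Or.inr (Or.inl (by linarith)))

theorem _root_.SpeedScaling.Separate.symm {a b c d : ℝ} (h : Separate a b c d) :
    Separate c d a b := by
  unfold Separate at *; tauto

theorem separate_self (h : ListSchedule n m z q S M B conflict) {i g g' : ℕ} (hi : i < n)
    (hg : g < pieceCount n m z i) (hg' : g' < pieceCount n m z i) (hne : g ≠ g') :
    Separate (pieceLo m z q S M B i g) (pieceHi m z q S M B i g)
      (pieceLo m z q S M B i g') (pieceHi m z q S M B i g') := by
  by_cases hs : z i + z i ≤ m + 1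
  · rcases hne.lt_or_gt with hlt | hlt
    · exact h.separate_of_slot_lt hi hi hg hg' (by simpa [slot, hs] using hlt)
    · exact (h.separate_of_slot_lt hi hi hg' hg (by simpa [slot, hs] using hlt)).symm
  · simp only [pieceCount, if_neg hs] at hg hg'
    omega

/-- Pieces in different slots are ordered in time. Within one slot two small jobs have the same
shift, so their virtual order decides; the shift `B (g + 1)` moves any small piece in the slot of a
big job behind that job. Two different big jobs never share a slot. -/
theorem separate_of_lt (h : ListSchedule n m z q S M B conflict) {i j g g' : ℕ} (hij : i < j)
    (hj : j < n) (hc : conflict i j) (hg : g < pieceCount n m z i)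
    (hg' : g' < pieceCount n m z j) :
    Separate (pieceLo m z q S M B i g) (pieceHi m z q S M B i g)
      (pieceLo m z q S M B j g') (pieceHi m z q S M B j g') := by
  have hi := hij.trans hj
  rcases Nat.lt_trichotomy (slot m z i g) (slot m z j g') with hlt | heq | hlt
  · exact h.separate_of_slot_lt hi hj hg hg' hlt
  · by_cases hsi : z i + z i ≤ m + 1 <;> by_cases hsj : z j + z j ≤ m + 1
    · simp only [slot, if_pos hsi, if_pos hsj] at heq
      subst heq
      have h1 := h.of_conflict i j hij hj hsi hsj hc
      right; right; left
      simp only [pieceLo, pieceHi, if_pos hsi, if_pos hsj]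
      have h2 := clampTo_le (a := S i) (x := M (g + 1)) (h.dur_pos i hi).le
      have h3 := le_clampTo (a := S j) (d := q j) (x := M g)
      linarith
    · simp only [slot, if_pos hsi, if_neg hsj] at heq
      subst heq
      by_cases hlt : pieceLo m z q S M B i g < pieceHi m z q S M B i g
      · simp only [pieceLo, pieceHi, if_pos hsi, if_neg hsj] at hlt ⊢
        obtain ⟨-, h1, h2⟩ := clampTo_lt_clampTo (h.dur_pos i hi).le (h.M_le_succ hj)
          (by linarith : clampTo (S i) (q i) (M g) < _)
        right; right; right
        linarith
      · exact Or.inl (not_lt.1 hlt)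
    · simp only [slot, if_neg hsi, if_pos hsj] at heq
      subst heq
      by_cases hlt : pieceLo m z q S M B j i < pieceHi m z q S M B j i
      · simp only [pieceLo, pieceHi, if_pos hsj, if_neg hsi] at hlt ⊢
        obtain ⟨-, h1, h2⟩ := clampTo_lt_clampTo (h.dur_pos j hj).le (h.M_le_succ hi)
          (by linarith : clampTo (S j) (q j) (M i) < _)
        right; right; left
        linarith
      · exact Or.inr (Or.inl (not_lt.1 hlt))
    · simp only [slot, if_neg hsi, if_neg hsj] at heq
      omega
  · exact (h.separate_of_slot_lt hj hi hg' hg hlt).symm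

theorem piece_window (h : ListSchedule n m z q S M B conflict) {L p : ℕ → ℝ} {W : ℕ → ℝ}
    (hp : OptimalDurations n m z L W p) (hz : ∀ i < n, 1 ≤ z i) (hm : 1 ≤ m)
    (hL : ∀ i j, i ≤ j → j < n → L i ≤ L j)
    (hq : ∀ i < n, q i = p i / (3 - 4 / ((m : ℝ) + 1))) {i g : ℕ} (hi : i < n)
    (hg : g < pieceCount n m z i)
    (hlt : pieceLo m z q S M B i g < pieceHi m z q S M B i g) :
    0 ≤ pieceLo m z q S M B i g ∧ pieceHi m z q S M B i g ≤ L i := by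
  have hslot := slot_lt hi hg
  refine ⟨(add_nonneg (h.M_nonneg hslot.le) (h.B_nonneg hslot.le)).trans
    (h.slot_bounds hi hg hlt).1, ?_⟩
  by_cases hs : z i + z i ≤ m + 1
  · simp only [pieceCount, pieceLo, pieceHi, if_pos hs] at hlt hg ⊢
    obtain ⟨h1, -, -⟩ := clampTo_lt_clampTo (h.dur_pos i hi).le (h.M_le_succ hg)
      (by linarith : clampTo (S i) (q i) (M g) < _)
    -- A nonempty piece needs `M g < S i + q i`, but `M g` is at least this end for `g > i`. Hence
    -- big jobs listed after `i` do not delay it, and `B (i + 1)` bounds the delay.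
    have hgi : g ≤ i := by
      by_contra hgi
      exact absurd (h.end_le_M (not_le.1 hgi) hg.le hs) (not_le.2 h1)
    have h2 := clampTo_le (a := S i) (x := M (g + 1)) (h.dur_pos i hi).le
    have h3 := h.B_mono (i := g + 1) (j := i + 1) (by omega) (by omega)
    linarith [h.end_add_B_le hp hz hm hL hq le_rfl hi hs]
  · simp only [pieceHi, if_neg hs]
    rcases h.M_eq hi.le with h1 | ⟨k, hk, hks, h1⟩
    · rw [h1, zero_add]
      exact h.B_le hp hm hq hi
    · rw [h1]
      exact h.end_add_B_le hp hz hm hL hq hk.le hi hks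

end ListSchedule

/-! ### Reasoning about programs -/

namespace Memory

variable (s : Memory) (a b i v : ℕ) (w : ℝ)

@[simp] theorem setNat_nat_self : (s.setNat a i v).nat a = Function.update (s.nat a) i v := by
  simp [setNat]

@[simp] theorem setNat_nat_of_ne (h : b ≠ a) : (s.setNat a i v).nat b = s.nat b := by
  simp [setNat, h]

@[simp] theorem setNat_real : (s.setNat a i v).real = s.real := rfl

@[simp] theorem setReal_real_self :
    (s.setReal a i w).real a = Function.update (s.real a) i w := by
  simp [setReal]

@[simp] theorem setReal_real_of_ne (h : b ≠ a) : (s.setReal a i w).real b = s.real b := by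
  simp [setReal, h]

@[simp] theorem setReal_nat : (s.setReal a i w).nat = s.nat := rfl

end Memory

attribute [simp] NExp.eval RExp.eval BExp.Holds

namespace NExp

/-- The value of cell `0` of array `a`: a scalar variable. -/
def var (a : ℕ) : NExp := .get a (.lit 0)

@[simp] theorem eval_var (s : Memory) (a : ℕ) : (var a).eval s = s.nat a 0 := rfl

end NExp

namespace RExp

/-- The value of cell `0` of array `a`: a scalar variable. -/
def var (a : ℕ) : RExp := .get a (.lit 0)

@[simp] theorem eval_var (s : Memory) (a : ℕ) : (var a).eval s = s.real a 0 := rfl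

end RExp

namespace Program

/-- `x := e`. -/
def setN (x : ℕ) (e : NExp) : Program := .storeNat x (.lit 0) e

/-- `x := e`. -/
def setR (x : ℕ) (e : RExp) : Program := .storeReal x (.lit 0) e

/-- The natural arrays that a program writes to. -/
def writesNat : Program → List ℕ
  | skip => []
  | storeNat a _ _ => [a]
  | storeReal _ _ _ => []
  | seq c d => c.writesNat ++ d.writesNat
  | cond _ c d => c.writesNat ++ d.writesNat
  | loop _ c => c.writesNat

/-- The real arrays that a program writes to. -/
def writesReal : Program → List ℕ
  | skip => []
  | storeNat _ _ _ => []
  | storeReal a _ _ => [a]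
  | seq c d => c.writesReal ++ d.writesReal
  | cond _ c d => c.writesReal ++ d.writesReal
  | loop _ c => c.writesReal

/-- The program has no loops. -/
def straight : Program → Bool
  | skip => true
  | storeNat _ _ _ => true
  | storeReal _ _ _ => true
  | seq c d => c.straight && d.straight
  | cond _ c d => c.straight && d.straight
  | loop _ _ => false

/-- A time bound for a program without loops. -/
def bound : Program → ℕ
  | skip => 1
  | storeNat _ i e => i.cost + e.cost + 1
  | storeReal _ i e => i.cost + e.cost + 1
  | seq c d => c.bound + d.bound
  | cond b c d => b.cost + c.bound + d.bound
  | loop _ _ => 0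

open Classical in
/-- The effect of a program without loops. -/
noncomputable def run : Program → Memory → Memory
  | skip, s => s
  | storeNat a i e, s => s.setNat a (i.eval s) (e.eval s)
  | storeReal a i e, s => s.setReal a (i.eval s) (e.eval s)
  | seq c d, s => d.run (c.run s)
  | cond b c d, s => if b.Holds s then c.run s else d.run s
  | loop _ _, s => s

/-- `for x < bnd do body`. -/
def forLoop (x : ℕ) (bnd : NExp) (body : Program) : Program :=
  .seq (setN x (.lit 0)) (.loop (.natLe (.add (.var x) (.lit 1)) bnd)
    (.seq body (setN x (.add (.var x) (.lit 1)))))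

end Program

attribute [simp] Program.run Program.setN Program.setR

/-- `s'` agrees with `s` on the arrays that `c` does not write to. -/
def Frame (c : Program) (s s' : Memory) : Prop :=
  (∀ a, a ∉ c.writesNat → s'.nat a = s.nat a) ∧ ∀ a, a ∉ c.writesReal → s'.real a = s.real a

theorem Frame.refl (c : Program) (s : Memory) : Frame c s s := ⟨fun _ _ => rfl, fun _ _ => rfl⟩

theorem Frame.trans {c : Program} {s s₁ s₂ : Memory} (h : Frame c s s₁) (h' : Frame c s₁ s₂) :
    Frame c s s₂ :=
  ⟨fun a ha => (h'.1 a ha).trans (h.1 a ha), fun a ha => (h'.2 a ha).trans (h.2 a ha)⟩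

theorem Frame.mono {c d : Program} {s s' : Memory} (h : Frame c s s')
    (h1 : c.writesNat ⊆ d.writesNat) (h2 : c.writesReal ⊆ d.writesReal) : Frame d s s' :=
  ⟨fun a ha => h.1 a fun h' => ha (h1 h'), fun a ha => h.2 a fun h' => ha (h2 h')⟩

/-- The arrays written are read off the syntax, so for a concrete program `decide` settles what it
leaves untouched. -/
theorem Exec.frame {c : Program} {s s' : Memory} {t : ℕ} (h : Exec c s t s') : Frame c s s' := by
  induction h with
  | skip s => exact .refl _ _
  | storeNat a i e s =>
    refine ⟨fun b hb => ?_, fun b hb => rfl⟩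
    simp only [Program.writesNat, List.mem_singleton] at hb
    simp [hb]
  | storeReal a i e s =>
    refine ⟨fun b hb => rfl, fun b hb => ?_⟩
    simp only [Program.writesReal, List.mem_singleton] at hb
    simp [hb]
  | seq _ _ ih1 ih2 =>
    exact (ih1.mono (by simp [Program.writesNat]) (by simp [Program.writesReal])).trans
      (ih2.mono (by simp [Program.writesNat]) (by simp [Program.writesReal]))
  | cond_true _ _ ih => exact ih.mono (by simp [Program.writesNat]) (by simp [Program.writesReal])
  | cond_false _ _ ih => exact ih.mono (by simp [Program.writesNat]) (by simp [Program.writesReal])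
  | loop_false _ => exact .refl _ _
  | loop_true _ _ _ ih1 ih2 =>
    exact (ih1.mono (by simp [Program.writesNat]) (by simp [Program.writesReal])).trans ih2

theorem Program.exec_run (c : Program) (hc : c.straight = true) (s : Memory) :
    ∃ t ≤ c.bound, Exec c s t (c.run s) := by
  induction c generalizing s with
  | skip => exact ⟨_, le_rfl, .skip s⟩
  | storeNat a i e => exact ⟨_, le_rfl, .storeNat a i e s⟩
  | storeReal a i e => exact ⟨_, le_rfl, .storeReal a i e s⟩
  | seq c d ihc ihd =>
    simp only [Program.straight, Bool.and_eq_true] at hc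
    obtain ⟨t1, h1, e1⟩ := ihc hc.1 s
    obtain ⟨t2, h2, e2⟩ := ihd hc.2 (c.run s)
    exact ⟨_, Nat.add_le_add h1 h2, .seq e1 e2⟩
  | cond b c d ihc ihd =>
    simp only [Program.straight, Bool.and_eq_true] at hc
    by_cases hb : b.Holds s
    · obtain ⟨t1, h1, e1⟩ := ihc hc.1 s
      refine ⟨b.cost + t1, by simp only [Program.bound]; omega, ?_⟩
      simpa [hb] using Exec.cond_true (d := d) hb e1
    · obtain ⟨t1, h1, e1⟩ := ihd hc.2 s
      refine ⟨b.cost + t1, by simp only [Program.bound]; omega, ?_⟩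
      simpa [hb] using Exec.cond_false (c := c) hb e1
  | loop b c => simp [Program.straight] at hc

/-- Started in `s`, the program `c` halts within `T` steps in a memory that satisfies `Q`. -/
def Runs (c : Program) (s : Memory) (T : ℕ) (Q : Memory → Prop) : Prop :=
  ∃ t s', Exec c s t s' ∧ t ≤ T ∧ Q s'

namespace Runs

variable {c d : Program} {s : Memory} {T T₁ T₂ : ℕ} {Q R : Memory → Prop}

theorem mono_time (h : Runs c s T₁ Q) (hT : T₁ ≤ T₂) : Runs c s T₂ Q := by
  obtain ⟨t, s', h1, h2, h3⟩ := h
  exact ⟨t, s', h1, h2.trans hT, h3⟩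

theorem imp (h : Runs c s T Q) (hQ : ∀ s', Frame c s s' → Q s' → R s') : Runs c s T R := by
  obtain ⟨t, s', h1, h2, h3⟩ := h
  exact ⟨t, s', h1, h2, hQ s' h1.frame h3⟩

theorem of_run (hc : c.straight = true) (hT : c.bound ≤ T) (hQ : Q (c.run s)) : Runs c s T Q := by
  obtain ⟨t, ht, e⟩ := c.exec_run hc s
  exact ⟨t, _, e, ht.trans hT, hQ⟩

theorem seq (hc : Runs c s T₁ R) (hd : ∀ s', Frame c s s' → R s' → Runs d s' T₂ Q) :
    Runs (.seq c d) s (T₁ + T₂) Q := by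
  obtain ⟨t1, s1, e1, h1, hR⟩ := hc
  obtain ⟨t2, s2, e2, h2, hQ⟩ := hd s1 e1.frame hR
  exact ⟨_, s2, .seq e1 e2, Nat.add_le_add h1 h2, hQ⟩

theorem cond {b : BExp} (hc : b.Holds s → Runs c s T Q) (hd : ¬ b.Holds s → Runs d s T Q) :
    Runs (.cond b c d) s (b.cost + T) Q := by
  by_cases hb : b.Holds s
  · obtain ⟨t, s', e, h, hQ⟩ := hc hb
    exact ⟨_, s', .cond_true hb e, by omega, hQ⟩
  · obtain ⟨t, s', e, h, hQ⟩ := hd hb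
    exact ⟨_, s', .cond_false hb e, by omega, hQ⟩

/-- A loop with invariant `Inv f`, where `f` decreases in every iteration. -/
theorem loop {b : BExp} {K : ℕ} {Inv : ℕ → Memory → Prop} (f : ℕ) (h0 : Inv f s)
    (step : ∀ f s', Frame c s s' → Inv f s' → b.Holds s' →
      Runs c s' K fun s'' => ∃ f' < f, Inv f' s'') :
    Runs (.loop b c) s ((b.cost + K) * f + b.cost) fun s' => ¬ b.Holds s' ∧ ∃ f', Inv f' s' := by
  have key : ∀ f s', Frame c s s' → Inv f s' →
      Runs (.loop b c) s' ((b.cost + K) * f + b.cost)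
        fun s' => ¬ b.Holds s' ∧ ∃ f', Inv f' s' := by
    intro f
    induction f using Nat.strong_induction_on with
    | _ f ih =>
      intro s' hfr hinv
      by_cases hb : b.Holds s'
      · obtain ⟨t, s1, e1, ht, f', hf', hinv'⟩ := step f s' hfr hinv hb
        obtain ⟨t2, s2, e2, ht2, hQ⟩ := ih f' hf' s1 (hfr.trans e1.frame) hinv'
        refine ⟨_, s2, .loop_true hb e1 e2, ?_, hQ⟩
        have : (b.cost + K) * (f' + 1) ≤ (b.cost + K) * f := Nat.mul_le_mul_left _ hf'
        rw [Nat.mul_add] at this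
        omega
      · exact ⟨_, s', .loop_false hb, by omega, hb, f, hinv⟩
  exact key f s (.refl _ _) h0

/-- A loop over `x < N` with invariant `Inv x`. -/
theorem forLoop {x N n K : ℕ} {bnd : NExp} {Inv : ℕ → Memory → Prop}
    (hNn : N ≤ n) (hn : 0 < n) (hx : x ∉ c.writesNat)
    (hbnd : ∀ s', Frame (.forLoop x bnd c) s s' → bnd.eval s' = N)
    (h0 : Inv 0 (s.setNat x 0 0))
    (step : ∀ y < N, ∀ s', Frame (.forLoop x bnd c) s s' → s'.nat x 0 = y → Inv y s' →
      Runs c s' K fun s'' => Inv (y + 1) (s''.setNat x 0 (y + 1))) :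
    Runs (.forLoop x bnd c) s ((2 * bnd.cost + K + 20) * n) (Inv N) := by
  have hsub1 : c.writesNat ⊆ (Program.forLoop x bnd c).writesNat := by
    simp [Program.forLoop, Program.writesNat]
  have hsub2 : c.writesReal ⊆ (Program.forLoop x bnd c).writesReal := by
    simp [Program.forLoop, Program.writesReal]
  have hset : ∀ (s : Memory) v, Frame (.forLoop x bnd c) s (s.setNat x 0 v) := by
    refine fun s v => ⟨fun a ha => ?_, fun a ha => rfl⟩
    have : a ≠ x := by rintro rfl; simp [Program.forLoop, Program.writesNat] at ha
    simp [this]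
  -- The fuel counts the missing iterations. The frame belongs to the invariant because `bnd` is
  -- evaluated anew in every test.
  have hloop := Runs.loop (c := .seq c (.setN x (.add (.var x) (.lit 1))))
    (b := .natLe (.add (.var x) (.lit 1)) bnd) (s := s.setNat x 0 0)
    (K := K + 6)
    (Inv := fun f s' => ∃ y, f + y = N ∧ Frame (.forLoop x bnd c) s s' ∧ s'.nat x 0 = y ∧ Inv y s')
    N ⟨0, rfl, hset _ _, by simp, h0⟩ ?_
  · obtain ⟨t, s', e, ht, hb, f, y, hy, hfr, hxy, hinv⟩ := hloop
    have hbn := hbnd s' hfr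
    simp only [BExp.Holds, NExp.eval, NExp.eval_var, hbn, hxy] at hb
    obtain rfl : y = N := by omega
    refine ⟨_, s', .seq (.storeNat _ _ _ _) e, ?_, hinv⟩
    simp only [BExp.cost, NExp.cost, NExp.var] at ht ⊢
    nlinarith [Nat.mul_le_mul_left (bnd.cost + K + 12) hNn]
  · rintro f s' - ⟨y, hy, hfr, hxy, hinv⟩ hb
    have hbn := hbnd s' hfr
    simp only [BExp.Holds, NExp.eval, NExp.eval_var, hbn, hxy] at hb
    obtain ⟨t, s1, e1, ht, hinv'⟩ := step y (by omega) s' hfr hxy hinv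
    refine ⟨_, _, .seq e1 (.storeNat _ _ _ _), ?_, f - 1, by omega, y + 1, by omega, ?_, ?_, ?_⟩
    · simp only [NExp.cost, NExp.var]; omega
    · exact (hfr.trans (e1.frame.mono hsub1 hsub2)).trans (hset _ _)
    · simp [e1.frame.1 x hx, hxy]
    · simpa [e1.frame.1 x hx, hxy] using hinv'

end Runs

/-! ### Sorting -/

/-- Job `j` precedes job `i`: smaller key, ties broken by the index. -/
def Precedes (key : ℕ → ℝ) (j i : ℕ) : Prop := key j ≤ key i ∧ ¬ (key i ≤ key j ∧ i ≤ j)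

open Classical in
/-- The number of predecessors of `i` among the first `y` jobs. -/
noncomputable def rankBelow (key : ℕ → ℝ) (i y : ℕ) : ℕ :=
  ((Finset.range y).filter fun j => Precedes key j i).card

/-- `o` lists the numbers below `n` in the order of increasing keys. -/
def Sorts (n : ℕ) (key : ℕ → ℝ) (o : ℕ → ℕ) : Prop :=
  ∃ e : Equiv.Perm (Fin n), (∀ a : Fin n, o a = e a) ∧ ∀ a b : Fin n, a ≤ b → key (e a) ≤ key (e b)

theorem Precedes.trans {key : ℕ → ℝ} {i j k : ℕ} (h : Precedes key i j) (h' : Precedes key j k) :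
    Precedes key i k := by
  refine ⟨h.1.trans h'.1, fun h2 => ?_⟩
  have h3 : ¬ j ≤ i := fun hh => h.2 ⟨h'.1.trans h2.1, hh⟩
  have h4 : ¬ k ≤ j := fun hh => h'.2 ⟨h2.1.trans h.1, hh⟩
  omega

theorem not_precedes_self {key : ℕ → ℝ} {i : ℕ} : ¬ Precedes key i i := by simp [Precedes]

theorem rankBelow_lt_of_precedes {key : ℕ → ℝ} {n i j : ℕ} (hi : i < n) (h : Precedes key i j) :
    rankBelow key i n < rankBelow key j n := by
  refine Finset.card_lt_card (Finset.ssubset_iff_of_subset ?_ |>.2 ⟨i, ?_, ?_⟩)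
  · intro k hk
    simp only [Finset.mem_filter] at hk ⊢
    exact ⟨hk.1, hk.2.trans h⟩
  · simp [hi, h]
  · simp [not_precedes_self]

theorem rankBelow_ne {key : ℕ → ℝ} {n i j : ℕ} (hi : i < n) (hj : j < n) (hij : i ≠ j) :
    rankBelow key i n ≠ rankBelow key j n := by
  have : Precedes key i j ∨ Precedes key j i := by
    unfold Precedes
    rcases lt_trichotomy (key i) (key j) with h | h | h
    · left; exact ⟨h.le, fun h' => absurd h'.1 (not_le.2 h)⟩
    · rcases Nat.lt_or_ge i j with h' | h'
      · left; exact ⟨h.le, fun h'' => by omega⟩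
      · right; exact ⟨h.ge, fun h'' => by omega⟩
    · right; exact ⟨h.le, fun h' => absurd h'.1 (not_le.2 h)⟩
  rcases this with h | h
  · exact (rankBelow_lt_of_precedes hi h).ne
  · exact (rankBelow_lt_of_precedes hj h).ne'

theorem rankBelow_lt {key : ℕ → ℝ} {n i : ℕ} (hi : i < n) : rankBelow key i n < n := by
  classical
  have h1 : (Finset.range n).card = n := Finset.card_range n
  conv_rhs => rw [← h1]
  refine Finset.card_lt_card (Finset.ssubset_iff_of_subset (Finset.filter_subset _ _) |>.2
    ⟨i, by simpa using hi, by simp [not_precedes_self]⟩)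

/-- Distinct jobs have distinct ranks below `n`, so the rank is a permutation, and `o` is its
inverse. -/
theorem sorts_of_rank {n : ℕ} {key : ℕ → ℝ} {o : ℕ → ℕ}
    (h : ∀ i < n, o (rankBelow key i n) = i) : Sorts n key o := by
  let r : Fin n → Fin n := fun i => ⟨rankBelow key i n, rankBelow_lt i.2⟩
  have hr : Function.Injective r := by
    intro i j hij
    by_contra hne
    exact rankBelow_ne i.2 j.2 (fun h => hne (Fin.ext h)) (congrArg Fin.val hij)
  let E := Equiv.ofBijective r (Finite.injective_iff_bijective.1 hr)
  have hE : ∀ a, rankBelow key (E.symm a) n = a := fun a =>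
    congrArg Fin.val (E.apply_symm_apply a)
  refine ⟨E.symm, fun a => ?_, fun a b hab => ?_⟩
  · have := h (E.symm a) (E.symm a).2
    rwa [hE] at this
  · by_contra hlt
    have h1 : Precedes key (E.symm b) (E.symm a) :=
      ⟨(not_le.1 hlt).le, fun h' => hlt h'.1⟩
    have h2 := rankBelow_lt_of_precedes (n := n) (E.symm b).2 h1
    rw [hE, hE] at h2
    exact absurd hab (not_le.2 h2)

/-- Count the predecessors of the job in variable `20` with respect to the keys in the real array
`key`. -/
def countBody (key : ℕ) : Program :=
  .cond (.and (.realLe (.get key (.var 21)) (.get key (.var 20)))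
      (.not (.and (.realLe (.get key (.var 20)) (.get key (.var 21))) (.natLe (.var 20) (.var 21)))))
    (.setN 22 (.add (.var 22) (.lit 1))) .skip

/-- Writes the order of increasing keys into the natural array `out`. -/
def sortProgram (key out : ℕ) : Program :=
  .forLoop 20 (.var 0) (.seq (.setN 22 (.lit 0)) (.seq (.forLoop 21 (.var 0) (countBody key))
    (.storeNat out (.var 22) (.var 20))))

theorem rankBelow_succ (key : ℕ → ℝ) (i y : ℕ) [Decidable (Precedes key y i)] :
    rankBelow key i (y + 1) = rankBelow key i y + if Precedes key y i then 1 else 0 := by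
  classical
  unfold rankBelow
  rw [Finset.range_add_one, Finset.filter_insert]
  split_ifs
  · rw [Finset.card_insert_of_notMem (by simp)]
  · simp

theorem count_runs {key n : ℕ} {s : Memory} (hn : 0 < n) (hs : s.nat 0 0 = n)
    (h22 : s.nat 22 0 = 0) :
    Runs (.forLoop 21 (.var 0) (countBody key)) s ((2 * 2 + (countBody key).bound + 20) * n)
      fun s' => s'.nat 22 0 = rankBelow (s.real key) (s.nat 20 0) n := by
  refine Runs.forLoop (N := n)
    (Inv := fun y s' => s'.nat 22 0 = rankBelow (s.real key) (s.nat 20 0) y)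
    le_rfl hn (by simp [countBody, Program.writesNat]) (fun s' hf => ?_) ?_ fun y hy s' hf hy' inv => ?_
  · simp [hf.1 0 (by simp [Program.forLoop, countBody, Program.writesNat]), hs]
  · simp [h22, rankBelow]
  · have e1 := hf.2 key (by simp [Program.forLoop, countBody, Program.writesReal])
    have e2 := hf.1 20 (by simp [Program.forLoop, countBody, Program.writesNat])
    refine Runs.of_run (by simp [countBody, Program.straight]) le_rfl ?_
    classical
    rw [rankBelow_succ, ← inv]
    simp only [countBody, Program.run, BExp.Holds, RExp.eval, NExp.eval_var, e1, e2, hy', Precedes,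
      Program.setN]
    split_ifs with h
    · simp [h]
    · rw [not_and_not_right] at h
      simpa using h

/-- Each job is written to the cell of its rank; since ranks are distinct, no entry is overwritten.
-/
theorem sort_runs {key out n : ℕ} {s : Memory} (hn : 0 < n) (hs : s.nat 0 0 = n)
    (hout : out ∉ [0, 20, 21, 22]) :
    Runs (sortProgram key out) s ((300 + (countBody key).bound) * n * n)
      fun s' => Sorts n (s.real key) (s'.nat out) := by
  obtain ⟨h0, h20, h21, h22⟩ : out ≠ 0 ∧ out ≠ 20 ∧ out ≠ 21 ∧ out ≠ 22 := by simpa using hout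
  have hT : (2 * 2 + (((24 + (countBody key).bound) * n + 20)) + 20) * n
      ≤ (300 + (countBody key).bound) * n * n := by nlinarith [Nat.mul_le_mul hn hn, Nat.mul_le_mul_left n hn]
  refine Runs.imp (Runs.mono_time (Runs.forLoop (N := n)
    (Inv := fun x s' => ∀ i < x, s'.nat out (rankBelow (s.real key) i n) = i)
    le_rfl hn (by simp [countBody, Program.writesNat, Program.forLoop]; omega) (fun s' hf => ?_) ?_
    fun x hx s' hf hx' inv => ?_) hT)
    fun s' _ h => sorts_of_rank h
  · rw [NExp.eval_var, hf.1 0 (by simp [Program.forLoop, countBody, Program.writesNat]; omega), hs]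
  · simp
  · have e1 := hf.2 key (by simp [Program.forLoop, countBody, Program.writesReal])
    have e0 := hf.1 0 (by simp [Program.forLoop, countBody, Program.writesNat]; omega)
    refine Runs.mono_time (T₁ := 3 + ((2 * 2 + (countBody key).bound + 20) * n + 5)) (Runs.seq
      (R := fun s1 => s1 = s'.setNat 22 0 0) (T₁ := 3)
      (Runs.of_run rfl le_rfl (by simp)) ?_) (by linarith)
    rintro s1 - rfl
    refine Runs.seq (count_runs hn (by simp [e0, hs]) (by simp)) fun s2 hf2 h2 => ?_
    have f20 := hf2.1 20 (by simp [Program.forLoop, countBody, Program.writesNat])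
    have fout := hf2.1 out (by simp [Program.forLoop, countBody, Program.writesNat, *])
    simp only [Memory.setNat_real, e1, ne_eq, Nat.reduceEqDiff, not_false_eq_true,
      Memory.setNat_nat_of_ne, hx', h22] at h2 f20 fout
    refine Runs.of_run rfl le_rfl ?_
    intro i hi
    simp only [Program.run, NExp.eval_var, f20, hx', h2]
    rw [Memory.setNat_nat_of_ne _ _ _ _ _ h20, Memory.setNat_nat_self, Function.update_apply]
    rcases Nat.lt_succ_iff_lt_or_eq.1 hi with hi | rfl
    · rw [if_neg (rankBelow_ne (hi.trans hx) hx hi.ne), fout]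
      exact inv i hi
    · simp

/-! ### Computing the optimal durations -/

/-- Jobs `i < n` in the order of deadlines: sizes `z`, lengths `L`, volumes `W`; `D` is `L` shifted
by one, and `o` lists the jobs by decreasing density. -/
structure SortedJobs (n m : ℕ) (z : ℕ → ℕ) (L W D : ℕ → ℝ) (o : ℕ → ℕ) : Prop where
  one_le_size : ∀ i < n, 1 ≤ z i
  size_le : ∀ i < n, z i ≤ m
  length_pos : ∀ i < n, 0 < L i
  work_pos : ∀ i < n, 0 < W i
  length_mono : ∀ i j, i ≤ j → j < n → L i ≤ L j
  shift_zero : D 0 = 0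
  shift_succ : ∀ i < n, D (i + 1) = L i
  sorts : Sorts n (fun i => 0 - W i / L i) o

namespace SortedJobs

variable {n m : ℕ} {z : ℕ → ℕ} {L W D : ℕ → ℝ} {o : ℕ → ℕ}

theorem shift_mono (h : SortedJobs n m z L W D o) {i j : ℕ} (hij : i ≤ j) (hj : j ≤ n) :
    D i ≤ D j := by
  refine le_of_le_succ_below (n := n) (fun i hi => ?_) hij hj
  rw [h.shift_succ i hi]
  rcases i with _ | i
  · rw [h.shift_zero]; exact (h.length_pos 0 hi).le
  · rw [h.shift_succ i (by omega)]; exact h.length_mono _ _ (by omega) hi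

theorem order_lt (h : SortedJobs n m z L W D o) {x : ℕ} (hx : x < n) : o x < n := by
  obtain ⟨e, he, -⟩ := h.sorts
  rw [he ⟨x, hx⟩]
  exact (e _).2

theorem order_notMem (h : SortedJobs n m z L W D o) {x : ℕ} (hx : x < n) :
    o x ∉ (Finset.range x).image o := by
  obtain ⟨e, he, -⟩ := h.sorts
  rw [Finset.mem_image]
  rintro ⟨y, hy, hyx⟩
  have hy := Finset.mem_range.1 hy
  have h1 := he ⟨x, hx⟩
  have h2 := he ⟨y, hy.trans hx⟩
  simp only at h1 h2
  have := e.injective (Fin.ext (h2.symm.trans (hyx.trans h1)))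
  simp at this
  omega

theorem mem_image_order (h : SortedJobs n m z L W D o) {j : ℕ} (hj : j < n) :
    j ∈ (Finset.range n).image o := by
  obtain ⟨e, he, -⟩ := h.sorts
  refine Finset.mem_image.2 ⟨e.symm ⟨j, hj⟩, by simp, ?_⟩
  rw [he]; simp

theorem density_le (h : SortedJobs n m z L W D o) {x j : ℕ} (hx : x < n) (hj : j < n)
    (hjx : j ∉ (Finset.range x).image o) : W j * L (o x) ≤ W (o x) * L j := by
  have hox := h.order_lt hx
  obtain ⟨e, he, hmono⟩ := h.sorts
  have h1 : x ≤ (e.symm ⟨j, hj⟩ : Fin n) := by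
    by_contra hlt
    exact hjx (Finset.mem_image.2 ⟨e.symm ⟨j, hj⟩, by simpa using hlt, by rw [he]; simp⟩)
  have h2 := hmono ⟨x, hx⟩ (e.symm ⟨j, hj⟩) h1
  have h3 := he ⟨x, hx⟩
  simp only [Equiv.apply_symm_apply] at h2 h3
  rw [← h3] at h2
  have h4 : W j / L j ≤ W (o x) / L (o x) := by linarith
  rwa [div_le_div_iff₀ (h.length_pos j hj) (h.length_pos _ hox)] at h4

end SortedJobs

/-- The job `x` is in the block from `lo = nat 31 0` to `k = nat 30 0`. -/
def inBlock (x : NExp) : BExp := .and (.natLe (.var 31) x) (.natLe x (.var 30))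

/-- Adds the work of the job in variable `33`, if it is in the block. -/
def blockWorkBody : Program :=
  .cond (inBlock (.var 33))
    (.setR 20 (.add (.var 20) (.mul (.ofNat (.get 11 (.var 33))) (.get 12 (.var 33))))) .skip

/-- Runs the next densest job of the block at its full length, if the level is below its density. -/
def fillBody : Program :=
  .cond (.and (inBlock (.get 12 (.var 33)))
      (.not (.realLe (.mul (.get 12 (.get 12 (.var 33))) (.var 21))
        (.mul (.var 20) (.get 11 (.get 12 (.var 33)))))))
    (.seq (.setR 20 (.sub (.var 20)
        (.mul (.ofNat (.get 11 (.get 12 (.var 33)))) (.get 12 (.get 12 (.var 33))))))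
      (.setR 21 (.sub (.var 21)
        (.mul (.ofNat (.get 11 (.get 12 (.var 33)))) (.get 11 (.get 12 (.var 33)))))))
    .skip

/-- Stores the level of the block for the job in variable `33`. -/
def storeLevelBody : Program :=
  .cond (inBlock (.var 33)) (.storeReal 22 (.var 33) (.var 25)) .skip

/-- Computes the level of the block from `nat 31 0` to `nat 30 0`, in real variable `25`, and stores
it for all jobs of the block in the real array `22`. -/
def levelProgram : Program :=
  .seq (.setR 20 (.ofNat (.lit 0)))
  (.seq (.forLoop 33 (.var 0) blockWorkBody)
  (.seq (.setR 21 (.mul (.ofNat (.get 0 (.lit 1)))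
      (.sub (.get 14 (.add (.var 30) (.lit 1))) (.get 14 (.var 31)))))
  (.seq (.forLoop 33 (.var 0) fillBody)
  (.seq (.setR 25 (.div (.var 20) (.add (.var 20) (.var 21))))
    (.forLoop 33 (.var 0) storeLevelBody)))))

/-! ### Correctness of the level computation and of the pooling -/

/-- The level `l` fills the volume that is available to the jobs from `a` to `b - 1`. -/
def IsLevel (z : ℕ → ℕ) (L W D : ℕ → ℝ) (a b : ℕ) (l : ℝ) : Prop :=
  0 ≤ l ∧ l ≤ 1 ∧ ∑ i ∈ Finset.Ico a b, z i * levelDuration (L i) (W i) l ≤ D b - D a ∧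
    (0 < l → ∑ i ∈ Finset.Ico a b, z i * levelDuration (L i) (W i) l = D b - D a)

theorem blockWork_runs {n : ℕ} {s : Memory} (hn : 0 < n) (hs : s.nat 0 0 = n)
    (hk : s.nat 30 0 < n) (h20 : s.real 20 0 = 0) :
    Runs (.forLoop 33 (.var 0) blockWorkBody) s ((4 + blockWorkBody.bound + 20) * n) fun s' =>
      s'.real 20 0 = ∑ i ∈ Finset.Ico (s.nat 31 0) (s.nat 30 0 + 1), s.nat 11 i * s.real 12 i := by
  refine Runs.imp (Runs.forLoop (N := n)
    (Inv := fun x s' => s'.real 20 0 =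
      ∑ i ∈ Finset.range x, if s.nat 31 0 ≤ i ∧ i ≤ s.nat 30 0 then s.nat 11 i * s.real 12 i else 0)
    le_rfl hn (by decide) (fun s' hf => by simp [hf.1 0 (by decide), hs]) (by simp [h20])
    fun y hy s' hf hy' inv => Runs.of_run rfl le_rfl ?_) fun s' _ h => ?_
  · have e1 := hf.1 31 (by decide)
    have e2 := hf.1 30 (by decide)
    have e3 := hf.1 11 (by decide)
    have e4 := hf.2 12 (by decide)
    rw [Finset.sum_range_succ, ← inv]
    simp only [blockWorkBody, inBlock, Program.run, BExp.Holds, NExp.eval_var, e1, e2, hy',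
      Program.setR]
    split_ifs <;> simp [hy', e3, e4]
  · rw [h, ← Finset.sum_filter]
    refine Finset.sum_congr ?_ fun _ _ => rfl
    ext i
    simp
    omega

/-- The scan need not stop at the first rejection: `V` and `c` then stay as they are, and every
later test for a job of the block fails. -/
theorem fill_runs {n m : ℕ} {s : Memory} {L W D : ℕ → ℝ} {z o : ℕ → ℕ} {C : ℝ} (hn : 0 < n)
    (hs : s.nat 0 0 = n)
    (hz : s.nat 11 = z) (ho : s.nat 12 = o) (hL : s.real 11 = L) (hW : s.real 12 = W)
    (hjobs : SortedJobs n m z L W D o) (hk : s.nat 30 0 < n) (hC : 0 ≤ C)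
    (h20 : s.real 20 0 = ∑ i ∈ Finset.Ico (s.nat 31 0) (s.nat 30 0 + 1), z i * W i)
    (h21 : s.real 21 0 = C) :
    Runs (.forLoop 33 (.var 0) fillBody) s ((4 + fillBody.bound + 20) * n) fun s' =>
      ∃ K, Filling z L W C (Finset.Ico (s.nat 31 0) (s.nat 30 0 + 1)) ((Finset.range n).image o) K
        (s'.real 20 0) (s'.real 21 0) := by
  refine Runs.forLoop (N := n)
    (Inv := fun x s' => ∃ K, Filling z L W C (Finset.Ico (s.nat 31 0) (s.nat 30 0 + 1))
      ((Finset.range x).image o) K (s'.real 20 0) (s'.real 21 0))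
    le_rfl hn (by decide) (fun s' hf => by simp [hf.1 0 (by decide), hs])
    ⟨∅, by simpa [h20, h21] using Filling.init hC⟩
    fun y hy s' hf hy' ⟨K, inv⟩ => Runs.of_run rfl le_rfl ?_
  have e1 := hf.1 31 (by decide)
  have e2 := hf.1 30 (by decide)
  have e3 := (hf.1 11 (by decide)).trans hz
  have e4 := (hf.1 12 (by decide)).trans ho
  have e5 := (hf.2 11 (by decide)).trans hL
  have e6 := (hf.2 12 (by decide)).trans hW
  rw [Finset.range_add_one, Finset.image_insert]
  have hBn : ∀ i ∈ Finset.Ico (s.nat 31 0) (s.nat 30 0 + 1), i < n := fun i hi => by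
    have := Finset.mem_Ico.1 hi; omega
  simp only [fillBody, inBlock, Program.run, BExp.Holds, NExp.eval, NExp.eval_var, e1, e2, e4, hy',
      Program.setR, RExp.eval, RExp.eval_var, e5, e6]
  split_ifs with hcond
  · obtain ⟨⟨h1, h2⟩, h3⟩ := hcond
    have hiB : o y ∈ Finset.Ico (s.nat 31 0) (s.nat 30 0 + 1) := Finset.mem_Ico.2 ⟨h1, by omega⟩
    refine ⟨insert (o y) K, ?_⟩
    simpa [hy', e3, e4, e5, e6] using inv.accept (fun i hi => hjobs.one_le_size i (hBn i hi))
      (fun i hi => hjobs.length_pos i (hBn i hi)) (fun i hi => hjobs.work_pos i (hBn i hi)) hiB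
      (hjobs.order_notMem hy) (not_le.1 h3)
  · refine ⟨K, ?_⟩
    by_cases hiB : o y ∈ Finset.Ico (s.nat 31 0) (s.nat 30 0 + 1)
    · have h3 : W (o y) * s'.real 21 0 ≤ s'.real 20 0 * L (o y) := by
        by_contra h3
        have := Finset.mem_Ico.1 hiB
        exact hcond ⟨⟨this.1, by omega⟩, h3⟩
      simpa using inv.reject (fun i hi => hjobs.length_pos i (hBn i hi)) hiB
        (fun j hj hjT => hjobs.density_le hy (hBn j hj) hjT) h3
    · simpa using inv.skip hiB

/-- The density order is global. Filtering it by membership in the block, at linear cost, avoids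
sorting each block. -/
theorem level_runs {n m : ℕ} {s : Memory} {L W D : ℕ → ℝ} {z o : ℕ → ℕ} (hn : 0 < n)
    (hs : s.nat 0 0 = n) (hm : s.nat 0 1 = m)
    (hz : s.nat 11 = z) (ho : s.nat 12 = o) (hL : s.real 11 = L) (hW : s.real 12 = W)
    (hD : s.real 14 = D) (hjobs : SortedJobs n m z L W D o) (hk : s.nat 30 0 < n)
    (hlo : s.nat 31 0 ≤ s.nat 30 0) :
    Runs levelProgram s (500 * n) fun s' =>
      IsLevel z L W (fun i => m * D i) (s.nat 31 0) (s.nat 30 0 + 1) (s'.real 25 0) ∧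
      ∀ i < n, s'.real 22 i =
        if s.nat 31 0 ≤ i ∧ i ≤ s.nat 30 0 then s'.real 25 0 else s.real 22 i := by
  have hT : 10 + ((4 + blockWorkBody.bound + 20) * n + (20 + ((4 + fillBody.bound + 20) * n +
      (20 + (4 + storeLevelBody.bound + 20) * n)))) ≤ 500 * n := by
    have h1 : blockWorkBody.bound = 25 := rfl
    have h2 : fillBody.bound = 61 := rfl
    have h3 : storeLevelBody.bound = 17 := rfl
    rw [h1, h2, h3]
    omega
  refine Runs.mono_time ?_ hT
  refine Runs.seq (R := fun s1 => s1 = s.setReal 20 0 0)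
    (Runs.of_run rfl (by decide) (by simp)) ?_
  rintro s1 - rfl
  refine Runs.seq (blockWork_runs hn (by simpa using hs) (by simpa using hk) (by simp)) ?_
  intro s2 hf2 h2
  simp only [Memory.setReal_nat, ne_eq, Nat.reduceEqDiff, not_false_eq_true,
    Memory.setReal_real_of_ne, hz, hW] at h2
  have g : ∀ a, a ∉ (Program.forLoop 33 (.var 0) blockWorkBody).writesNat → s2.nat a = s.nat a :=
    hf2.1
  have g' : ∀ a, a ≠ 20 → a ∉ (Program.forLoop 33 (.var 0) blockWorkBody).writesReal →
    s2.real a = s.real a := fun a ha h => by rw [hf2.2 a h]; simp [ha]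
  set C : ℝ := m * D (s.nat 30 0 + 1) - m * D (s.nat 31 0) with hCdef
  refine Runs.seq (R := fun s3 => s3 = s2.setReal 21 0 C)
    (Runs.of_run rfl (by decide) ?_) ?_
  · simp [g 0 (by decide), g 30 (by decide), g 31 (by decide), g' 14 (by decide) (by decide), hm, hD,
      hCdef, mul_sub]
  rintro s3 - rfl
  have hC : 0 ≤ C := by
    have := hjobs.shift_mono (i := s.nat 31 0) (j := s.nat 30 0 + 1) (by omega) (by omega)
    rw [hCdef, ← mul_sub]
    exact mul_nonneg (by positivity) (by linarith)
  refine Runs.seq (fill_runs (m := m) (D := D) (C := C) (z := z) (o := o) (L := L) (W := W) hn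
    (by simp [g 0 (by decide), hs]) (by simp [g 11 (by decide), hz])
    (by simp [g 12 (by decide), ho]) (by simp [g' 11 (by decide) (by decide), hL])
    (by simp [g' 12 (by decide) (by decide), hW]) hjobs (by simpa [g 30 (by decide)] using hk) hC
    (by simp [g 31 (by decide), g 30 (by decide), h2]) (by simp)) ?_
  rintro s4 hf4 ⟨K, hK⟩
  simp only [Memory.setReal_nat, g 30 (by decide), g 31 (by decide)] at hK
  have hlev := hK.level (fun i hi => hjobs.one_le_size i (by have := Finset.mem_Ico.1 hi; omega))
    (fun i hi => hjobs.work_pos i (by have := Finset.mem_Ico.1 hi; omega))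
    ⟨s.nat 31 0, Finset.mem_Ico.2 ⟨le_rfl, by omega⟩⟩
    (fun i hi => hjobs.mem_image_order (by have := Finset.mem_Ico.1 hi; omega))
  set lev := s4.real 20 0 / (s4.real 20 0 + s4.real 21 0)
  have q : ∀ a, a ∉ (Program.forLoop 33 (.var 0) fillBody).writesNat → s4.nat a = s.nat a := by
    intro a ha
    rw [hf4.1 a ha]
    exact g a ha
  have q22 : s4.real 22 = s.real 22 := by
    rw [hf4.2 22 (by decide), Memory.setReal_real_of_ne _ _ _ _ _ (by decide),
      g' 22 (by decide) (by decide)]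
  refine Runs.seq (R := fun s5 => s5 = s4.setReal 25 0 lev)
    (Runs.of_run rfl (by decide) (by simp [lev])) ?_
  rintro s5 - rfl
  refine Runs.imp (Runs.forLoop (N := n)
    (Inv := fun x s' => ∀ i < n, s'.real 22 i =
      if s.nat 31 0 ≤ i ∧ i ≤ s.nat 30 0 ∧ i < x then lev else s.real 22 i)
    le_rfl hn (by decide) (fun s' hf => by simp [hf.1 0 (by decide), q 0 (by decide), hs])
    (by simp [q22]) fun y hy s' hf hy' inv => Runs.of_run rfl le_rfl ?_) fun s' hf h => ?_
  · have e1 : s'.nat 31 = s.nat 31 := by rw [hf.1 31 (by decide)]; simp [q 31 (by decide)]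
    have e2 : s'.nat 30 = s.nat 30 := by rw [hf.1 30 (by decide)]; simp [q 30 (by decide)]
    have e3 : s'.real 25 0 = lev := by rw [hf.2 25 (by decide)]; simp
    intro i hi
    simp only [storeLevelBody, inBlock, Program.run, BExp.Holds, NExp.eval_var, e1, e2, hy',
      Memory.setNat_real]
    have := inv i hi
    split_ifs with h1 h2 h2
    · simp only [Memory.setReal_real_self, RExp.eval_var, e3,
        Function.update_apply]
      split_ifs with h3
      · rfl
      · rw [this, if_pos ⟨h2.1, h2.2.1, by omega⟩]
    · simp only [Memory.setReal_real_self, RExp.eval_var, e3,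
        Function.update_apply]
      rw [if_neg (by rintro rfl; exact h2 ⟨h1.1, h1.2, by omega⟩), this,
        if_neg (by omega)]
    · rw [this, if_pos ⟨h2.1, h2.2.1, by omega⟩]
    · rw [this, if_neg (by omega)]
  · have e3 : s'.real 25 0 = lev := by rw [hf.2 25 (by decide)]; simp
    rw [e3]
    refine ⟨hlev, fun i hi => ?_⟩
    rw [h i hi]
    simp [hi]

/-- Merges the current block with its predecessor, if the levels do not decrease; otherwise closes
it. -/
def poolStep : Program :=
  .cond (.and (.natLe (.lit 1) (.var 31)) (.realLe (.get 22 (.sub (.var 31) (.lit 1))) (.var 25)))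
    (.setN 31 (.get 32 (.sub (.var 31) (.lit 1))))
    (.seq (.storeNat 32 (.var 30) (.var 31)) (.seq (.setN 30 (.add (.var 30) (.lit 1)))
      (.setN 31 (.var 30))))

/-- Pools adjacent blocks until the levels decrease. -/
def poolProgram : Program :=
  .seq (.setN 30 (.lit 0)) (.seq (.setN 31 (.lit 0))
    (.loop (.natLe (.add (.var 30) (.lit 1)) (.var 0)) (.seq levelProgram poolStep)))

/-- The current block `a, …, k` is a single job or the union of two blocks to be merged. -/
def Pending (f : ℕ → ℝ → ℝ) (D : ℕ → ℝ) (a k : ℕ) : Prop :=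
  a = k ∨ ∃ b l l', Block f D a b l ∧ Block f D b (k + 1) l' ∧ l ≤ l'

/-- The program fits only the total volume of the block. The inner constraints are void for a single
job and come from `Block.merge` for a union of two blocks. -/
theorem Pending.block {n m : ℕ} {L W D : ℕ → ℝ} {z o : ℕ → ℕ} (hjobs : SortedJobs n m z L W D o)
    {a k : ℕ} {r : ℝ} {D' : ℕ → ℝ} (hk : k < n) (hr : IsLevel z L W D' a (k + 1) r)
    (h : Pending (fun i l => z i * levelDuration (L i) (W i) l) D' a k) :
    Block (fun i l => z i * levelDuration (L i) (W i) l) D' a (k + 1) r := by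
  obtain ⟨h0, h1, hle, heq⟩ := hr
  rcases h with rfl | ⟨b, l, l', hb, hb', hll⟩
  · refine ⟨by omega, h0, h1, fun j haj hj => ?_, heq⟩
    rcases haj.eq_or_lt with rfl | haj
    · simp
    · obtain rfl : j = a + 1 := by omega
      exact hle
  · refine hb.merge hb' hll (fun i _ hi x y hx hxy _ => ?_) h0 h1 hle heq
    exact mul_le_mul_of_nonneg_left (levelDuration_anti (hjobs.length_pos i (by omega))
      (hjobs.work_pos i (by omega)) hx hxy) (by positivity)

/-- The potential is `2 * (n - k) + d`, with `k` the last job of the open block and `d` the number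
of closed blocks. Closing a block raises `k` and `d` by one, merging lowers `d` by one; so at most
`2 * n` levels are computed, each in linear time. -/
theorem pool_runs {n m : ℕ} {s : Memory} {L W D : ℕ → ℝ} {z o : ℕ → ℕ} (hn : 0 < n)
    (hs : s.nat 0 0 = n) (hm : s.nat 0 1 = m)
    (hz : s.nat 11 = z) (ho : s.nat 12 = o) (hL : s.real 11 = L) (hW : s.real 12 = W)
    (hD : s.real 14 = D) (hjobs : SortedJobs n m z L W D o) :
    Runs poolProgram s (1400 * (n * n)) fun s' =>
      OptimalDurations n m z L W (fun i => levelDuration (L i) (W i) (s'.real 22 i)) := by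
  have hm0 : 0 < m := (hjobs.one_le_size 0 hn).trans (hjobs.size_le 0 hn)
  set F : ℕ → ℝ → ℝ := fun i l => z i * levelDuration (L i) (W i) l with hF
  set mD : ℕ → ℝ := fun i => m * D i with hmD
  have hT : 3 + (3 + ((7 + (500 * n + 100)) * (2 * n) + 7)) ≤ 1400 * (n * n) := by
    nlinarith [Nat.mul_le_mul hn hn, Nat.mul_le_mul_left n hn]
  refine Runs.mono_time ?_ hT
  refine Runs.seq (R := fun s1 => s1 = s.setNat 30 0 0) (Runs.of_run rfl (by decide) (by simp)) ?_
  rintro s1 - rfl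
  refine Runs.seq (R := fun s1 => s1 = (s.setNat 30 0 0).setNat 31 0 0)
    (Runs.of_run rfl (by decide) (by simp)) ?_
  rintro s1 - rfl
  refine Runs.imp (Runs.loop (K := 500 * n + 100)
    (Inv := fun f s' => ∃ d, s'.nat 30 0 ≤ n ∧ s'.nat 31 0 ≤ s'.nat 30 0 ∧
      -- When the loop ends, this leaves no open block: the chain reaches up to `n`.
      (s'.nat 30 0 < n ∨ s'.nat 31 0 = s'.nat 30 0) ∧
      BlockChain F mD (s'.nat 32) (s'.real 22) (s'.nat 31 0) d ∧
      f = 2 * (n - s'.nat 30 0) + d ∧ Pending F mD (s'.nat 31 0) (s'.nat 30 0))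
    (2 * n) ⟨0, by simp, by simp, by simp, by simpa using BlockChain.nil, by simp,
      Or.inl (by simp)⟩ ?_) fun s' hf h => ?_
  · rintro f s2 hf ⟨d, hkn, hlok, hlast, hchain, rfl, hpend⟩ hb
    have q : ∀ a, a ∉ (Program.seq levelProgram poolStep).writesNat → s2.nat a = s.nat a := by
      intro a ha
      have h1 : a ≠ 30 := by rintro rfl; exact ha (by decide)
      have h2 : a ≠ 31 := by rintro rfl; exact ha (by decide)
      rw [hf.1 a ha]
      simp [h1, h2]
    have q' : ∀ a, a ∉ (Program.seq levelProgram poolStep).writesReal → s2.real a = s.real a := by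
      intro a ha
      rw [hf.2 a ha]
      rfl
    have q0 := q 0 (by decide)
    simp only [BExp.Holds, NExp.eval, NExp.eval_var, q0, hs] at hb
    refine Runs.seq (level_runs hn (by rw [q0, hs]) (by rw [q0, hm])
      ((q 11 (by decide)).trans hz) ((q 12 (by decide)).trans ho)
      ((q' 11 (by decide)).trans hL) ((q' 12 (by decide)).trans hW)
      ((q' 14 (by decide)).trans hD) hjobs (by omega) hlok) ?_
    rintro s3 hf3 ⟨hlev, hstore⟩
    have e30 := hf3.1 30 (by decide)
    have e31 := hf3.1 31 (by decide)
    have e32 := hf3.1 32 (by decide)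
    have hblock := hpend.block hjobs (by omega) hlev
    have hchain' : BlockChain F mD (s2.nat 32) (s3.real 22) (s2.nat 31 0) d :=
      -- New levels are stored only inside the open block, behind the chain.
      hchain.congr (fun _ _ => rfl) fun i hi => by
        rw [hstore i (by omega), if_neg (by omega)]
    refine Runs.of_run rfl (by decide) ?_
    simp only [poolStep, Program.run, BExp.Holds, NExp.eval, NExp.eval_var, RExp.eval, RExp.eval_var,
      e31, e30, e32, Program.setN]
    split_ifs with hcond
    · obtain ⟨h1, h2⟩ := hcond
      generalize hlo : s2.nat 31 0 = lo at *
      -- The last closed block is the one to merge with. It exists, because the open block starts at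
      -- a positive index.
      cases hchain' with
      | nil => omega
      | @snoc _ d prev const block lt =>
        have := block.lt
        refine ⟨2 * (n - s2.nat 30 0) + d, by omega, d, ?_, ?_, ?_, ?_, ?_, ?_⟩
        · simpa [e30] using hkn
        · simp [e30]; omega
        · left; simp [e30]; omega
        · simpa [e32] using prev
        · simp [e30]
        · have h3 : Pending F mD (s2.nat 32 (lo - 1)) (s2.nat 30 0) :=
            Or.inr ⟨lo, _, _, block, hblock, h2⟩
          simpa [e30] using h3
    · have hkk : s2.nat 30 0 < n := by omega
      refine ⟨2 * (n - (s2.nat 30 0 + 1)) + (d + 1), by omega, d + 1, ?_, ?_, ?_, ?_, ?_, Or.inl ?_⟩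
      · simpa [e30] using hb
      · simp [e30]
      · simp [e30]
      · have hlevk : s3.real 22 (s2.nat 30 0) = s3.real 25 0 := by
          rw [hstore _ hkk, if_pos ⟨hlok, le_rfl⟩]
        simp only [e30, e32, ne_eq, Nat.reduceEqDiff, not_false_eq_true, Memory.setNat_nat_of_ne,
          Memory.setNat_nat_self, Function.update_self, Memory.setNat_real]
        refine .snoc ?_ ?_ ?_ ?_
        · simp only [add_tsub_cancel_right, Function.update_self]
          exact hchain'.congr (fun i hi => by rw [Function.update_of_ne (by omega)])
            fun _ _ => rfl
        · simp only [add_tsub_cancel_right, Function.update_self, hlevk]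
          intro i h1 h2
          rw [hstore i (by omega), if_pos ⟨h1, by omega⟩]
        · simpa only [add_tsub_cancel_right, Function.update_self, hlevk] using hblock
        · simp only [add_tsub_cancel_right, Function.update_self, hlevk]
          -- The failed merge test is exactly the strict decrease of levels that the chain demands.
          intro h0
          by_contra h1
          exact hcond ⟨h0, not_lt.1 h1⟩
      · simp [e30]
      · simp [e30]
  · obtain ⟨hb, f, d, hkn, hlok, hlast, hchain, -⟩ := h
    have q0 : s'.nat 0 0 = n := by rw [hf.1 0 (by decide)]; simpa using hs
    simp only [BExp.Holds, NExp.eval, NExp.eval_var, q0] at hb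
    have h1 : s'.nat 31 0 = n := by omega
    rw [h1] at hchain
    refine hchain.optimalDurations hm0 (by simp [hmD, hjobs.shift_zero])
      (fun i hi => by simp [hmD, hjobs.shift_succ i hi]) hjobs.length_pos hjobs.work_pos

/-- Stores the length of the window of the job in variable `23`. -/
def lengthBody : Program := .storeReal 10 (.var 23) (.sub (.get 1 (.var 23)) (.get 0 (.var 23)))

/-- Copies the data of the job at position `nat 23 0` of the order of deadlines. -/
def gatherBody : Program :=
  .seq (.storeNat 11 (.var 23) (.get 1 (.get 10 (.var 23))))
  (.seq (.storeReal 11 (.var 23) (.get 10 (.get 10 (.var 23))))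
  (.seq (.storeReal 12 (.var 23) (.get 2 (.get 10 (.var 23))))
  (.seq (.storeReal 14 (.add (.var 23) (.lit 1)) (.get 11 (.var 23)))
    (.storeReal 13 (.var 23)
      (.sub (.ofNat (.lit 0)) (.div (.get 12 (.var 23)) (.get 11 (.var 23))))))))

/-- Stores the duration and the speed of the job in variable `23`. -/
def durationBody : Program :=
  .seq (.cond (.realLe (.mul (.get 22 (.var 23)) (.get 11 (.var 23)))
      (.mul (.get 12 (.var 23)) (.sub (.ofNat (.lit 1)) (.get 22 (.var 23)))))
    (.storeReal 23 (.var 23) (.get 11 (.var 23)))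
    (.storeReal 23 (.var 23) (.div (.mul (.get 12 (.var 23))
      (.sub (.ofNat (.lit 1)) (.get 22 (.var 23)))) (.get 22 (.var 23)))))
  (.seq (.storeReal 23 (.var 23) (.div (.get 23 (.var 23)) (.sub (.ofNat (.lit 3))
      (.div (.ofNat (.lit 4)) (.add (.ofNat (.get 0 (.lit 1))) (.ofNat (.lit 1)))))))
    (.storeReal 24 (.var 23) (.div (.get 12 (.var 23)) (.get 23 (.var 23)))))

/-- Sorts the jobs and computes their durations and speeds. -/
def planProgram : Program :=
  .seq (.forLoop 23 (.var 0) lengthBody)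
  (.seq (sortProgram 10 10)
  (.seq (.forLoop 23 (.var 0) gatherBody)
  (.seq (sortProgram 13 12)
  (.seq poolProgram
    (.forLoop 23 (.var 0) durationBody)))))

/-- The memory holds, in the order `e` of deadlines, the sizes in `nat 11`, the durations in `real
23` and the speeds in `real 24`. -/
structure Planned {n : ℕ} (I : RigidInstance n) (s : Memory) (e : Equiv.Perm (Fin n))
    (L W p : ℕ → ℝ) : Prop where
  jobs : s.nat 0 0 = n
  procs : s.nat 0 1 = I.m
  order : ∀ a : Fin n, s.nat 10 a = e a
  size : ∀ a : Fin n, s.nat 11 a = I.size (e a)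
  length : ∀ a : Fin n, L a = I.deadline (e a) - I.release (e a)
  work : ∀ a : Fin n, W a = I.work (e a)
  mono : ∀ i j, i ≤ j → j < n → L i ≤ L j
  optimal : OptimalDurations n I.m (s.nat 11) L W p
  duration : ∀ i < n, s.real 23 i = p i / (3 - 4 / ((I.m : ℝ) + 1))
  speed : ∀ i < n, s.real 24 i = W i / s.real 23 i
  release : ∀ a : Fin n, s.real 0 a = I.release a
  deadline : ∀ a : Fin n, s.real 1 a = I.deadline a

theorem Sorts.congr {n : ℕ} {key key' : ℕ → ℝ} {o : ℕ → ℕ} (h : Sorts n key o)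
    (hk : ∀ i < n, key' i = key i) : Sorts n key' o := by
  obtain ⟨e, h1, h2⟩ := h
  exact ⟨e, h1, fun a b hab => by rw [hk _ (e a).2, hk _ (e b).2]; exact h2 a b hab⟩

theorem length_runs {n : ℕ} {s : Memory} (hn : 0 < n) (hs : s.nat 0 0 = n) :
    Runs (.forLoop 23 (.var 0) lengthBody) s ((4 + lengthBody.bound + 20) * n) fun s' =>
      ∀ i < n, s'.real 10 i = s.real 1 i - s.real 0 i := by
  refine Runs.forLoop (N := n) (Inv := fun x s' => ∀ i < x, s'.real 10 i = s.real 1 i - s.real 0 i)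
    le_rfl hn (by decide) (fun s' hf => by simp [hf.1 0 (by decide), hs]) (by simp)
    fun y hy s' hf hy' inv => Runs.of_run rfl le_rfl fun i hi => ?_
  have e0 := hf.2 0 (by decide)
  have e1 := hf.2 1 (by decide)
  simp only [lengthBody, Program.run, NExp.eval_var, RExp.eval, hy', e0, e1, Memory.setNat_real,
    Memory.setReal_real_self, Function.update_apply]
  split_ifs with h
  · rw [h]
  · exact inv i (by omega)

theorem gather_runs {n : ℕ} {s : Memory} (hn : 0 < n) (hs : s.nat 0 0 = n) :
    Runs (.forLoop 23 (.var 0) gatherBody) s ((4 + gatherBody.bound + 20) * n) fun s' =>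
      s'.real 14 0 = s.real 14 0 ∧ ∀ i < n, s'.nat 11 i = s.nat 1 (s.nat 10 i) ∧
        s'.real 11 i = s.real 10 (s.nat 10 i) ∧ s'.real 12 i = s.real 2 (s.nat 10 i) ∧
        s'.real 14 (i + 1) = s.real 10 (s.nat 10 i) ∧
        s'.real 13 i = 0 - s.real 2 (s.nat 10 i) / s.real 10 (s.nat 10 i) := by
  refine Runs.forLoop (N := n) (Inv := fun x s' =>
      s'.real 14 0 = s.real 14 0 ∧ ∀ i < x, s'.nat 11 i = s.nat 1 (s.nat 10 i) ∧
        s'.real 11 i = s.real 10 (s.nat 10 i) ∧ s'.real 12 i = s.real 2 (s.nat 10 i) ∧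
        s'.real 14 (i + 1) = s.real 10 (s.nat 10 i) ∧
        s'.real 13 i = 0 - s.real 2 (s.nat 10 i) / s.real 10 (s.nat 10 i))
    le_rfl hn (by decide) (fun s' hf => by simp [hf.1 0 (by decide), hs]) (by simp)
    fun y hy s' hf hy' inv => Runs.of_run rfl le_rfl ⟨?_, fun i hi => ?_⟩
  · simpa [gatherBody, hy'] using inv.1
  · have e1 := hf.1 1 (by decide)
    have e10 := hf.1 10 (by decide)
    have f10 := hf.2 10 (by decide)
    have f2 := hf.2 2 (by decide)
    rcases Nat.lt_succ_iff_lt_or_eq.1 hi with h | rfl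
    · have := inv.2 i h
      simpa [gatherBody, hy', e1, e10, f10, f2, Function.update_apply, h.ne] using this
    · simp [gatherBody, hy', e1, e10, f10, f2]

theorem duration_runs {n m : ℕ} {s : Memory} (hn : 0 < n) (hs : s.nat 0 0 = n)
    (hm : s.nat 0 1 = m) :
    Runs (.forLoop 23 (.var 0) durationBody) s ((4 + durationBody.bound + 20) * n) fun s' =>
      ∀ i < n, s'.real 23 i =
        levelDuration (s.real 11 i) (s.real 12 i) (s.real 22 i) / (3 - 4 / ((m : ℝ) + 1)) ∧
        s'.real 24 i = s.real 12 i / s'.real 23 i := by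
  refine Runs.forLoop (N := n) (Inv := fun x s' => ∀ i < x, s'.real 23 i =
        levelDuration (s.real 11 i) (s.real 12 i) (s.real 22 i) / (3 - 4 / ((m : ℝ) + 1)) ∧
        s'.real 24 i = s.real 12 i / s'.real 23 i)
    le_rfl hn (by decide) (fun s' hf => by simp [hf.1 0 (by decide), hs]) (by simp)
    fun y hy s' hf hy' inv => Runs.of_run rfl le_rfl fun i hi => ?_
  have e0 := (congrFun (hf.1 0 (by decide)) 1).trans hm
  have f11 := hf.2 11 (by decide)
  have f12 := hf.2 12 (by decide)
  have f22 := hf.2 22 (by decide)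
  rcases Nat.lt_succ_iff_lt_or_eq.1 hi with h | rfl
  · have := inv i h
    simp only [durationBody, Program.run]
    split_ifs <;> simpa [hy', Function.update_apply, h.ne] using this
  · simp only [durationBody, Program.run, levelDuration, BExp.Holds, RExp.eval, NExp.eval_var, hy',
      f11, f12, f22, NExp.eval, Nat.cast_one]
    split_ifs <;> simp [hy', f12, e0]

theorem plan_runs : ∃ K, ∀ (n : ℕ) (I : RigidInstance n), 0 < n →
    Runs planProgram (inputMemory I) (K * n ^ 2) fun s => ∃ e L W p, Planned I s e L W p := by
  refine ⟨(4 + lengthBody.bound + 20) + ((300 + (countBody 10).bound) +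
    ((4 + gatherBody.bound + 20) + ((300 + (countBody 13).bound) +
    (1400 + (4 + durationBody.bound + 20))))), fun n I hn => ?_⟩
  have hnn : n ≤ n * n := Nat.le_mul_of_pos_left n hn
  have hT : (4 + lengthBody.bound + 20) * n + ((300 + (countBody 10).bound) * n * n +
    ((4 + gatherBody.bound + 20) * n + ((300 + (countBody 13).bound) * n * n +
    (1400 * (n * n) + (4 + durationBody.bound + 20) * n)))) ≤ ((4 + lengthBody.bound + 20) + ((300 + (countBody 10).bound) +
    ((4 + gatherBody.bound + 20) + ((300 + (countBody 13).bound) +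
    (1400 + (4 + durationBody.bound + 20)))))) * n ^ 2 := by
    have h1 := Nat.mul_le_mul_left (4 + lengthBody.bound + 20) hnn
    have h2 := Nat.mul_le_mul_left (4 + gatherBody.bound + 20) hnn
    have h3 := Nat.mul_le_mul_left (4 + durationBody.bound + 20) hnn
    nlinarith
  refine Runs.mono_time ?_ hT
  set s := inputMemory I with hsdef
  have i0 : s.nat 0 0 = n := by simp [hsdef, inputMemory, natArray]
  have i1 : s.nat 0 1 = I.m := by simp [hsdef, inputMemory, natArray]
  have iz : ∀ a : Fin n, s.nat 1 a = I.size a := by simp [hsdef, inputMemory, natArray]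
  have ir : ∀ a : Fin n, s.real 0 a = I.release a := by simp [hsdef, inputMemory, realArray]
  have id : ∀ a : Fin n, s.real 1 a = I.deadline a := by simp [hsdef, inputMemory, realArray]
  have iw : ∀ a : Fin n, s.real 2 a = I.work a := by simp [hsdef, inputMemory, realArray]
  have i14 : s.real 14 0 = 0 := by simp [hsdef, inputMemory]
  clear_value s
  refine Runs.seq (length_runs hn i0) fun s1 f1 h1 => ?_
  refine Runs.seq (sort_runs hn (by rw [f1.1 0 (by decide), i0]) (by decide)) fun s2 f2 h2 => ?_
  refine Runs.seq (gather_runs hn (by rw [f2.1 0 (by decide), f1.1 0 (by decide), i0]))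
    fun s3 f3 ⟨h30, h3⟩ => ?_
  refine Runs.seq (sort_runs hn
    (by rw [f3.1 0 (by decide), f2.1 0 (by decide), f1.1 0 (by decide), i0]) (by decide))
    fun s4 f4 h4 => ?_
  obtain ⟨e, he, hmono⟩ := h2
  have g10 : s4.nat 10 = s2.nat 10 := by rw [f4.1 10 (by decide), f3.1 10 (by decide)]
  have g11 : ∀ a : Fin n, s4.nat 11 a = I.size (e a) := fun a => by
    rw [f4.1 11 (by decide), (h3 a a.2).1, he, f2.1 1 (by decide), f1.1 1 (by decide), iz]
  have hlen : ∀ a : Fin n, s1.real 10 (e a) = I.deadline (e a) - I.release (e a) := fun a => by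
    rw [h1 _ (e a).2, ir, id]
  have g11' : ∀ a : Fin n, s4.real 11 a = I.deadline (e a) - I.release (e a) := fun a => by
    rw [f4.2 11 (by decide), (h3 a a.2).2.1, he, f2.2 10 (by decide), hlen]
  have g12 : ∀ a : Fin n, s4.real 12 a = I.work (e a) := fun a => by
    rw [f4.2 12 (by decide), (h3 a a.2).2.2.1, he, f2.2 2 (by decide), f1.2 2 (by decide), iw]
  have hjobs : SortedJobs n I.m (s4.nat 11) (s4.real 11) (s4.real 12) (s4.real 14) (s4.nat 12) := by
    refine ⟨fun i hi => ?_, fun i hi => ?_, fun i hi => ?_, fun i hi => ?_, fun i j hij hj => ?_, ?_,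
      fun i hi => ?_, h4.congr fun i hi => ?_⟩
    · rw [g11 ⟨i, hi⟩]; exact I.one_le_size _
    · rw [g11 ⟨i, hi⟩]; exact I.size_le _
    · rw [g11' ⟨i, hi⟩]; linarith [I.release_lt_deadline (e ⟨i, hi⟩)]
    · rw [g12 ⟨i, hi⟩]; exact I.work_pos _
    · have := hmono ⟨i, by omega⟩ ⟨j, hj⟩ hij
      rw [g11' ⟨i, by omega⟩, g11' ⟨j, hj⟩]
      rwa [hlen, hlen] at this
    · rw [f4.2 14 (by decide), h30, f2.2 14 (by decide), f1.2 14 (by decide), i14]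
    · rw [f4.2 14 (by decide), f4.2 11 (by decide), (h3 i hi).2.2.2.1, (h3 i hi).2.1]
    · rw [f4.2 12 (by decide), f4.2 11 (by decide), (h3 i hi).2.2.2.2, (h3 i hi).2.1,
        (h3 i hi).2.2.1]
  have j0 : ∀ x, s4.nat 0 x = s.nat 0 x := fun x => by
    rw [f4.1 0 (by decide), f3.1 0 (by decide), f2.1 0 (by decide), f1.1 0 (by decide)]
  refine Runs.seq (pool_runs hn ((j0 0).trans i0) ((j0 1).trans i1) rfl rfl rfl rfl rfl hjobs)
    fun s5 f5 h5 => ?_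
  have k0 : ∀ x, s5.nat 0 x = s.nat 0 x := fun x => by rw [f5.1 0 (by decide), j0]
  refine Runs.imp (duration_runs hn ((k0 0).trans i0) ((k0 1).trans i1)) fun s6 f6 h6 => ?_
  have r0 : ∀ x, x = 0 ∨ x = 1 → s6.real x = s.real x := by
    rintro x (rfl | rfl) <;>
    rw [f6.2 _ (by decide), f5.2 _ (by decide), f4.2 _ (by decide), f3.2 _ (by decide),
      f2.2 _ (by decide), f1.2 _ (by decide)]
  refine ⟨e, s4.real 11, s4.real 12,
    fun i => levelDuration (s4.real 11 i) (s4.real 12 i) (s5.real 22 i), ?_, ?_, fun a => ?_, fun a => ?_, g11', g12,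
    hjobs.length_mono, ?_, fun i hi => ?_, fun i hi => ?_, fun a => ?_, fun a => ?_⟩
  · rw [f6.1 0 (by decide), k0, i0]
  · rw [f6.1 0 (by decide), k0, i1]
  · rw [f6.1 10 (by decide), f5.1 10 (by decide), g10, he]
  · rw [f6.1 11 (by decide), f5.1 11 (by decide), g11]
  · rw [f6.1 11 (by decide), f5.1 11 (by decide)]; exact h5
  · rw [(h6 i hi).1, f5.2 11 (by decide), f5.2 12 (by decide)]
  · rw [(h6 i hi).2, f5.2 12 (by decide)]
  · rw [r0 0 (by simp), ir]
  · rw [r0 1 (by simp), id]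

/-! ### List scheduling on segments of processors -/

/-- The ranges `[st x, en x)`, `x < g`, partition the processors below `m`. -/
structure Segments (m g : ℕ) (st en : ℕ → ℕ) : Prop where
  le : ∀ x < g, st x ≤ en x
  le_m : ∀ x < g, en x ≤ m
  sum : ∑ x ∈ Finset.range g, (en x - st x) = m
  disj : ∀ x < g, ∀ y < g, ∀ p, st x ≤ p → p < en x → st y ≤ p → p < en y → x = y

/-- Stated without subtraction, so that it serves sums of processor counts in `ℕ` as well as volumes
in `ℝ`. -/
theorem sum_range_eq_of_eq_off {M : Type*} [AddCommMonoid M] {g x : ℕ} {F F' : ℕ → M} (hx : x < g)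
    (h : ∀ y < g, y ≠ x → F' y = F y) :
    ∑ y ∈ Finset.range g, F' y + F x = ∑ y ∈ Finset.range g, F y + F' x := by
  rw [← Finset.sum_erase_add _ _ (Finset.mem_range.2 hx),
    ← Finset.sum_erase_add (Finset.range g) F (Finset.mem_range.2 hx),
    Finset.sum_congr rfl fun y hy => h y (Finset.mem_range.1 (Finset.mem_of_mem_erase hy))
      (Finset.ne_of_mem_erase hy)]
  abel

/-- Cell `x` keeps the first `r` processors of the segment, the new cell `g` gets the others. -/
theorem Segments.split {m g : ℕ} {st en : ℕ → ℕ} (h : Segments m g st en) {x r : ℕ} (hx : x < g)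
    (hr : st x + r ≤ en x) :
    Segments m (g + 1) (Function.update st g (st x + r))
      (Function.update (Function.update en g (en x)) x (st x + r)) := by
  have hgx : g ≠ x := hx.ne'
  have hxg : x ≠ g := hx.ne
  have h1 := h.le_m x hx
  refine ⟨fun y hy => ?_, fun y hy => ?_, ?_, fun y hy y' hy' p => ?_⟩
  · have := fun hyg => h.le y hyg
    simp only [Function.update_apply]
    split_ifs <;> subst_vars <;> omega
  · have := fun hyg => h.le_m y hyg
    simp only [Function.update_apply]
    split_ifs <;> subst_vars <;> omega
  · rw [Finset.sum_range_succ]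
    have h2 := sum_range_eq_of_eq_off (F := fun y => en y - st y)
      (F' := fun y => Function.update (Function.update en g (en x)) x (st x + r) y -
        Function.update st g (st x + r) y) hx fun y hy hyx => by
          simp [hyx, hy.ne]
    simp only [h.sum, Function.update_self, hxg, ne_eq, not_false_eq_true,
      Function.update_of_ne] at h2
    simp only [hgx, ne_eq, not_false_eq_true, Function.update_of_ne, Function.update_self]
    omega
  · have h2 := fun a b => h.disj y a y' b p
    have h3 := fun a => h.disj x hx y' a p
    have h4 := fun a => h.disj y a x hx p
    simp only [Function.update_apply]
    split_ifs <;> subst_vars <;> intros <;> omega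

/-- The volume that is still to be processed at time `t`. -/
noncomputable def remaining (g : ℕ) (st en : ℕ → ℕ) (ld : ℕ → ℝ) (t : ℝ) : ℝ :=
  ∑ x ∈ Finset.range g, ((en x - st x : ℕ) : ℝ) * max (ld x - t) 0

/-- The number of processors in segments that are idle from time `t` on. -/
noncomputable def freeCount (g : ℕ) (st en : ℕ → ℕ) (ld : ℕ → ℝ) (t : ℝ) : ℕ :=
  ∑ x ∈ Finset.range g, if ld x ≤ t then en x - st x else 0

theorem remaining_nonneg {g : ℕ} {st en : ℕ → ℕ} {ld : ℕ → ℝ} {t : ℝ} :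
    0 ≤ remaining g st en ld t :=
  Finset.sum_nonneg fun _ _ => mul_nonneg (by positivity) (le_max_right _ _)

/-- The state of the search for `z` idle processors for a job of duration `dur` at time `t`, after
the first `x` of `g₀` segments: `rem` processors are missing, `P` are found. `old p c` says that an
earlier job uses processor `p` until time `c`; `F` counts the idle processors of the initial
segments. -/
structure Placing (m g₀ z : ℕ) (t dur : ℝ) (old : ℕ → ℝ → Prop) (R bnd : ℝ) (F : ℕ → ℕ)
    (Λ : Finset ℝ) (x g : ℕ) (st en : ℕ → ℕ) (ld : ℕ → ℝ) (rem : ℕ) (P : Finset ℕ) : Prop where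
  seg : Segments m g st en
  g_le : g ≤ g₀ + 1
  le_g : g₀ ≤ g
  g_eq : 0 < rem → g = g₀
  card : rem + P.card = z
  of_mem : ∀ y < g, ∀ p ∈ P, st y ≤ p → p < en y → y < x ∧ ld y = t + dur
  of_old : ∀ p c, old p c → ∀ y < g, st y ≤ p → p < en y → c ≤ ld y
  of_old_of_mem : ∀ p c, old p c → p ∈ P → c ≤ t
  volume : remaining g st en ld t = R + P.card * dur
  load_le : ∀ y < g, ld y ≤ bnd
  free : rem ≤ ∑ y ∈ Finset.Ico x g₀, F y
  same : 0 < rem → ∀ y, x ≤ y → y < g₀ → F y = if ld y ≤ t then en y - st y else 0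
  loads : ∀ y < g, ld y ∈ Λ

namespace Placing

variable {m g₀ z x g rem : ℕ} {t dur R bnd : ℝ} {old : ℕ → ℝ → Prop} {F : ℕ → ℕ} {Λ : Finset ℝ}
  {st en : ℕ → ℕ} {ld : ℕ → ℝ} {P : Finset ℕ}

theorem skip (h : Placing m g₀ z t dur old R bnd F Λ x g st en ld rem P) (hx : x < g₀)
    (hno : ¬ (ld x ≤ t ∧ 0 < rem)) :
    Placing m g₀ z t dur old R bnd F Λ (x + 1) g st en ld rem P := by
  refine { h with of_mem := fun y hy p hp h1 h2 => ?_, free := ?_, same := fun h0 y hy => ?_ }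
  · have := h.of_mem y hy p hp h1 h2
    exact ⟨by omega, this.2⟩
  · rcases Nat.eq_zero_or_pos rem with h0 | h0
    · omega
    · have h1 := h.free
      rw [Finset.sum_eq_sum_Ico_succ_bot hx, h.same h0 x le_rfl hx,
        if_neg fun hl => hno ⟨hl, h0⟩] at h1
      omega
  · exact h.same h0 y (by omega)

/-- Processors already found lie in segments before `x`, so those of segment `x` are new. -/
theorem disjoint_segment (h : Placing m g₀ z t dur old R bnd F Λ x g st en ld rem P) (hx : x < g)
    {a b : ℕ} (ha : st x ≤ a) (hb : b ≤ en x) : Disjoint P (Finset.Ico a b) := by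
  rw [Finset.disjoint_left]
  intro p hp hp'
  have := Finset.mem_Ico.1 hp'
  have := (h.of_mem x hx p hp (by omega) (by omega)).1
  omega

theorem takeAll (h : Placing m g₀ z t dur old R bnd F Λ x g st en ld rem P) (hx : x < g₀)
    (hl : ld x ≤ t) (hrem : 0 < rem) (hw : en x - st x ≤ rem) (hdur : 0 < dur)
    (hbnd : t + dur ≤ bnd) (hΛ : t + dur ∈ Λ) :
    Placing m g₀ z t dur old R bnd F Λ (x + 1) g st en (Function.update ld x (t + dur))
      (rem - (en x - st x)) (P ∪ Finset.Ico (st x) (en x)) := by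
  have hxg : x < g := hx.trans_le h.le_g
  have hcard : (P ∪ Finset.Ico (st x) (en x)).card = P.card + (en x - st x) := by
    rw [Finset.card_union_of_disjoint (h.disjoint_segment hxg le_rfl le_rfl), Nat.card_Ico]
  refine ⟨h.seg, h.g_le, h.le_g, fun h0 => h.g_eq hrem, ?_, ?_, ?_, ?_, ?_, ?_, ?_, ?_, ?_⟩
  · have := h.card
    omega
  · intro y hy p hp h1 h2
    rcases Finset.mem_union.1 hp with hp | hp
    · have := h.of_mem y hy p hp h1 h2
      rw [Function.update_of_ne (by omega)]
      exact ⟨by omega, this.2⟩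
    · have := Finset.mem_Ico.1 hp
      obtain rfl := h.seg.disj x hxg y hy p this.1 this.2 h1 h2
      simp
  · intro p c hpc y hy h1 h2
    have := h.of_old p c hpc y hy h1 h2
    rw [Function.update_apply]
    split_ifs with hyx
    · subst hyx; linarith
    · exact this
  · intro p c hpc hp
    rcases Finset.mem_union.1 hp with hp | hp
    · exact h.of_old_of_mem p c hpc hp
    · have := Finset.mem_Ico.1 hp
      exact (h.of_old p c hpc x hxg this.1 this.2).trans hl
  · have h1 := sum_range_eq_of_eq_off (F := fun y => ((en y - st y : ℕ) : ℝ) * max (ld y - t) 0)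
      (F' := fun y => ((en y - st y : ℕ) : ℝ) * max (Function.update ld x (t + dur) y - t) 0) hxg
      fun y _ hyx => by simp [hyx]
    have h2 := h.volume
    simp only [remaining] at h2 ⊢
    rw [h2, Function.update_self, max_eq_right (by linarith : ld x - t ≤ 0),
      max_eq_left (by linarith : 0 ≤ t + dur - t)] at h1
    rw [hcard]
    push_cast
    linarith
  · intro y hy
    rw [Function.update_apply]
    split_ifs
    · exact hbnd
    · exact h.load_le y hy
  · have h1 := h.free
    rw [Finset.sum_eq_sum_Ico_succ_bot hx, h.same hrem x le_rfl hx, if_pos hl] at h1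
    omega
  · intro h0 y hy hyg
    rw [Function.update_of_ne (by omega)]
    exact h.same hrem y (by omega) hyg
  · intro y hy
    rw [Function.update_apply]
    split_ifs
    · exact hΛ
    · exact h.loads y hy

/-- Taking only part of a segment completes the search, so one job splits at most one segment. The
unused part keeps its old load and stays idle. -/
theorem takePart (h : Placing m g₀ z t dur old R bnd F Λ x g st en ld rem P) (hx : x < g₀)
    (hl : ld x ≤ t) (hrem : 0 < rem) (hw : rem < en x - st x) (hdur : 0 < dur)
    (hbnd : t + dur ≤ bnd) (hΛ : t + dur ∈ Λ) :
    Placing m g₀ z t dur old R bnd F Λ (x + 1) (g + 1) (Function.update st g (st x + rem))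
      (Function.update (Function.update en g (en x)) x (st x + rem))
      (Function.update (Function.update ld g (ld x)) x (t + dur))
      0 (P ∪ Finset.Ico (st x) (st x + rem)) := by
  have hxg : x < g := hx.trans_le h.le_g
  have hgx : g ≠ x := hxg.ne'
  have hdisj := h.disjoint_segment hxg le_rfl (show st x + rem ≤ en x by omega)
  have hcard : (P ∪ Finset.Ico (st x) (st x + rem)).card = P.card + rem := by
    rw [Finset.card_union_of_disjoint hdisj, Nat.card_Ico]
    omega
  have hold : ∀ y < g + 1, ∀ p, Function.update st g (st x + rem) y ≤ p →
      p < Function.update (Function.update en g (en x)) x (st x + rem) y →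
      (y < g ∧ y ≠ x ∧ st y ≤ p ∧ p < en y) ∨ (y = x ∧ st x ≤ p ∧ p < st x + rem) ∨
        (y = g ∧ st x + rem ≤ p ∧ p < en x) := by
    intro y hy p
    by_cases hyx : y = x
    · subst hyx
      rw [Function.update_self, Function.update_of_ne hgx.symm]
      intro h1 h2
      exact Or.inr (Or.inl ⟨rfl, h1, h2⟩)
    · rw [Function.update_of_ne hyx]
      by_cases hyg : y = g
      · subst hyg
        rw [Function.update_self, Function.update_self]
        intro h1 h2
        exact Or.inr (Or.inr ⟨rfl, h1, h2⟩)
      · rw [Function.update_of_ne hyg, Function.update_of_ne hyg]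
        intro h1 h2
        exact Or.inl ⟨by omega, hyx, h1, h2⟩
  have hld : ∀ y < g, y ≠ x →
      Function.update (Function.update ld g (ld x)) x (t + dur) y = ld y := fun y hy hyx => by
    rw [Function.update_of_ne hyx, Function.update_of_ne hy.ne]
  have hldx : Function.update (Function.update ld g (ld x)) x (t + dur) x = t + dur := by simp
  have hldg : Function.update (Function.update ld g (ld x)) x (t + dur) g = ld x := by
    rw [Function.update_of_ne hgx, Function.update_self]
  refine ⟨h.seg.split hxg (by omega), by have := h.g_eq hrem; omega, by have := h.le_g; omega,
    fun h0 => absurd h0 (lt_irrefl _), ?_, ?_, ?_, ?_, ?_, ?_, Nat.zero_le _,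
    fun h0 => absurd h0 (lt_irrefl _), ?_⟩
  · have := h.card
    omega
  · intro y hy p hp h1 h2
    rcases hold y hy p h1 h2 with ⟨hyg, hyx, h3, h4⟩ | ⟨rfl, h3, h4⟩ | ⟨rfl, h3, h4⟩
    · rcases Finset.mem_union.1 hp with hp | hp
      · have := h.of_mem y hyg p hp h3 h4
        rw [hld y hyg hyx]
        exact ⟨by omega, this.2⟩
      · have := Finset.mem_Ico.1 hp
        exact absurd (h.seg.disj x hxg y hyg p this.1 (by omega) h3 h4).symm hyx
    · exact ⟨by omega, hldx⟩
    · rcases Finset.mem_union.1 hp with hp | hp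
      · have := h.of_mem x hxg p hp (by omega) h4
        omega
      · have := Finset.mem_Ico.1 hp
        omega
  · intro p c hpc y hy h1 h2
    rcases hold y hy p h1 h2 with ⟨hyg, hyx, h3, h4⟩ | ⟨rfl, h3, h4⟩ | ⟨rfl, h3, h4⟩
    · rw [hld y hyg hyx]
      exact h.of_old p c hpc y hyg h3 h4
    · rw [hldx]
      linarith [h.of_old p c hpc y hxg h3 (by omega)]
    · rw [hldg]
      exact h.of_old p c hpc x hxg (by omega) h4
  · intro p c hpc hp
    rcases Finset.mem_union.1 hp with hp | hp
    · exact h.of_old_of_mem p c hpc hp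
    · have := Finset.mem_Ico.1 hp
      exact (h.of_old p c hpc x hxg this.1 (by omega)).trans hl
  · have h1 := sum_range_eq_of_eq_off (F := fun y => ((en y - st y : ℕ) : ℝ) * max (ld y - t) 0)
      (F' := fun y => ((Function.update (Function.update en g (en x)) x (st x + rem) y -
        Function.update st g (st x + rem) y : ℕ) : ℝ) *
        max (Function.update (Function.update ld g (ld x)) x (t + dur) y - t) 0) hxg
      fun y hy hyx => by simp [hyx, hy.ne]
    have h2 := h.volume
    simp only [remaining] at h2 ⊢
    rw [Finset.sum_range_succ, hldg, max_eq_right (by linarith : ld x - t ≤ 0)]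
    rw [h2, hldx, max_eq_right (by linarith : ld x - t ≤ 0),
      max_eq_left (by linarith : 0 ≤ t + dur - t), Function.update_self,
      Function.update_of_ne hgx.symm, Nat.add_sub_cancel_left] at h1
    rw [hcard]
    push_cast
    linarith
  · intro y hy
    by_cases hyx : y = x
    · subst hyx; rw [hldx]; exact hbnd
    · by_cases hyg : y = g
      · subst hyg; rw [hldg]; exact h.load_le x hxg
      · rw [hld y (by omega) hyx]; exact h.load_le y (by omega)
  · intro y hy
    by_cases hyx : y = x
    · subst hyx; rw [hldx]; exact hΛ
    · by_cases hyg : y = g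
      · subst hyg; rw [hldg]; exact h.loads x hxg
      · rw [hld y (by omega) hyx]; exact h.loads y (by omega)

end Placing

/-- Appending job `j` leaves the data of earlier jobs unchanged, so only the conditions at `j` have
to be supplied. -/
theorem ListSchedule.extend {j m : ℕ} {z : ℕ → ℕ} {q S M B S' M' B' : ℕ → ℝ}
    {c c' : ℕ → ℕ → Prop} (h : ListSchedule j m z q S M B c) (hS : ∀ i < j, S' i = S i)
    (hM : ∀ i ≤ j, M' i = M i) (hB : ∀ i ≤ j, B' i = B i)
    (hc : ∀ i k, i < k → k < j → c' i k → c i k) (hq : 0 < q j)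
    (hsmall : z j + z j ≤ m + 1 → 0 ≤ S' j ∧ ((m : ℝ) + 1) / 2 * S' j ≤
        (∑ k ∈ Finset.range j, if z k + z k ≤ m + 1 then z k * q k else 0) ∧
      M' (j + 1) = max (M j) (S' j + q j) ∧ B' (j + 1) = B j ∧
      ∀ i < j, z i + z i ≤ m + 1 → c' i j → S i + q i ≤ S' j)
    (hbig : ¬ z j + z j ≤ m + 1 → M' (j + 1) = M j ∧ B' (j + 1) = B j + q j) :
    ListSchedule (j + 1) m z q S' M' B' c' := by
  have hlt : ∀ i < j + 1, i < j ∨ i = j := fun i hi => Nat.lt_succ_iff_lt_or_eq.1 hi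
  refine ⟨fun i hi => ?_, ?_, ?_, fun i hi hs => ?_, fun i hi hs => ?_, fun i hi hs => ?_,
    fun i hi hs => ?_, fun i hi hs => ?_, fun i hi hs => ?_, fun i k hik hk hsi hsk hcik => ?_⟩
  · rcases hlt i hi with hi | rfl
    · exact h.dur_pos i hi
    · exact hq
  · rw [hM 0 (Nat.zero_le _), h.M_zero]
  · rw [hB 0 (Nat.zero_le _), h.B_zero]
  · rcases hlt i hi with hi | rfl
    · rw [hS i hi]; exact h.start_nonneg i hi hs
    · exact (hsmall hs).1
  · rcases hlt i hi with hi | rfl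
    · rw [hS i hi]; exact h.start_le i hi hs
    · exact (hsmall hs).2.1
  · rcases hlt i hi with hi | rfl
    · rw [hS i hi, hM _ hi, hM i hi.le]; exact h.M_small i hi hs
    · rw [hM i le_rfl]; exact (hsmall hs).2.2.1
  · rcases hlt i hi with hi | rfl
    · rw [hB _ hi, hB i hi.le]; exact h.B_small i hi hs
    · rw [hB i le_rfl]; exact (hsmall hs).2.2.2.1
  · rcases hlt i hi with hi | rfl
    · rw [hM _ hi, hM i hi.le]; exact h.M_big i hi hs
    · rw [hM i le_rfl]; exact (hbig hs).1
  · rcases hlt i hi with hi | rfl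
    · rw [hB _ hi, hB i hi.le]; exact h.B_big i hi hs
    · rw [hB i le_rfl]; exact (hbig hs).2
  · rcases hlt k hk with hk | rfl
    · rw [hS i (by omega), hS k hk]
      exact h.of_conflict i k hik hk hsi hsk (hc i k hik hk hcik)
    · rw [hS i hik]; exact (hsmall hsk).2.2.2.2 i hik hsi hcik

/-- The state of the list schedule when the first `j` of `n` jobs have been placed, at virtual time
`t`; `PS i` are the processors of job `i`, and the processors of segment `x` are busy with small
jobs until `ld x`. -/
structure Listing (n m : ℕ) (z : ℕ → ℕ) (q : ℕ → ℝ) (j : ℕ) (t : ℝ) (g : ℕ) (st en : ℕ → ℕ)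
    (ld S M B : ℕ → ℝ) (PS : ℕ → Finset ℕ) : Prop where
  le : j ≤ n
  seg : Segments m g st en
  g_le : g ≤ j + 1
  time_nonneg : 0 ≤ t
  volume : ((m : ℝ) + 1) / 2 * t + remaining g st en ld t ≤
    ∑ k ∈ Finset.range j, if z k + z k ≤ m + 1 then z k * q k else 0
  load_le : ∀ x < g, ld x ≤ M j
  list : ListSchedule j m z q S M B fun i k => ¬ Disjoint (PS i) (PS k)
  card : ∀ i < j, (PS i).card = z i
  empty : ∀ i, j ≤ i → i < n → PS i = ∅
  blocked : ∀ i < j, z i + z i ≤ m + 1 → ∀ x < g, ∀ p ∈ PS i, st x ≤ p → p < en x →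
    S i + q i ≤ ld x

/-- A bound on the number of steps that the list schedule still needs. -/
noncomputable def stepsLeft (n j : ℕ) (t : ℝ) (g : ℕ) (ld : ℕ → ℝ) : ℕ :=
  2 * (n - j) + (((Finset.range g).image ld).filter fun l => t < l).card

namespace Listing

variable {n m : ℕ} {z : ℕ → ℕ} {q : ℕ → ℝ} {j : ℕ} {t : ℝ} {g : ℕ} {st en : ℕ → ℕ}
  {ld S M B : ℕ → ℝ} {PS : ℕ → Finset ℕ}

theorem init {m : ℕ} {st en : ℕ → ℕ} {ld : ℕ → ℝ} (hst : st 0 = 0) (hen : en 0 = m)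
    (hld : ld 0 = 0) (hM : M 0 = 0) (hB : B 0 = 0) (hPS : ∀ i < n, PS i = ∅) :
    Listing n m z q 0 0 1 st en ld S M B PS where
  le := Nat.zero_le _
  seg := ⟨by simp [hst], by simp [hen], by simp [hst, hen], by omega⟩
  g_le := le_rfl
  time_nonneg := le_rfl
  volume := by simp [remaining, hld]
  load_le := by simp [hld, hM]
  list := ⟨by simp, hM, hB, by simp, by simp, by simp, by simp, by simp, by simp,
    fun i k _ hk => absurd hk (by omega)⟩
  card := by simp
  empty := fun i _ hi => hPS i hi
  blocked := by simp

/-- A big job takes no virtual time: the clock and the loads of the segments stay as they are. -/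
theorem big (h : Listing n m z q j t g st en ld S M B PS) (hj : j < n) (hq : 0 < q j)
    (hs : ¬ z j + z j ≤ m + 1) {PS' : ℕ → Finset ℕ} (hPS : ∀ i < n, i ≠ j → PS' i = PS i)
    (hcard : (PS' j).card = z j) :
    Listing n m z q (j + 1) t g st en ld S (Function.update M (j + 1) (M j))
      (Function.update B (j + 1) (B j + q j)) PS' := by
  refine ⟨hj, h.seg, by have := h.g_le; omega, h.time_nonneg, ?_, ?_, ?_, fun i hi => ?_,
    fun i hij hi => ?_, fun i hi hsi x hx p hp => ?_⟩
  · rw [Finset.sum_range_succ, if_neg hs, add_zero]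
    exact h.volume
  · simpa using h.load_le
  · refine h.list.extend (fun _ _ => rfl) (fun i hi => ?_) (fun i hi => ?_) (fun i k hik hk hc => ?_)
      hq (fun h' => absurd h' hs) fun _ => by simp
    · rw [Function.update_of_ne (by omega)]
    · rw [Function.update_of_ne (by omega)]
    · rwa [hPS i (by omega) (by omega), hPS k (by omega) (by omega)] at hc
  · by_cases hij : i = j
    · rw [hij, hcard]
    · rw [hPS i (by omega) hij]; exact h.card i (by omega)
  · rw [hPS i hi (by omega)]; exact h.empty i (by omega) hi
  · have hij : i ≠ j := by rintro rfl; exact hs hsi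
    rw [hPS i (by omega) hij] at hp
    exact h.blocked i (by omega) hsi x hx p hp

theorem placing (h : Listing n m z q j t g st en ld S M B PS)
    (hz : z j ≤ freeCount g st en ld t) :
    Placing m g (z j) t (q j) (fun p c => ∃ i < j, z i + z i ≤ m + 1 ∧ p ∈ PS i ∧ c = S i + q i)
      (remaining g st en ld t) (max (M j) (t + q j)) (fun y => if ld y ≤ t then en y - st y else 0)
      (insert (t + q j) ((Finset.range g).image ld)) 0 g st en ld (z j) ∅ where
  seg := h.seg
  g_le := Nat.le_succ _
  le_g := le_rfl
  g_eq := fun _ => rfl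
  card := by simp
  of_mem := by simp
  of_old := by
    rintro p c ⟨i, hi, hs, hp, rfl⟩ y hy h1 h2
    exact h.blocked i hi hs y hy p hp h1 h2
  of_old_of_mem := by simp
  volume := by simp
  load_le := fun y hy => le_max_of_le_left (h.load_le y hy)
  free := by rwa [freeCount, Finset.range_eq_Ico] at hz
  same := fun _ _ _ _ => rfl
  loads := fun y hy => Finset.mem_insert_of_mem (Finset.mem_image_of_mem _ (Finset.mem_range.2 hy))

theorem small (h : Listing n m z q j t g st en ld S M B PS) (hj : j < n) (hq : 0 < q j)
    (hs : z j + z j ≤ m + 1) {g' rem : ℕ} {st' en' : ℕ → ℕ} {ld' : ℕ → ℝ} {F : ℕ → ℕ} {Λ : Finset ℝ}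
    {PS' : ℕ → Finset ℕ}
    (hp : Placing m g (z j) t (q j)
      (fun p c => ∃ i < j, z i + z i ≤ m + 1 ∧ p ∈ PS i ∧ c = S i + q i)
      (remaining g st en ld t) (max (M j) (t + q j)) F Λ g g' st' en' ld' rem (PS' j))
    (hPS : ∀ i < n, i ≠ j → PS' i = PS i) :
    Listing n m z q (j + 1) t g' st' en' ld' (Function.update S j t)
      (Function.update M (j + 1) (max (M j) (t + q j))) (Function.update B (j + 1) (B j)) PS' := by
  -- After the last segment the missing processors are bounded by an empty sum.
  have hrem : rem = 0 := by simpa using hp.free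
  have hcard : (PS' j).card = z j := by have := hp.card; omega
  refine ⟨hj, hp.seg, by have := h.g_le; have := hp.g_le; omega, h.time_nonneg, ?_, ?_, ?_,
    fun i hi => ?_, fun i hij hi => ?_, fun i hi hsi x hx p hpi h1 h2 => ?_⟩
  · rw [Finset.sum_range_succ, if_pos hs, hp.volume, hcard]
    linarith [h.volume]
  · simpa using hp.load_le
  · refine h.list.extend (fun i hi => ?_) (fun i hi => ?_) (fun i hi => ?_) (fun i k hik hk hc => ?_)
      hq (fun _ => ⟨?_, ?_, ?_, ?_, fun i hi hsi hc => ?_⟩) fun h' => absurd hs h'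
    · rw [Function.update_of_ne (by omega)]
    · rw [Function.update_of_ne (by omega)]
    · rw [Function.update_of_ne (by omega)]
    · rwa [hPS i (by omega) (by omega), hPS k (by omega) (by omega)] at hc
    · simpa using h.time_nonneg
    -- The bound on the start is the volume invariant without the nonnegative remaining volume.
    · rw [Function.update_self]
      have := h.volume
      have := remaining_nonneg (g := g) (st := st) (en := en) (ld := ld) (t := t)
      linarith
    · simp
    · simp
    · rw [Function.update_self]
      obtain ⟨p, hpi, hpj⟩ := Finset.not_disjoint_iff.1 hc
      rw [hPS i (by omega) (by omega)] at hpi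
      exact hp.of_old_of_mem p _ ⟨i, hi, hsi, hpi, rfl⟩ hpj
  · by_cases hij : i = j
    · rw [hij, hcard]
    · rw [hPS i (by omega) hij]; exact h.card i (by omega)
  · rw [hPS i hi (by omega)]; exact h.empty i (by omega) hi
  · by_cases hij : i = j
    · subst hij
      rw [Function.update_self, (hp.of_mem x hx p hpi h1 h2).2]
    · rw [hPS i (by omega) hij] at hpi
      rw [Function.update_of_ne hij]
      exact hp.of_old p _ ⟨i, by omega, hsi, hpi, rfl⟩ x hx h1 h2

/-- No segment becomes idle strictly between `t` and `t'`, so the remaining volume falls at a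
constant rate, the number of busy processors. That number is at least `(m + 1) / 2` because job `j`
does not fit, and the invariant survives. -/
theorem advance (h : Listing n m z q j t g st en ld S M B PS) (hs : z j + z j ≤ m + 1)
    (hz : freeCount g st en ld t < z j) {t' : ℝ} (ht : t < t')
    (hmin : ∀ y < g, t < ld y → t' ≤ ld y) : Listing n m z q j t' g st en ld S M B PS := by
  refine { h with time_nonneg := h.time_nonneg.trans ht.le, volume := ?_ }
  refine le_trans ?_ h.volume
  have h1 : remaining g st en ld t' = remaining g st en ld t
      - (∑ x ∈ Finset.range g, if ld x ≤ t then (0 : ℝ) else ((en x - st x : ℕ) : ℝ)) * (t' - t) := by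
    rw [remaining, remaining, Finset.sum_mul, ← Finset.sum_sub_distrib]
    refine Finset.sum_congr rfl fun x hx => ?_
    split_ifs with hl
    · rw [max_eq_right (by linarith), max_eq_right (by linarith)]
      ring
    · have := hmin x (Finset.mem_range.1 hx) (not_le.1 hl)
      rw [max_eq_left (by linarith), max_eq_left (by linarith)]
      ring
  have h2 : (∑ x ∈ Finset.range g, if ld x ≤ t then (0 : ℝ) else ((en x - st x : ℕ) : ℝ))
      + freeCount g st en ld t = m := by
    rw [freeCount, Nat.cast_sum, ← Finset.sum_add_distrib]
    have := h.seg.sum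
    conv_rhs => rw [← this, Nat.cast_sum]
    refine Finset.sum_congr rfl fun x _ => ?_
    split_ifs <;> simp
  -- Integrality gives at most `z j - 1` idle processors; this extra one is what makes the count of
  -- busy ones reach `(m + 1) / 2`.
  have h3 : ((freeCount g st en ld t : ℕ) : ℝ) + 1 ≤ z j := by exact_mod_cast hz
  have h4 : (z j : ℝ) + z j ≤ m + 1 := by exact_mod_cast hs
  set N := ∑ x ∈ Finset.range g, if ld x ≤ t then (0 : ℝ) else ((en x - st x : ℕ) : ℝ)
  have h5 : ((m : ℝ) + 1) / 2 ≤ N := by linarith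
  rw [h1]
  nlinarith

theorem exists_load_gt (h : Listing n m z q j t g st en ld S M B PS)
    (hz : freeCount g st en ld t < z j) (hzm : z j ≤ m) : ∃ x < g, t < ld x := by
  by_contra hno
  push Not at hno
  have : freeCount g st en ld t = m := by
    rw [← h.seg.sum, freeCount]
    exact Finset.sum_congr rfl fun x hx => if_pos (hno x (Finset.mem_range.1 hx))
  omega

end Listing

/-- Placing a job creates at most one new completion time, while the term `2 * (n - j)` falls by
two. -/
theorem stepsLeft_small {n j g g' : ℕ} {t d : ℝ} {ld ld' : ℕ → ℝ} (hj : j < n)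
    (h : ∀ y < g', ld' y ∈ insert d ((Finset.range g).image ld)) :
    stepsLeft n (j + 1) t g' ld' < stepsLeft n j t g ld := by
  have h1 : ((Finset.range g').image ld').filter (fun l => t < l) ⊆
      insert d (((Finset.range g).image ld).filter fun l => t < l) := by
    intro l hl
    simp only [Finset.mem_filter, Finset.mem_image, Finset.mem_range] at hl
    obtain ⟨⟨y, hy, rfl⟩, hlt⟩ := hl
    rcases Finset.mem_insert.1 (h y hy) with h2 | h2
    · rw [h2]; exact Finset.mem_insert_self _ _
    · exact Finset.mem_insert_of_mem (Finset.mem_filter.2 ⟨h2, hlt⟩)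
  have h2 := (Finset.card_le_card h1).trans (Finset.card_insert_le _ _)
  unfold stepsLeft
  omega

/-- The completion time `t'` is no longer in the future. Counting distinct values rather than
segments makes simultaneous completions harmless. -/
theorem stepsLeft_advance {n j g : ℕ} {t t' : ℝ} {ld : ℕ → ℝ} (ht : t < t')
    (h : ∃ y < g, ld y = t') : stepsLeft n j t' g ld < stepsLeft n j t g ld := by
  obtain ⟨y, hy, rfl⟩ := h
  refine Nat.add_lt_add_left (Finset.card_lt_card (Finset.ssubset_iff_of_subset ?_ |>.2
    ⟨ld y, ?_, by simp⟩)) _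
  · intro l hl
    rw [Finset.mem_filter] at hl ⊢
    exact ⟨hl.1, ht.trans hl.2⟩
  · rw [Finset.mem_filter]
    exact ⟨Finset.mem_image_of_mem _ (Finset.mem_range.2 hy), ht⟩

theorem stepsLeft_big {n j g : ℕ} {t : ℝ} {ld : ℕ → ℝ} (hj : j < n) :
    stepsLeft n (j + 1) t g ld < stepsLeft n j t g ld := by
  unfold stepsLeft; omega

/-! ### The list scheduling program and its output -/

/-- The processors of job `J` in a list of `c` ranges. -/
def rangeSet (m c : ℕ) (job lo hi : ℕ → ℕ) (J : ℕ) : Finset ℕ :=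
  (Finset.range m).filter fun p => ∃ k < c, job k = J ∧ lo k ≤ p ∧ p < hi k

theorem rangeSet_zero (m : ℕ) (job lo hi : ℕ → ℕ) (J : ℕ) : rangeSet m 0 job lo hi J = ∅ := by
  simp [rangeSet]

theorem rangeSet_append {m c : ℕ} {job lo hi : ℕ → ℕ} {J' a b : ℕ} (hb : b ≤ m) (J : ℕ) :
    rangeSet m (c + 1) (Function.update job c J') (Function.update lo c a)
      (Function.update hi c b) J
      = if J' = J then rangeSet m c job lo hi J ∪ Finset.Ico a b else rangeSet m c job lo hi J := by
  have key : ∀ p, (∃ k < c + 1, Function.update job c J' k = J ∧ Function.update lo c a k ≤ p ∧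
      p < Function.update hi c b k) ↔
      (∃ k < c, job k = J ∧ lo k ≤ p ∧ p < hi k) ∨ (J' = J ∧ a ≤ p ∧ p < b) := by
    intro p
    constructor
    · rintro ⟨k, hk, h⟩
      rcases Nat.lt_succ_iff_lt_or_eq.1 hk with hk | rfl
      · exact Or.inl ⟨k, hk, by simpa [hk.ne] using h⟩
      · exact Or.inr (by simpa using h)
    · rintro (⟨k, hk, h⟩ | h)
      · exact ⟨k, by omega, by simpa [hk.ne] using h⟩
      · exact ⟨c, by omega, by simpa using h⟩
  ext p
  split_ifs with hJ
  · simp only [rangeSet, Finset.mem_filter, Finset.mem_union, Finset.mem_range, Finset.mem_Ico, key]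
    constructor
    · rintro ⟨h1, h2 | h2⟩
      · exact Or.inl ⟨h1, h2⟩
      · exact Or.inr h2.2
    · rintro (⟨h1, h2⟩ | h2)
      · exact ⟨h1, Or.inl h2⟩
      · exact ⟨by omega, Or.inr ⟨hJ, h2⟩⟩
  · simp only [rangeSet, Finset.mem_filter, Finset.mem_range, key]
    constructor
    · rintro ⟨h1, h2 | h2⟩
      · exact ⟨h1, h2⟩
      · exact absurd h2.1 hJ
    · rintro ⟨h1, h2⟩
      exact ⟨h1, Or.inl h2⟩

/-- The processors that the memory assigns to the job with index `J`. -/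
def Memory.procSet (s : Memory) (m J : ℕ) : Finset ℕ :=
  rangeSet m (s.nat 2 0) (s.nat 3) (s.nat 4) (s.nat 5) J

/-- Appends a range of processors to the output. -/
def emitRange (job lo hi : NExp) : Program :=
  .seq (.storeNat 3 (.var 2) job) (.seq (.storeNat 4 (.var 2) lo) (.seq (.storeNat 5 (.var 2) hi)
    (.setN 2 (.add (.var 2) (.lit 1)))))

/-- Examines segment `nat 44 0`: counts idle processors in `nat 45 0` and finds the next completion
time `real 32 0`. -/
def scanBody : Program :=
  .cond (.realLe (.get 31 (.var 44)) (.var 30))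
    (.setN 45 (.add (.var 45) (.sub (.get 43 (.var 44)) (.get 42 (.var 44)))))
    (.cond (.not (.realLe (.var 32) (.get 31 (.var 44)))) (.setR 32 (.get 31 (.var 44))) .skip)

/-- Takes the whole segment `nat 44 0` for job `nat 40 0`. -/
def takeAllProgram : Program :=
  .seq (emitRange (.get 10 (.var 40)) (.get 42 (.var 44)) (.get 43 (.var 44)))
  (.seq (.setN 46 (.sub (.var 46) (.sub (.get 43 (.var 44)) (.get 42 (.var 44)))))
    (.storeReal 31 (.var 44) (.add (.var 30) (.get 23 (.var 40)))))

/-- Takes the first `nat 46 0` processors of the segment `nat 44 0` for job `nat 40 0`. -/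
def takePartProgram : Program :=
  .seq (emitRange (.get 10 (.var 40)) (.get 42 (.var 44)) (.add (.get 42 (.var 44)) (.var 46)))
  (.seq (.storeNat 42 (.var 41) (.add (.get 42 (.var 44)) (.var 46)))
  (.seq (.storeNat 43 (.var 41) (.get 43 (.var 44)))
  (.seq (.storeReal 31 (.var 41) (.get 31 (.var 44)))
  (.seq (.storeNat 43 (.var 44) (.add (.get 42 (.var 44)) (.var 46)))
  (.seq (.storeReal 31 (.var 44) (.add (.var 30) (.get 23 (.var 40))))
  (.seq (.setN 41 (.add (.var 41) (.lit 1)))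
    (.setN 46 (.lit 0))))))))

/-- Assigns idle processors of the segment `nat 44 0` to job `nat 40 0`. -/
def placeBody : Program :=
  .cond (.and (.realLe (.get 31 (.var 44)) (.var 30)) (.natLe (.lit 1) (.var 46)))
    (.cond (.natLe (.sub (.get 43 (.var 44)) (.get 42 (.var 44))) (.var 46))
      takeAllProgram takePartProgram)
    .skip

/-- Records the start of the small job `nat 40 0` and goes to the next job. -/
def finishSmall : Program :=
  .seq (.storeReal 36 (.var 40) (.var 30))
  (.seq (.storeReal 35 (.add (.var 40) (.lit 1)) (.get 35 (.var 40)))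
  (.seq (.cond (.realLe (.get 34 (.var 40)) (.add (.var 30) (.get 23 (.var 40))))
      (.storeReal 34 (.add (.var 40) (.lit 1)) (.add (.var 30) (.get 23 (.var 40))))
      (.storeReal 34 (.add (.var 40) (.lit 1)) (.get 34 (.var 40))))
    (.setN 40 (.add (.var 40) (.lit 1)))))

/-- Starts the small job `nat 40 0`. -/
def startSmall : Program :=
  .seq (.setN 46 (.get 11 (.var 40))) (.seq (.setN 48 (.var 41))
    (.seq (.forLoop 44 (.var 48) placeBody) finishSmall))

/-- Starts the small job `nat 40 0` at the current time, or goes to the next completion time. -/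
def smallStep : Program :=
  .seq (.setN 45 (.lit 0)) (.seq (.setR 32 (.get 34 (.var 40)))
    (.seq (.forLoop 44 (.var 41) scanBody)
      (.cond (.natLe (.get 11 (.var 40)) (.var 45)) startSmall (.setR 30 (.var 32)))))

/-- Places the big job `nat 40 0`. -/
def bigStep : Program :=
  .seq (emitRange (.get 10 (.var 40)) (.lit 0) (.get 11 (.var 40)))
  (.seq (.storeReal 34 (.add (.var 40) (.lit 1)) (.get 34 (.var 40)))
  (.seq (.storeReal 35 (.add (.var 40) (.lit 1)) (.add (.get 35 (.var 40)) (.get 23 (.var 40))))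
    (.setN 40 (.add (.var 40) (.lit 1)))))

/-- The job `x` is small. -/
def isSmall (x : NExp) : BExp :=
  .natLe (.add (.get 11 x) (.get 11 x)) (.add (.get 0 (.lit 1)) (.lit 1))

/-- One step of the list schedule. -/
def listStep : Program := .cond (isSmall (.var 40)) smallStep bigStep

/-- The initial state of the list schedule. -/
def listInit : Program :=
  .seq (.setN 2 (.lit 0)) (.seq (.setN 40 (.lit 0)) (.seq (.setN 41 (.lit 1))
  (.seq (.setN 42 (.lit 0)) (.seq (.setN 43 (.get 0 (.lit 1))) (.seq (.setR 31 (.ofNat (.lit 0)))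
  (.seq (.setR 30 (.ofNat (.lit 0))) (.seq (.setR 34 (.ofNat (.lit 0)))
    (.setR 35 (.ofNat (.lit 0))))))))))

/-- List scheduling of the jobs in the order of deadlines. -/
def listProgram : Program :=
  .seq listInit (.loop (.natLe (.add (.var 40) (.lit 1)) (.var 0)) listStep)

/-! ### Correctness and running time of list scheduling -/

theorem scan_runs {n g : ℕ} {s : Memory} (hn : 0 < n) (hg : s.nat 41 0 = g) (hgn : g ≤ n)
    (h45 : s.nat 45 0 = 0) :
    Runs (.forLoop 44 (.var 41) scanBody) s ((4 + scanBody.bound + 20) * n) fun s' =>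
      s'.nat 45 0 = freeCount g (s.nat 42) (s.nat 43) (s.real 31) (s.real 30 0) ∧
      s'.real 32 0 ≤ s.real 32 0 ∧
      (∀ y < g, s.real 30 0 < s.real 31 y → s'.real 32 0 ≤ s.real 31 y) ∧
      (s'.real 32 0 = s.real 32 0 ∨ ∃ y < g, s.real 31 y = s'.real 32 0 ∧ s.real 30 0 < s.real 31 y) := by
  refine Runs.forLoop (N := g) (Inv := fun x s' =>
      s'.nat 45 0 = freeCount x (s.nat 42) (s.nat 43) (s.real 31) (s.real 30 0) ∧
      s'.real 32 0 ≤ s.real 32 0 ∧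
      (∀ y < x, s.real 30 0 < s.real 31 y → s'.real 32 0 ≤ s.real 31 y) ∧
      (s'.real 32 0 = s.real 32 0 ∨
        ∃ y < x, s.real 31 y = s'.real 32 0 ∧ s.real 30 0 < s.real 31 y))
    hgn hn (by decide) (fun s' hf => by simp [hf.1 41 (by decide), hg])
    ⟨by simp [freeCount, h45], by simp, by simp, by simp⟩
    fun x hx s' hf hx' ⟨h1, h2, h3, h4⟩ => Runs.of_run rfl le_rfl ?_
  have e42 := hf.1 42 (by decide)
  have e43 := hf.1 43 (by decide)
  have e31 := hf.2 31 (by decide)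
  have e30 := hf.2 30 (by decide)
  rw [freeCount, Finset.sum_range_succ, ← freeCount]
  simp only [scanBody, Program.run, BExp.Holds, RExp.eval, RExp.eval_var, NExp.eval_var, hx', e31,
    e30, Program.setN, Program.setR, NExp.eval, e42, e43]
  split_ifs with hc hc'
  · refine ⟨by simp [h1], by simpa using h2, fun y hy hlt => ?_, ?_⟩
    · rcases Nat.lt_succ_iff_lt_or_eq.1 hy with hy | rfl
      · simpa using h3 y hy hlt
      · exact absurd hc (not_le.2 hlt)
    · rcases h4 with h4 | ⟨y, hy, h5⟩
      · left; simpa using h4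
      · right; exact ⟨y, by omega, by simpa using h5⟩
  · refine ⟨by simp [h1], by simpa using h2, fun y hy hlt => ?_, ?_⟩
    · rcases Nat.lt_succ_iff_lt_or_eq.1 hy with hy | rfl
      · simpa using h3 y hy hlt
      · simpa using hc'
    · rcases h4 with h4 | ⟨y, hy, h5⟩
      · left; simpa using h4
      · right; exact ⟨y, by omega, by simpa using h5⟩
  · have hc' := not_le.1 hc'
    refine ⟨by simp [h1], by simpa using hc'.le.trans h2, fun y hy hlt => ?_, ?_⟩
    · rcases Nat.lt_succ_iff_lt_or_eq.1 hy with hy | rfl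
      · simpa using hc'.le.trans (h3 y hy hlt)
      · simp
    · right; exact ⟨x, by omega, by simpa using hc⟩

/-- The loop bound is a copy of the initial number of segments, because a split enlarges the counter
in array `41` during the loop. -/
theorem place_runs {n m g₀ j J : ℕ} {t dur R bnd : ℝ} {old : ℕ → ℝ → Prop} {F : ℕ → ℕ}
    {Λ : Finset ℝ} {s : Memory} (hn : 0 < n) (hg : s.nat 48 0 = g₀) (hgn : g₀ ≤ n)
    (hj : s.nat 40 0 = j) (hJ : s.nat 10 j = J) (ht : s.real 30 0 = t) (hdur : s.real 23 j = dur)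
    (hdur0 : 0 < dur) (hbnd : t + dur ≤ bnd) (hΛ : t + dur ∈ Λ) {z : ℕ}
    (h0 : Placing m g₀ z t dur old R bnd F Λ 0 (s.nat 41 0) (s.nat 42) (s.nat 43) (s.real 31)
      (s.nat 46 0) (s.procSet m J)) :
    Runs (.forLoop 44 (.var 48) placeBody) s ((4 + placeBody.bound + 20) * n) fun s' =>
      Placing m g₀ z t dur old R bnd F Λ g₀ (s'.nat 41 0) (s'.nat 42) (s'.nat 43) (s'.real 31)
        (s'.nat 46 0) (s'.procSet m J) ∧
      ∀ J', J' ≠ J → s'.procSet m J' = s.procSet m J' := by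
  refine Runs.forLoop (N := g₀) (Inv := fun x s' =>
      Placing m g₀ z t dur old R bnd F Λ x (s'.nat 41 0) (s'.nat 42) (s'.nat 43) (s'.real 31)
        (s'.nat 46 0) (s'.procSet m J) ∧
      ∀ J', J' ≠ J → s'.procSet m J' = s.procSet m J')
    hgn hn (by decide) (fun s' hf => by simp [hf.1 48 (by decide), hg])
    ⟨by simpa [Memory.procSet] using h0, by simp [Memory.procSet]⟩
    fun x hx s' hf hx' ⟨inv, inv'⟩ => Runs.of_run rfl le_rfl ?_
  have e40 := (congrFun (hf.1 40 (by decide)) 0).trans hj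
  have e10 := (congrFun (hf.1 10 (by decide)) j).trans hJ
  have e30 := (congrFun (hf.2 30 (by decide)) 0).trans ht
  have e23 := (congrFun (hf.2 23 (by decide)) j).trans hdur
  have hxg : x < s'.nat 41 0 := hx.trans_le inv.le_g
  simp only [placeBody, Program.run, BExp.Holds, RExp.eval, RExp.eval_var, NExp.eval_var, hx',
    NExp.eval, e30]
  split_ifs with hc hc'
  · have hm := inv.seg.le_m x hxg
    refine ⟨?_, fun J' hJ' => ?_⟩
    · have := inv.takeAll hx hc.1 hc.2 hc' hdur0 hbnd hΛ
      simp only [Memory.procSet] at this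
      simpa [takeAllProgram, emitRange, hx', e40, e10, e30, e23, Memory.procSet,
        rangeSet_append hm] using this
    · have := inv' J' hJ'
      simp only [Memory.procSet] at this
      simpa [takeAllProgram, emitRange, hx', e40, e10, e30, e23, Memory.procSet,
        rangeSet_append hm, hJ'.symm] using this
  · have hm := inv.seg.le_m x hxg
    have hm' : s'.nat 42 x + s'.nat 46 0 ≤ m := by omega
    have hgx : s'.nat 41 0 ≠ x := hxg.ne'
    refine ⟨?_, fun J' hJ' => ?_⟩
    · have := inv.takePart hx hc.1 hc.2 (by omega) hdur0 hbnd hΛ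
      simp only [Memory.procSet] at this
      simpa [takePartProgram, emitRange, hx', e40, e10, e30, e23, Memory.procSet,
        rangeSet_append hm', hxg.ne] using this
    · have := inv' J' hJ'
      simp only [Memory.procSet] at this
      simpa [takePartProgram, emitRange, hx', e40, e10, e30, e23, Memory.procSet,
        rangeSet_append hm', hJ'.symm, hxg.ne] using this
  · refine ⟨by simpa [Memory.procSet] using inv.skip hx (fun h => hc h), ?_⟩
    simpa [Memory.procSet] using inv'

/-- The memory represents a state of the list schedule with at most `f` steps left. -/
def ListState (n m : ℕ) (perm z : ℕ → ℕ) (q : ℕ → ℝ) (f : ℕ) (s : Memory) : Prop :=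
  stepsLeft n (s.nat 40 0) (s.real 30 0) (s.nat 41 0) (s.real 31) = f ∧
    Listing n m z q (s.nat 40 0) (s.real 30 0) (s.nat 41 0) (s.nat 42) (s.nat 43) (s.real 31)
      (s.real 36) (s.real 34) (s.real 35) fun i => s.procSet m (perm i)

section

variable {n m f : ℕ} {perm z : ℕ → ℕ} {q : ℕ → ℝ} {s : Memory}

/-- Big jobs all receive an initial range of processors. This causes no conflict, as a big job never
shares its time with any other job. -/
theorem bigStep_runs (hm : s.nat 0 1 = m)
    (hperm : s.nat 10 = perm) (hz : s.nat 11 = z) (hq : s.real 23 = q)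
    (hzm : ∀ i < n, z i ≤ m) (hq0 : ∀ i < n, 0 < q i)
    (hinj : ∀ i < n, ∀ k < n, perm i = perm k → i = k)
    (h : ListState n m perm z q f s) (hj : s.nat 40 0 < n)
    (hbig : ¬ (isSmall (.var 40)).Holds s) :
    Runs bigStep s bigStep.bound fun s' => ∃ f' < f, ListState n m perm z q f' s' := by
  obtain ⟨rfl, h⟩ := h
  simp only [isSmall, BExp.Holds, NExp.eval, NExp.eval_var, hm, hz] at hbig
  refine Runs.of_run rfl le_rfl ⟨_, stepsLeft_big hj, ?_⟩
  have hzj := hzm _ hj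
  generalize hjdef : s.nat 40 0 = j at *
  have key := h.big hj (hq0 j hj) hbig
    (PS' := fun i => if perm j = perm i then s.procSet m (perm i) ∪ Finset.Ico 0 (z j)
      else s.procSet m (perm i))
    (fun i hi hij => if_neg fun hp => hij (hinj j hj i hi hp).symm)
    (by
      have := h.empty j le_rfl hj
      simp [this])
  simp only [ListState, bigStep, emitRange, Program.run, Memory.procSet, NExp.eval,
    NExp.eval_var, hjdef, Memory.setNat_nat_self, Memory.setNat_real, Memory.setReal_nat, ne_eq,
    Nat.reduceEqDiff, not_false_eq_true, Memory.setNat_nat_of_ne, Memory.setReal_real_self,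
    Memory.setReal_real_of_ne, Function.update_self, Program.setN, RExp.eval, hperm, hz, hq,
    rangeSet_append hzj, true_and] at key ⊢
  exact key

theorem startSmall_runs (hn : 0 < n)
    (hperm : s.nat 10 = perm) (hz : s.nat 11 = z) (hq : s.real 23 = q)
    (hq0 : ∀ i < n, 0 < q i)
    (hinj : ∀ i < n, ∀ k < n, perm i = perm k → i = k)
    (h : ListState n m perm z q f s) (hj : s.nat 40 0 < n)
    (hsmall : z (s.nat 40 0) + z (s.nat 40 0) ≤ m + 1)
    (hfree : z (s.nat 40 0) ≤
      freeCount (s.nat 41 0) (s.nat 42) (s.nat 43) (s.real 31) (s.real 30 0)) :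
    Runs startSmall s ((50 + placeBody.bound + finishSmall.bound) * n)
      fun s' => ∃ f' < f, ListState n m perm z q f' s' := by
  obtain ⟨rfl, h⟩ := h
  have hT : 5 + (4 + ((4 + placeBody.bound + 20) * n + finishSmall.bound)) ≤
      (50 + placeBody.bound + finishSmall.bound) * n := by
    nlinarith [Nat.mul_le_mul_left finishSmall.bound hn]
  have hempty : s.procSet m (perm (s.nat 40 0)) = ∅ := h.empty _ le_rfl hj
  have key := h.placing hfree
  have hg := h.g_le
  generalize hjdef : s.nat 40 0 = j at *
  refine Runs.mono_time ?_ hT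
  refine Runs.seq (R := fun s1 => s1 = s.setNat 46 0 (z j)) (Runs.of_run rfl (by decide)
    (by simp [hjdef, hz])) ?_
  rintro s1 - rfl
  refine Runs.seq (R := fun s1 => s1 = (s.setNat 46 0 (z j)).setNat 48 0 (s.nat 41 0))
    (Runs.of_run rfl (by decide) (by simp)) ?_
  rintro s1 - rfl
  have hstart := place_runs (n := n) (m := m) (g₀ := s.nat 41 0) (j := j) (J := perm j)
    (t := s.real 30 0) (dur := q j) (s := (s.setNat 46 0 (z j)).setNat 48 0 (s.nat 41 0)) hn (by simp)
    (by omega) (by simp [hjdef]) (by simp [hperm]) (by simp) (by simp [hq]) (hq0 j hj)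
    (le_max_right (s.real 34 j) _) (Finset.mem_insert_self _ _)
    (by
      have e : ((s.setNat 46 0 (z j)).setNat 48 0 (s.nat 41 0)).procSet m (perm j) = ∅ := by
        rw [← hempty]; simp [Memory.procSet]
      rw [e]
      simpa using key)
  refine Runs.seq hstart fun s2 hf2 ⟨hp, hother⟩ => Runs.of_run rfl le_rfl ?_
  have e40 : s2.nat 40 0 = j := by rw [hf2.1 40 (by decide)]; simp [hjdef]
  have e30 : s2.real 30 0 = s.real 30 0 := by rw [hf2.2 30 (by decide)]; simp
  have e23 : s2.real 23 j = q j := by rw [hf2.2 23 (by decide)]; simp [hq]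
  have e34 : s2.real 34 = s.real 34 := by rw [hf2.2 34 (by decide)]; simp
  have e35 : s2.real 35 = s.real 35 := by rw [hf2.2 35 (by decide)]; simp
  have e36 : s2.real 36 = s.real 36 := by rw [hf2.2 36 (by decide)]; simp
  have hres := h.small hj (hq0 j hj) hsmall (PS' := fun i => s2.procSet m (perm i)) hp
    fun i hi hij => by
      rw [hother _ fun hp => hij (hinj i hi j hj hp)]
      simp [Memory.procSet]
  refine ⟨_, stepsLeft_small hj hp.loads, ?_⟩
  simp only [ListState, finishSmall, Program.run, BExp.Holds, RExp.eval, RExp.eval_var, NExp.eval,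
    NExp.eval_var, e40, e30, e23, e34, e35, Memory.setReal_nat, Memory.procSet, ne_eq,
    Nat.reduceEqDiff, not_false_eq_true, Memory.setReal_real_of_ne, Program.setN] at hres ⊢
  split_ifs with hmax
  · rw [max_eq_right hmax] at hres
    simpa [e40, e30, e34, e35, e36] using hres
  · rw [max_eq_left (not_le.1 hmax).le] at hres
    simpa [e40, e30, e34, e35, e36] using hres

theorem smallStep_runs (hn : 0 < n) (hm : s.nat 0 1 = m)
    (hperm : s.nat 10 = perm) (hz : s.nat 11 = z) (hq : s.real 23 = q)
    (hzm : ∀ i < n, z i ≤ m) (hq0 : ∀ i < n, 0 < q i)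
    (hinj : ∀ i < n, ∀ k < n, perm i = perm k → i = k)
    (h : ListState n m perm z q f s) (hj : s.nat 40 0 < n)
    (hsmall : (isSmall (.var 40)).Holds s) :
    Runs smallStep s ((200 + scanBody.bound + placeBody.bound + finishSmall.bound) * n)
      fun s' => ∃ f' < f, ListState n m perm z q f' s' := by
  have hT : 3 + (5 + ((4 + scanBody.bound + 20) * n + (6 +
      (50 + placeBody.bound + finishSmall.bound) * n))) ≤
      (200 + scanBody.bound + placeBody.bound + finishSmall.bound) * n := by
    nlinarith
  simp only [isSmall, BExp.Holds, NExp.eval, NExp.eval_var, hm, hz] at hsmall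
  have hg := h.2.g_le
  have hzj := hzm _ hj
  refine Runs.mono_time ?_ hT
  refine Runs.seq (R := fun s1 => s1 = s.setNat 45 0 0) (Runs.of_run rfl (by decide) (by simp)) ?_
  rintro s1 - rfl
  refine Runs.seq (R := fun s1 => s1 = (s.setNat 45 0 0).setReal 32 0 (s.real 34 (s.nat 40 0)))
    (Runs.of_run rfl (by decide) (by simp)) ?_
  rintro s1 - rfl
  refine Runs.seq (scan_runs (g := s.nat 41 0) hn (by simp) (by omega) (by simp)) ?_
  rintro s2 hf2 ⟨h45, h32, hmin, hat⟩
  simp only [Memory.setReal_nat, ne_eq, Nat.reduceEqDiff, not_false_eq_true,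
    Memory.setNat_nat_of_ne, Memory.setReal_real_of_ne, Memory.setNat_real,
    Memory.setReal_real_self, Function.update_self] at h45 h32 hmin hat
  have e : ∀ a, a ≠ 44 → a ≠ 45 → s2.nat a = s.nat a := fun a h1 h2 => by
    rw [hf2.1 a (by simp [Program.forLoop, Program.writesNat, scanBody, h1, h2])]
    simp [h2]
  have e' : ∀ a, a ≠ 32 → s2.real a = s.real a := fun a h1 => by
    rw [hf2.2 a (by simp [Program.forLoop, Program.writesReal, scanBody, h1])]
    simp [h1]
  have hstate : ListState n m perm z q f s2 := by
    simpa [ListState, Memory.procSet, e, e'] using h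
  refine Runs.cond (fun hfit => ?_) fun hfit => ?_
  · simp only [BExp.Holds, NExp.eval, NExp.eval_var, e, ne_eq, Nat.reduceEqDiff,
      not_false_eq_true, hz, h45] at hfit
    refine startSmall_runs hn (by simp [e, hperm]) (by simp [e, hz]) (by simp [e', hq]) hq0 hinj
      hstate (by simpa [e] using hj) (by simpa [e] using hsmall) (by simpa [e, e'] using hfit)
  · simp only [BExp.Holds, NExp.eval, NExp.eval_var, e, ne_eq, Nat.reduceEqDiff,
      not_false_eq_true, hz, h45, not_le] at hfit
    obtain ⟨rfl, h⟩ := h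
    obtain ⟨y, hy, hty⟩ := h.exists_load_gt hfit hzj
    -- The minimum was initialised with `M j`, an upper bound of all loads. If the scan never
    -- lowered it, a load beyond the current time must be equal to it.
    have hnext : ∃ y < s.nat 41 0, s.real 31 y = s2.real 32 0 ∧ s.real 30 0 < s.real 31 y := by
      rcases hat with hat | hat
      · exact ⟨y, hy, le_antisymm (by rw [hat]; exact h.load_le y hy) (hmin y hy hty), hty⟩
      · exact hat
    obtain ⟨y', hy', h1, h2⟩ := hnext
    rw [h1] at h2
    refine Runs.of_run rfl ?_ ?_
    · have : (Program.setR 30 (.var 32)).bound = 4 := rfl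
      rw [this]
      nlinarith
    · refine ⟨_, stepsLeft_advance h2 ⟨y', hy', h1⟩, ?_⟩
      simpa [ListState, Memory.procSet, e, e'] using h.advance hsmall hfit h2 hmin

end

/-- Initially no load lies in the future, so `stepsLeft` is `2 * n`; each step visits at most `n`
segments a bounded number of times. -/
theorem list_runs : ∃ K, ∀ (n m : ℕ) (perm z : ℕ → ℕ) (q : ℕ → ℝ) (s : Memory), 0 < n →
    s.nat 0 0 = n → s.nat 0 1 = m → s.nat 10 = perm → s.nat 11 = z → s.real 23 = q →
    (∀ i < n, z i ≤ m) → (∀ i < n, 0 < q i) →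
    (∀ i < n, ∀ k < n, perm i = perm k → i = k) →
    Runs listProgram s (K * n ^ 2) fun s' =>
      ListSchedule n m z q (s'.real 36) (s'.real 34) (s'.real 35)
        (fun i k => ¬ Disjoint (s'.procSet m (perm i)) (s'.procSet m (perm k))) ∧
      ∀ i < n, (s'.procSet m (perm i)).card = z i := by
  set K₁ := 200 + scanBody.bound + placeBody.bound + finishSmall.bound + bigStep.bound
  refine ⟨2 * (K₁ + 120) + listInit.bound + 7,
    fun n m perm z q s hn h0 h1 hperm hz hq hzm hq0 hinj => ?_⟩
  have hT : listInit.bound + ((7 + (12 + K₁ * n)) * (2 * n) + 7) ≤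
      (2 * (K₁ + 120) + listInit.bound + 7) * n ^ 2 := by
    nlinarith [Nat.mul_le_mul hn hn, Nat.mul_le_mul_left n hn,
      Nat.mul_le_mul_left listInit.bound (Nat.mul_le_mul hn hn)]
  refine Runs.mono_time ?_ hT
  refine Runs.seq (R := fun s1 => s1 = listInit.run s) (Runs.of_run rfl le_rfl rfl) ?_
  rintro s1 hf1 rfl
  have hinit : ListState n m perm z q (2 * n) (listInit.run s) := by
    refine ⟨?_, ?_⟩
    · simp [listInit, stepsLeft]
    · have := Listing.init (n := n) (m := m) (z := z) (q := q) (S := s.real 36)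
        (st := Function.update (s.nat 42) 0 0) (en := Function.update (s.nat 43) 0 m)
        (ld := Function.update (s.real 31) 0 0) (M := Function.update (s.real 34) 0 0)
        (B := Function.update (s.real 35) 0 0) (PS := fun _ => ∅) (by simp) (by simp) (by simp)
        (by simp) (by simp) (by simp)
      simpa [listInit, h1, Memory.procSet, rangeSet_zero] using this
  refine Runs.imp (Runs.loop (K := 12 + K₁ * n) (Inv := ListState n m perm z q) (2 * n) hinit ?_)
    fun s' hf h => ?_
  · rintro f s2 hf2 hstate hb
    have e : ∀ a, a ∉ listInit.writesNat → a ∉ listStep.writesNat → s2.nat a = s.nat a :=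
      fun a ha hb => (hf2.1 a hb).trans (hf1.1 a ha)
    have e' : ∀ a, a ∉ listInit.writesReal → a ∉ listStep.writesReal → s2.real a = s.real a :=
      fun a ha hb => (hf2.2 a hb).trans (hf1.2 a ha)
    have e0 := e 0 (by decide) (by decide)
    have e10 := (e 10 (by decide) (by decide)).trans hperm
    have e11 := (e 11 (by decide) (by decide)).trans hz
    have e23 := (e' 23 (by decide) (by decide)).trans hq
    simp only [BExp.Holds, NExp.eval, NExp.eval_var, e0, h0] at hb
    have e1 : s2.nat 0 1 = m := by rw [e0, h1]
    have hK : 200 + scanBody.bound + placeBody.bound + finishSmall.bound ≤ K₁ := by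
      simp only [K₁]; omega
    have hK' : bigStep.bound ≤ K₁ := by simp only [K₁]; omega
    exact Runs.cond (fun hs => (smallStep_runs hn e1 e10 e11 e23 hzm hq0 hinj hstate hb hs).mono_time
        (Nat.mul_le_mul_right n hK))
      fun hs => (bigStep_runs e1 e10 e11 e23 hzm hq0 hinj hstate hb hs).mono_time
        (hK'.trans (Nat.le_mul_of_pos_right _ hn))
  · obtain ⟨hb, f, -, hlist⟩ := h
    have e0 : s'.nat 0 0 = n := by rw [hf.1 0 (by decide), hf1.1 0 (by decide), h0]
    simp only [BExp.Holds, NExp.eval, NExp.eval_var, e0] at hb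
    have hj : s'.nat 40 0 = n := by have := hlist.le; omega
    rw [hj] at hlist
    exact ⟨hlist.list, hlist.card⟩

/-! ### Writing the execution intervals -/

/-- The speed at which the job with index `J` runs at time `t` according to a list of `c` execution
intervals. -/
noncomputable def intervalSpeed (c : ℕ) (job : ℕ → ℕ) (lo hi v : ℕ → ℝ) (J : ℕ) (t : ℝ) : ℝ :=
  ∑ k ∈ (Finset.range c).filter (fun k => job k = J),
    Set.indicator (Set.Ico (lo k) (hi k)) (fun _ => v k) t

theorem intervalSpeed_append (c : ℕ) (job : ℕ → ℕ) (lo hi v : ℕ → ℝ) (J' : ℕ) (a b w : ℝ) (J : ℕ)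
    (t : ℝ) :
    intervalSpeed (c + 1) (Function.update job c J') (Function.update lo c a)
        (Function.update hi c b) (Function.update v c w) J t
      = intervalSpeed c job lo hi v J t +
        if J' = J then Set.indicator (Set.Ico a b) (fun _ => w) t else 0 := by
  unfold intervalSpeed
  rw [Finset.sum_filter, Finset.sum_range_succ, Finset.sum_filter]
  simp only [Function.update_self]
  congr 1
  refine Finset.sum_congr rfl fun k hk => ?_
  have : k ≠ c := (Finset.mem_range.1 hk).ne
  simp [this]

theorem pieceSpeed_succ (N : ℕ) (lo hi : ℕ → ℝ) (v t : ℝ) :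
    pieceSpeed (N + 1) lo hi v t
      = pieceSpeed N lo hi v t + Set.indicator (Set.Ico (lo N) (hi N)) (fun _ => v) t :=
  Finset.sum_range_succ _ _

/-- The memory lists the first `N a` intervals `[lo a g, hi a g)` for each job `perm a`, `a < n`. -/
def Memory.Emits (s : Memory) (n : ℕ) (perm : ℕ → ℕ) (v : ℕ → ℝ) (lo hi : ℕ → ℕ → ℝ)
    (N : ℕ → ℕ) : Prop :=
  ∀ a < n, ∀ t, intervalSpeed (s.nat 2 1) (s.nat 6) (s.real 3) (s.real 4) (s.real 5) (perm a) t =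
    pieceSpeed (N a) (lo a) (hi a) (v a) t

/-- Left end point of `[a, b)` after the translation by `r`, or, for `rev`, of its mirror image
that starts at `d` and runs backwards in time. -/
def placedLo (rev : Bool) (r d a b : ℝ) : ℝ := if rev then d - b else r + a

/-- The right end point that belongs to `placedLo`. -/
def placedHi (rev : Bool) (r d a b : ℝ) : ℝ := if rev then d - a else r + b

/-- Replaces the interval `[real 40 0, real 41 0)` by its translate or mirror image. -/
def placeInterval (rev : Bool) : Program :=
  if rev then
    .seq (.setR 42 (.sub (.var 1) (.var 41)))
      (.seq (.setR 41 (.sub (.var 1) (.var 40))) (.setR 40 (.var 42)))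
  else .seq (.setR 40 (.add (.var 0) (.var 40))) (.setR 41 (.add (.var 0) (.var 41)))

/-- Appends the interval `[real 40 0, real 41 0)` for job `nat 50 0` to the output. -/
def appendInterval : Program :=
  .seq (.storeNat 6 (.get 2 (.lit 1)) (.get 10 (.var 50)))
  (.seq (.storeReal 3 (.get 2 (.lit 1)) (.var 40))
  (.seq (.storeReal 4 (.get 2 (.lit 1)) (.var 41))
  (.seq (.storeReal 5 (.get 2 (.lit 1)) (.get 24 (.var 50)))
    (.storeNat 2 (.lit 1) (.add (.get 2 (.lit 1)) (.lit 1))))))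

/-- Appends the placed interval. -/
def emitInterval (rev : Bool) : Program := .seq (placeInterval rev) appendInterval

/-- Sets `real x 0` to the time `g` of the list schedule, moved into the execution of job
`nat 50 0` and corrected for the big jobs before slot `nat 51 0`. -/
def clampProgram (x : ℕ) (g : NExp) : Program :=
  .seq (.setR x (.get 34 g))
  (.seq (.cond (.realLe (.add (.get 36 (.var 50)) (.get 23 (.var 50))) (.var x))
    (.setR x (.add (.get 36 (.var 50)) (.get 23 (.var 50)))) .skip)
  (.seq (.cond (.realLe (.var x) (.get 36 (.var 50))) (.setR x (.get 36 (.var 50))) .skip)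
    (.setR x (.add (.var x) (.get 35 (.add (.var 51) (.lit 1)))))))

/-- Writes the interval of the small job `nat 50 0` in slot `nat 51 0`. -/
def emitSmall (rev : Bool) : Program :=
  .seq (clampProgram 40 (.var 51)) (.seq (clampProgram 41 (.add (.var 51) (.lit 1)))
    (emitInterval rev))

/-- Writes the interval of the big job `nat 50 0`. -/
def emitBig (rev : Bool) : Program :=
  .seq (.setR 40 (.add (.get 34 (.var 50)) (.get 35 (.var 50))))
  (.seq (.setR 41 (.add (.get 34 (.var 50)) (.get 35 (.add (.var 50) (.lit 1)))))
    (emitInterval rev))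

/-- Writes the intervals of job `nat 50 0`. -/
def emitJob (rev : Bool) : Program :=
  .cond (isSmall (.var 50)) (.forLoop 51 (.var 0) (emitSmall rev)) (emitBig rev)

/-- Writes the intervals of all jobs. -/
def emitProgram (rev : Bool) : Program :=
  .seq (.storeNat 2 (.lit 1) (.lit 0)) (.forLoop 50 (.var 0) (emitJob rev))

theorem placeInterval_runs (rev : Bool) (s : Memory) :
    Runs (placeInterval rev) s (placeInterval rev).bound fun s' =>
      s'.real 40 0 = placedLo rev (s.real 0 0) (s.real 1 0) (s.real 40 0) (s.real 41 0) ∧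
      s'.real 41 0 = placedHi rev (s.real 0 0) (s.real 1 0) (s.real 40 0) (s.real 41 0) := by
  cases rev
  · exact Runs.of_run rfl le_rfl (by simp [placeInterval, placedLo, placedHi])
  · exact Runs.of_run rfl le_rfl (by simp [placeInterval, placedLo, placedHi])

theorem clampProgram_runs {x : ℕ} {g : NExp} {s : Memory} (hx : x = 40 ∨ x = 41) :
    Runs (clampProgram x g) s (clampProgram x g).bound fun s' =>
      s'.real x 0 = clampTo (s.real 36 (s.nat 50 0)) (s.real 23 (s.nat 50 0))
        (s.real 34 (g.eval s)) + s.real 35 (s.nat 51 0 + 1) := by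
  refine Runs.of_run rfl le_rfl ?_
  have h36 : (36 : ℕ) ≠ x := by omega
  have h23 : (23 : ℕ) ≠ x := by omega
  have h35 : (35 : ℕ) ≠ x := by omega
  generalize hy : s.real 34 (g.eval s) = y
  generalize ha : s.real 36 (s.nat 50 0) = a
  generalize hd : s.real 23 (s.nat 50 0) = d
  simp only [clampProgram, Program.run, Program.setR, BExp.Holds, RExp.eval, RExp.eval_var,
    NExp.eval, NExp.eval_var, Memory.setReal_nat, Memory.setReal_real_self, Function.update_self,
    ne_eq, h36, h23, not_false_eq_true, Memory.setReal_real_of_ne, hy, ha, hd]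
  by_cases h1 : a + d ≤ y
  · rw [if_pos h1]
    by_cases h2 : a + d ≤ a
    · simp [h35, h36, ha, h1, h2, clampTo]
    · simp [h35, h36, ha, h1, h2, clampTo, (not_le.1 h2).le]
  · rw [if_neg h1]
    by_cases h2 : y ≤ a
    · simp [h35, h36, ha, h2, clampTo, (not_le.1 h1).le]
    · simp [h35, h36, ha, h2, clampTo, (not_le.1 h1).le, (not_le.1 h2).le]

section

variable {n : ℕ} {perm : ℕ → ℕ} {v : ℕ → ℝ} {lo hi : ℕ → ℕ → ℝ} {N : ℕ → ℕ}
  {rev : Bool} {s s₀ : Memory}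

theorem emitInterval_runs (hinj : ∀ i < n, ∀ k < n, perm i = perm k → i = k)
    (hperm : s.nat 10 = perm) (hv : s.real 24 = v) {i : ℕ} (hi' : i < n) (h50 : s.nat 50 0 = i)
    (hlo : lo i (N i) =
      placedLo rev (s.real 0 0) (s.real 1 0) (s.real 40 0) (s.real 41 0))
    (hhi : hi i (N i) =
      placedHi rev (s.real 0 0) (s.real 1 0) (s.real 40 0) (s.real 41 0))
    (h : s.Emits n perm v lo hi N) :
    Runs (emitInterval rev) s (emitInterval rev).bound fun s' =>
      s'.nat 2 0 = s.nat 2 0 ∧ s'.Emits n perm v lo hi (Function.update N i (N i + 1)) := by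
  refine Runs.seq (placeInterval_runs rev s) fun s1 hf ⟨h40, h41⟩ => Runs.of_run rfl le_rfl ?_
  have hN : s1.nat = s.nat := funext fun a => hf.1 a (by cases rev <;> simp [placeInterval, Program.writesNat])
  have hR : ∀ a, a ≠ 40 → a ≠ 41 → a ≠ 42 → s1.real a = s.real a := fun a _ _ _ =>
    hf.2 a (by cases rev <;> simp [placeInterval, Program.writesReal, *])
  refine ⟨by simp [appendInterval, hN], fun a ha t => ?_⟩
  have key := intervalSpeed_append (s.nat 2 1) (s.nat 6) (s.real 3) (s.real 4) (s.real 5) (perm i)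
    (lo i (N i)) (hi i (N i)) (v i) (perm a) t
  simp only [appendInterval, Program.run, NExp.eval, NExp.eval_var, RExp.eval, RExp.eval_var, hN,
    hR, h40, h41, h50, ← hlo, ← hhi, hperm, hv, Memory.setNat_real, Memory.setReal_nat,
    Memory.setNat_nat_self, Memory.setReal_real_self, Memory.setNat_nat_of_ne,
    Memory.setReal_real_of_ne, Function.update_self, ne_eq, Nat.reduceEqDiff, not_false_eq_true]
    at key ⊢
  rw [key, h a ha t]
  by_cases hai : a = i
  · subst hai
    simp [pieceSpeed_succ]
  · have : perm i ≠ perm a := fun h => hai (hinj i hi' a ha h).symm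
    simp [hai, this]

/-- Both memories agree on the arrays that no part of `emitProgram` writes to. -/
def SameInput (s₀ s : Memory) : Prop :=
  (∀ a, a ∉ [2, 6, 50, 51] → s.nat a = s₀.nat a) ∧
    ∀ a, a ∉ [3, 4, 5, 40, 41, 42] → s.real a = s₀.real a

theorem SameInput.trans_frame {c : Program} {s' : Memory} (h : SameInput s₀ s) (hf : Frame c s s')
    (h1 : c.writesNat ⊆ [2, 6, 50, 51]) (h2 : c.writesReal ⊆ [3, 4, 5, 40, 41, 42]) :
    SameInput s₀ s' :=
  ⟨fun a ha => (hf.1 a fun h => ha (h1 h)).trans (h.1 a ha),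
    fun a ha => (hf.2 a fun h => ha (h2 h)).trans (h.2 a ha)⟩

/-- Left end points of the intervals that `emitProgram` writes. -/
noncomputable def emitLo (rev : Bool) (s : Memory) (i g : ℕ) : ℝ :=
  placedLo rev (s.real 0 0) (s.real 1 0)
    (pieceLo (s.nat 0 1) (s.nat 11) (s.real 23) (s.real 36) (s.real 34) (s.real 35) i g)
    (pieceHi (s.nat 0 1) (s.nat 11) (s.real 23) (s.real 36) (s.real 34) (s.real 35) i g)

/-- Right end points of the intervals that `emitProgram` writes. -/
noncomputable def emitHi (rev : Bool) (s : Memory) (i g : ℕ) : ℝ :=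
  placedHi rev (s.real 0 0) (s.real 1 0)
    (pieceLo (s.nat 0 1) (s.nat 11) (s.real 23) (s.real 36) (s.real 34) (s.real 35) i g)
    (pieceHi (s.nat 0 1) (s.nat 11) (s.real 23) (s.real 36) (s.real 34) (s.real 35) i g)

/-- The slot equals the number of intervals of the job written so far, so the entry appended is the
next one in its list. -/
theorem emitSmall_runs (hs : SameInput s₀ s)
    (hinj : ∀ i < n, ∀ k < n, s₀.nat 10 i = s₀.nat 10 k → i = k) {i : ℕ} (hi' : i < n)
    (h50 : s.nat 50 0 = i) (h51 : s.nat 51 0 = N i)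
    (hsmall : s₀.nat 11 i + s₀.nat 11 i ≤ s₀.nat 0 1 + 1)
    (h : s.Emits n (s₀.nat 10) (s₀.real 24) (emitLo rev s₀) (emitHi rev s₀) N) :
    Runs (emitSmall rev) s (emitSmall rev).bound fun s' =>
      s'.nat 2 0 = s.nat 2 0 ∧ s'.Emits n (s₀.nat 10) (s₀.real 24) (emitLo rev s₀)
        (emitHi rev s₀) (Function.update N i (N i + 1)) := by
  refine Runs.seq (clampProgram_runs (.inl rfl)) fun s1 f1 h1 =>
    Runs.seq (clampProgram_runs (.inr rfl)) fun s2 f2 h2 => ?_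
  have e1 : s1.nat = s.nat := funext fun a => f1.1 a (by simp [clampProgram, Program.writesNat])
  have e2 : s2.nat = s.nat := funext fun a =>
    (f2.1 a (by simp [clampProgram, Program.writesNat])).trans (congrFun e1 a)
  have r1 : ∀ a, a ≠ 40 → s1.real a = s.real a := fun a ha =>
    f1.2 a (by simp [clampProgram, Program.writesReal, ha])
  have r2 : ∀ a, a ≠ 41 → s2.real a = s1.real a := fun a ha =>
    f2.2 a (by simp [clampProgram, Program.writesReal, ha])
  have hr := hs.2
  have hn := hs.1
  have h40 : s2.real 40 0 = pieceLo (s₀.nat 0 1) (s₀.nat 11) (s₀.real 23) (s₀.real 36)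
      (s₀.real 34) (s₀.real 35) i (N i) := by
    simp [r2, h1, h50, h51, hr, pieceLo, hsmall]
  have h41 : s2.real 41 0 = pieceHi (s₀.nat 0 1) (s₀.nat 11) (s₀.real 23) (s₀.real 36)
      (s₀.real 34) (s₀.real 35) i (N i) := by
    simp [h2, e1, r1, h50, h51, hr, pieceHi, hsmall]
  refine (emitInterval_runs hinj (v := s₀.real 24) (lo := emitLo rev s₀) (hi := emitHi rev s₀)
    (N := N) (by simp [e2, hn]) (by simp [r2, r1, hr]) hi' (by rw [e2, h50])
    (by simp [h40, h41, r2, r1, hr, emitLo]) (by simp [h40, h41, r2, r1, hr, emitHi]) ?_).imp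
    fun s' _ h' => ⟨by rw [h'.1, e2], h'.2⟩
  simpa [Memory.Emits, e2, r2, r1] using h

theorem emitBig_runs (hs : SameInput s₀ s)
    (hinj : ∀ i < n, ∀ k < n, s₀.nat 10 i = s₀.nat 10 k → i = k) {i : ℕ} (hi' : i < n)
    (h50 : s.nat 50 0 = i) (hbig : ¬ s₀.nat 11 i + s₀.nat 11 i ≤ s₀.nat 0 1 + 1)
    (h : s.Emits n (s₀.nat 10) (s₀.real 24) (emitLo rev s₀) (emitHi rev s₀) N) :
    Runs (emitBig rev) s (emitBig rev).bound fun s' =>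
      s'.nat 2 0 = s.nat 2 0 ∧ s'.Emits n (s₀.nat 10) (s₀.real 24) (emitLo rev s₀)
        (emitHi rev s₀) (Function.update N i (N i + 1)) := by
  have hr := hs.2
  have hn := hs.1
  refine Runs.seq (R := fun s1 => s1 = s.setReal 40 0 (s.real 34 i + s.real 35 i))
    (Runs.of_run rfl le_rfl (by simp [h50])) ?_
  rintro s1 - rfl
  refine Runs.seq (R := fun s2 => s2 = (s.setReal 40 0 (s.real 34 i + s.real 35 i)).setReal 41 0
    (s.real 34 i + s.real 35 (i + 1))) (Runs.of_run rfl le_rfl (by simp [h50])) ?_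
  rintro s1 - rfl
  refine (emitInterval_runs hinj (v := s₀.real 24) (lo := emitLo rev s₀) (hi := emitHi rev s₀)
    (N := N) (by simp [hn]) (by simp [hr]) hi' (by simp [h50])
    (by simp [hr, emitLo, pieceLo, pieceHi, hbig]) (by simp [hr, emitHi, pieceLo, pieceHi, hbig])
    ?_).imp fun s' _ h' => h'
  simpa [Memory.Emits] using h

/-- A small job is written slot by slot, empty pieces included; this needs no search and costs
linear time per job. -/
theorem emitJob_runs (hn : 0 < n) (hs : SameInput s₀ s) (h0 : s₀.nat 0 0 = n)
    (hinj : ∀ i < n, ∀ k < n, s₀.nat 10 i = s₀.nat 10 k → i = k) {i : ℕ} (hi' : i < n)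
    (h50 : s.nat 50 0 = i) (hN : N i = 0)
    (h : s.Emits n (s₀.nat 10) (s₀.real 24) (emitLo rev s₀) (emitHi rev s₀) N) :
    Runs (emitJob rev) s ((40 + (emitSmall rev).bound + (emitBig rev).bound) * n) fun s' =>
      s'.nat 2 0 = s.nat 2 0 ∧ s'.Emits n (s₀.nat 10) (s₀.real 24) (emitLo rev s₀)
        (emitHi rev s₀) (Function.update N i (pieceCount n (s₀.nat 0 1) (s₀.nat 11) i)) := by
  have hT : 12 + ((4 + (emitSmall rev).bound + 20) * n + (emitBig rev).bound) ≤
      (40 + (emitSmall rev).bound + (emitBig rev).bound) * n := by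
    nlinarith [Nat.mul_le_mul_left (emitBig rev).bound hn]
  refine Runs.mono_time ?_ hT
  have hholds : (isSmall (.var 50)).Holds s ↔ s₀.nat 11 i + s₀.nat 11 i ≤ s₀.nat 0 1 + 1 := by
    simp [isSmall, h50, hs.1]
  refine Runs.cond (fun hb => Runs.mono_time ?_ (Nat.le_add_right _ _))
    fun hb => Runs.mono_time ?_ (Nat.le_add_left _ _)
  · rw [hholds] at hb
    have hcount : pieceCount n (s₀.nat 0 1) (s₀.nat 11) i = n := if_pos hb
    rw [hcount]
    refine Runs.forLoop (N := n) (Inv := fun x s' => s'.nat 2 0 = s.nat 2 0 ∧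
      s'.Emits n (s₀.nat 10) (s₀.real 24) (emitLo rev s₀) (emitHi rev s₀) (Function.update N i x))
      le_rfl hn (by cases rev <;> decide) ?_ ?_ ?_
    · intro s' hf
      rw [NExp.eval_var, hf.1 0 (by cases rev <;> decide), hs.1 0 (by decide), h0]
    · rw [← hN, Function.update_eq_self]
      simpa [Memory.Emits] using h
    · intro y hy s' hf h51 inv
      have hf50 : s'.nat 50 0 = i := by rw [hf.1 50 (by cases rev <;> decide), h50]
      refine (emitSmall_runs (N := Function.update N i y)
        (hs.trans_frame hf (by cases rev <;> decide) (by cases rev <;> decide)) hinj hi' hf50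
        (by simp [h51]) hb inv.2).imp fun s'' _ h' => ?_
      simpa [Memory.Emits, inv.1] using h'
  · rw [hholds] at hb
    have hcount : pieceCount n (s₀.nat 0 1) (s₀.nat 11) i = N i + 1 := by rw [hN]; exact if_neg hb
    rw [hcount]
    exact emitBig_runs hs hinj hi' h50 hb h

theorem emit_runs (rev : Bool) (hn : 0 < n) (h0 : s.nat 0 0 = n)
    (hinj : ∀ i < n, ∀ k < n, s.nat 10 i = s.nat 10 k → i = k) :
    Runs (emitProgram rev) s
      (((40 + (emitSmall rev).bound + (emitBig rev).bound) + 30) * n ^ 2) fun s' =>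
      s'.nat 2 0 = s.nat 2 0 ∧ s'.Emits n (s.nat 10) (s.real 24) (emitLo rev s)
        (emitHi rev s) (pieceCount n (s.nat 0 1) (s.nat 11)) := by
  set K := 40 + (emitSmall rev).bound + (emitBig rev).bound
  have hT : 3 + (4 + K * n + 20) * n ≤ (K + 30) * n ^ 2 := by
    nlinarith [Nat.mul_le_mul hn hn, Nat.mul_le_mul_left n hn]
  refine Runs.mono_time ?_ hT
  refine Runs.seq (R := fun s1 => s1 = s.setNat 2 1 0) (Runs.of_run rfl le_rfl (by simp)) ?_
  rintro s1 - rfl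
  have hs1 : SameInput s (s.setNat 2 1 0) := ⟨fun a ha => by
    have : a ≠ 2 := by rintro rfl; simp at ha
    simp [this], fun _ _ => rfl⟩
  refine (Runs.forLoop (N := n) (Inv := fun x s' => s'.nat 2 0 = s.nat 2 0 ∧
    s'.Emits n (s.nat 10) (s.real 24) (emitLo rev s) (emitHi rev s) fun a =>
      if a < x then pieceCount n (s.nat 0 1) (s.nat 11) a else 0)
      le_rfl hn (by cases rev <;> decide) ?_ ?_ ?_).imp fun s' _ h => ⟨h.1, fun a ha t => ?_⟩
  · intro s' hf
    rw [NExp.eval_var, hf.1 0 (by cases rev <;> decide)]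
    simpa using h0
  · simp [Memory.Emits, intervalSpeed, pieceSpeed]
  · intro y hy s' hf h50 inv
    refine (emitJob_runs hn (hs1.trans_frame hf (by cases rev <;> decide)
      (by cases rev <;> decide)) h0 hinj hy h50 (if_neg (lt_irrefl y)) inv.2).imp
      fun s'' _ h => ⟨by simp [h.1, inv.1], fun a ha t => ?_⟩
    have := h.2 a ha t
    simp only [ne_eq, Nat.reduceEqDiff, not_false_eq_true, Memory.setNat_nat_of_ne,
      Memory.setNat_real, this]
    congr 1
    rcases lt_trichotomy a y with h | h | h
    · simp [h, h.ne, h.trans (Nat.lt_succ_self y)]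
    · simp [h]
    · simp [h.ne', not_lt.2 h.le, Nat.not_lt.2 (Nat.succ_le_of_lt h)]
  · simp [h.2 a ha t, ha]

end

/-! ### The algorithm -/

/-- Carries cardinality and disjointness from the processor numbers of the program over to `Fin
I.m`. -/
theorem map_procs_outputSchedule {n : ℕ} (I : RigidInstance n) (s : Memory) (j : Fin n) :
    ((outputSchedule I s).procs j).map Fin.valEmbedding = s.procSet I.m j := by
  ext p
  simp only [outputSchedule, Memory.procSet, rangeSet, Finset.mem_map, Finset.mem_filter,
    Finset.mem_univ, true_and, Fin.valEmbedding_apply, Finset.mem_range]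
  constructor
  · rintro ⟨x, hx, rfl⟩
    exact ⟨x.2, hx⟩
  · rintro ⟨hp, h⟩
    exact ⟨⟨p, hp⟩, h, rfl⟩

/-- All jobs have a common deadline (if `rev`), or a common release time. -/
def RigidInstance.Common {n : ℕ} (I : RigidInstance n) (rev : Bool) : Prop :=
  if rev then ∃ d : ℝ, ∀ j, I.deadline j = d else ∃ r : ℝ, ∀ j, I.release j = r

section

variable {rev : Bool} {r d a b a' b' : ℝ}

theorem placed_sub : placedHi rev r d a b - placedLo rev r d a b = b - a := by
  cases rev <;> simp [placedHi, placedLo]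

theorem Separate.placed (h : Separate a b a' b') :
    Separate (placedLo rev r d a b) (placedHi rev r d a b)
      (placedLo rev r d a' b') (placedHi rev r d a' b') := by
  unfold Separate at *
  cases rev
  · simpa [placedHi, placedLo] using h
  · simp only [placedHi, placedLo, if_true, sub_le_sub_iff_left]
    tauto

end

/-- The placement uses just one end of the window of job `i`, and that end is common to all jobs;
hence the data of one fixed job serve for placing every job. -/
theorem RigidInstance.Common.placed_mem {n : ℕ} {I : RigidInstance n} {rev : Bool}
    (h : I.Common rev) (i j : Fin n) {a b : ℝ} (ha : 0 ≤ a)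
    (hb : b ≤ I.deadline j - I.release j) :
    I.release j ≤ placedLo rev (I.release i) (I.deadline i) a b ∧
      placedHi rev (I.release i) (I.deadline i) a b ≤ I.deadline j := by
  cases rev <;> obtain ⟨r, hr⟩ := h
  · simp only [placedLo, placedHi, hr] at *
    constructor <;> simp <;> linarith
  · simp only [placedLo, placedHi, hr] at *
    constructor <;> simp <;> linarith

/-- Windows with one common end point are nested in the order of their lengths, as the lower bound
requires. -/
theorem RigidInstance.Common.window_subset {n : ℕ} {I : RigidInstance n} {rev : Bool}
    (h : I.Common rev) {i j : Fin n}
    (hij : I.deadline i - I.release i ≤ I.deadline j - I.release j) :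
    Set.Ico (I.release i) (I.deadline i) ⊆ Set.Ico (I.release j) (I.deadline j) := by
  refine Set.Ico_subset_Ico ?_ ?_ <;> cases rev <;> obtain ⟨r, hr⟩ := h <;>
    simp only [hr] at * <;> linarith

/-- The memory `s` describes the jobs and a list schedule of them, and `s'` describes the output
that `emitProgram` computes from `s`. -/
theorem pieces_of_emits {n : ℕ} {I : RigidInstance n} {rev : Bool} (hI : I.Common rev) (hn : 0 < n)
    {s s' : Memory} {e : Equiv.Perm (Fin n)} {L W p : ℕ → ℝ} (h : Planned I s e L W p)
    (hlist : ListSchedule n I.m (s.nat 11) (s.real 23) (s.real 36) (s.real 34) (s.real 35)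
      fun i k => ¬ Disjoint (s'.procSet I.m (s.nat 10 i)) (s'.procSet I.m (s.nat 10 k)))
    (hcard : ∀ i < n, (s'.procSet I.m (s.nat 10 i)).card = s.nat 11 i)
    (hem : s'.Emits n (s.nat 10) (s.real 24) (emitLo rev s) (emitHi rev s)
      (pieceCount n (s.nat 0 1) (s.nat 11))) :
    Pieces (outputSchedule I s') e W (fun i => p i / (3 - 4 / ((I.m : ℝ) + 1)))
      (pieceCount n I.m (s.nat 11)) (emitLo rev s) (emitHi rev s) := by
  have hm : 1 ≤ I.m := (I.one_le_size ⟨0, hn⟩).trans (I.size_le _)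
  have h1 := h.procs
  rw [h1] at hem
  have hsub : ∀ i g, emitHi rev s i g - emitLo rev s i g =
      pieceHi I.m (s.nat 11) (s.real 23) (s.real 36) (s.real 34) (s.real 35) i g -
      pieceLo I.m (s.nat 11) (s.real 23) (s.real 36) (s.real 34) (s.real 35) i g := fun i g => by
    rw [emitHi, emitLo, placed_sub, h1]
  have hsep : ∀ a b : Fin n, a < b →
      ¬ Disjoint ((outputSchedule I s').procs (e a)) ((outputSchedule I s').procs (e b)) →
      ∀ g < pieceCount n I.m (s.nat 11) a, ∀ g' < pieceCount n I.m (s.nat 11) b,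
        Separate (emitLo rev s a g) (emitHi rev s a g) (emitLo rev s b g') (emitHi rev s b g') := by
    intro a b hab hd g hg g' hg'
    rw [← Finset.disjoint_map Fin.valEmbedding, map_procs_outputSchedule, map_procs_outputSchedule,
      ← h.order, ← h.order] at hd
    simp only [emitLo, emitHi, h1]
    exact (hlist.separate_of_lt (i := a) (j := b) hab b.2 hd hg hg').placed
  refine ⟨fun j => ?_, h.work, fun i hi => ?_, fun a t => ?_, fun i hi g hg => ?_, fun i hi => ?_,
    fun i hi g hg g' hg' hne => ?_, fun a g hg hlt => ?_, fun a b hne hd g hg g' hg' => ?_⟩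
  · obtain ⟨a, rfl⟩ := e.surjective j
    rw [← Finset.card_map Fin.valEmbedding, map_procs_outputSchedule, ← h.order, hcard a a.2, h.size]
  · rw [← h.duration i hi]
    exact hlist.dur_pos i hi
  · have := hem a a.2 t
    rw [h.order, h.speed a a.2, h.duration a a.2] at this
    exact this
  · have := hlist.pieceLo_le hi hg
    linarith [hsub i g]
  · simp only [hsub]
    rw [hlist.sum_pieces hi, h.duration i hi]
  · simp only [emitLo, emitHi, h1]
    exact (hlist.separate_self hi hg hg' hne).placed
  -- Translation and reflection preserve lengths, so a nonempty output interval comes from a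
  -- nonempty piece.
  · have hw := hlist.piece_window h.optimal (fun i hi => ?_) hm h.mono h.duration a.2 hg
      (by linarith [hsub a g])
    · simp only [emitLo, emitHi, h1]
      rw [h.release ⟨0, hn⟩, h.deadline ⟨0, hn⟩]
      exact hI.placed_mem ⟨0, hn⟩ (e a) hw.1 (hw.2.trans_eq (h.length a))
    · rw [h.size ⟨i, hi⟩]
      exact I.one_le_size _
  · rcases hne.lt_or_gt with hab | hab
    · exact hsep a b hab hd g hg g' hg'
    · exact (hsep b a hab (fun h => hd h.symm) g' hg' g hg).symm

/-- Both cases share planning and list scheduling, which see only window lengths; `rev` affects only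
the placement of the intervals in time. -/
theorem exists_program (rev : Bool) : ∃ (A : Program) (C : ℕ), ∀ (n : ℕ) (I : RigidInstance n),
    0 < n → I.Common rev →
    ∃ (t : ℕ) (s : Memory), Exec A (inputMemory I) t s ∧ t ≤ C * n ^ 2 ∧
      ∀ α : ℝ, 1 < α →
        (outputSchedule I s).IsApproximate α ((3 - 4 / ((I.m : ℝ) + 1)) ^ (α - 1)) := by
  obtain ⟨K₁, hplan⟩ := plan_runs
  obtain ⟨K₂, hlist⟩ := list_runs
  refine ⟨.seq planProgram (.seq listProgram (emitProgram rev)),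
    K₁ + (K₂ + ((40 + (emitSmall rev).bound + (emitBig rev).bound) + 30)), fun n I hn hI => ?_⟩
  rw [add_mul K₁, add_mul K₂]
  change Runs _ _ _ fun s => ∀ α : ℝ, 1 < α →
    (outputSchedule I s).IsApproximate α ((3 - 4 / ((I.m : ℝ) + 1)) ^ (α - 1))
  refine Runs.seq (hplan n I hn) fun s1 _ ⟨e, L, W, p, h⟩ => ?_
  have hm : 1 ≤ I.m := (I.one_le_size ⟨0, hn⟩).trans (I.size_le _)
  have hinj : ∀ i < n, ∀ k < n, s1.nat 10 i = s1.nat 10 k → i = k := fun i hi k hk hik => by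
    rw [h.order ⟨i, hi⟩, h.order ⟨k, hk⟩] at hik
    exact congrArg Fin.val (e.injective (Fin.ext hik))
  have hρ : 0 < 3 - 4 / ((I.m : ℝ) + 1) := by
    have hm' : (1 : ℝ) ≤ I.m := by exact_mod_cast hm
    have : 4 / ((I.m : ℝ) + 1) ≤ 2 := by rw [div_le_iff₀ (by linarith)]; linarith
    linarith
  refine Runs.seq (hlist n I.m _ _ _ s1 hn h.jobs h.procs rfl rfl rfl
    (fun i hi => by rw [h.size ⟨i, hi⟩]; exact I.size_le _)
    (fun i hi => by rw [h.duration i hi]; exact div_pos (h.optimal.pos i hi) hρ) hinj)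
    fun s2 f2 ⟨hls, hcard⟩ => ?_
  have e0 := f2.1 0 (by decide)
  have e10 := f2.1 10 (by decide)
  have e11 := f2.1 11 (by decide)
  have r0 := f2.2 0 (by decide)
  have r1 := f2.2 1 (by decide)
  have r23 := f2.2 23 (by decide)
  have r24 := f2.2 24 (by decide)
  have h2 : Planned I s2 e L W p := by
    refine ⟨?_, ?_, ?_, ?_, h.length, h.work, h.mono, ?_, ?_, ?_, ?_, ?_⟩ <;>
      simp only [e0, e10, e11, r0, r1, r23, r24]
    exacts [h.jobs, h.procs, h.order, h.size, h.optimal, h.duration, h.speed, h.release,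
      h.deadline]
  refine Runs.imp (emit_runs rev hn h2.jobs (by rwa [e10])) fun s3 f3 ⟨h20, hem⟩ => ?_
  intro α hα
  -- Writing the intervals leaves the list of processor ranges intact, although both list lengths
  -- live in the same array.
  have hproc : ∀ J, s3.procSet I.m J = s2.procSet I.m J := fun J => by
    rw [Memory.procSet, Memory.procSet, h20, f3.1 3 (by cases rev <;> decide),
      f3.1 4 (by cases rev <;> decide), f3.1 5 (by cases rev <;> decide)]
  refine (pieces_of_emits hI hn h2 (by simpa only [hproc, e10, e11, r23] using hls)
    (by simpa only [hproc, e10, e11] using hcard) hem).isApproximate hρ h2.optimal h2.size h2.length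
    (fun a b hab => ?_) hα
  refine hI.window_subset ?_
  rw [← h2.length, ← h2.length]
  exact h2.mono a b hab b.2

end SpeedScaling

theorem theorem2 :
    -- common release time, individual deadlines
    (∃ (A : Program) (C : ℕ), ∀ (n : ℕ) (I : RigidInstance n), 0 < n →
      (∃ r : ℝ, ∀ j, I.release j = r) →
      ∃ (t : ℕ) (s : Memory), Exec A (inputMemory I) t s ∧ t ≤ C * n ^ 2 ∧
        ∀ α : ℝ, 1 < α →
          (outputSchedule I s).IsApproximate α ((3 - 4 / ((I.m : ℝ) + 1)) ^ (α - 1))) ∧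
    -- individual release times, common deadline
    (∃ (A : Program) (C : ℕ), ∀ (n : ℕ) (I : RigidInstance n), 0 < n →
      (∃ d : ℝ, ∀ j, I.deadline j = d) →
      ∃ (t : ℕ) (s : Memory), Exec A (inputMemory I) t s ∧ t ≤ C * n ^ 2 ∧
        ∀ α : ℝ, 1 < α →
          (outputSchedule I s).IsApproximate α ((3 - 4 / ((I.m : ℝ) + 1)) ^ (α - 1))) := by
  have h1 := exists_program false
  have h2 := exists_program true
  simp only [RigidInstance.Common, if_true, Bool.false_eq_true, if_false] at h1 h2
  exact ⟨h1, h2⟩
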